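/- Let $A$ be a stably finite simple unital C*-algebra which is not of type I, let $G$ be a finite group, and let $\alpha\colon G\to\operatorname{Aut}(A)$ be an action which is weakly tracially strictly approximately inner; that is, for every finite set $F\subset A$, every $\varepsilon>0$, and every positive $x\in A$ with $\|x\|=1$, there are a positive $c\in A$ with $\|c\|\le 1$ and $\alpha_g(c)=c$ for all $g\in G$, and contractions $s_g\in\overline{cAc}$ for $g\in G$, such that: (1) $\|s_1-c\|<\varepsilon$ and $\|s_g^*-s_{g^{-1}}\|<\varepsilon$ for all $g\in G$; (2) $\|s_gs_h-cs_{gh}\|<\varepsilon$ for all $g,h\in G$; (3) $\|ca-ac\|<\varepsilon$ for all $a\in F\cup\{s_g\colon g\in G\}$; (4) $\|\alpha_g(cac)-s_gas_g^*\|<\varepsilon$ for all $a\in F$ and $g\in G$; (5) $(1-c-\varepsilon)_+\precsim_A x$; (6) $\|cxc\|>1-\varepsilon$. (In particular, this covers tracially strictly approximately inner actions, where $c$ can be taken to be a projection and the $s_g$ unitaries in $cAc$.) Here, for a C*-algebra $D$ and positive $a,b\in M_\infty(D)$, $a\precsim_D b$ means that there is a sequence $(y_n)$ in $M_\infty(D)$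 with $y_nby_n^*\to a$; $W(D)$ is the set of classes $\langle a\rangle$ of positive elements $a$ of $M_\infty(D)$ under the relation "$a\precsim_D b$ and $b\precsim_D a$", with addition $\langle a\rangle+\langle b\rangle=\langle a\oplus b\rangle$ and the order induced by $\precsim_D$; and the Cuntz semigroup of $D$ is $\operatorname{Cu}(D)=W(\mathcal K\otimes D)$, where $\mathcal K$ is the algebra of compact operators on a separable infinite-dimensional Hilbert space. $\operatorname{Cu}_+(D)\subset\operatorname{Cu}(D)$ is the set of classes of positive elements $a\in\mathcal K\otimes D$ such that there is no projection $q\in M_\infty(\mathcal K\otimes D)$ with $\langle a\rangle=\langle q\rangle$. A subset $T$ of an ordered abelian semigroup is almost unperforated if, for all $x,y\in T$ and all integers $n\ge 1$, $(n+1)x\le ny$ implies $x\le y$. If $\operatorname{Cu}_+\big(C^*(G,A,\alpha)\big)\cup\{0\}$ is almost unperforated, then so is $\operatorname{Cu}(A)$. -/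

import Mathlib

set_option linter.unusedSectionVars false
open Filter Topology
open scoped CStarAlgebra

namespace CuntzSemigroup

noncomputable section Stabilization

variable (A : Type*) [NonUnitalCStarAlgebra A] [PartialOrder A] [StarOrderedRing A]

/-- The `n × n` matrix with upper left corner `M` and zeros elsewhere, for `m ≤ n`. -/
def cornerFun {m : ℕ} (n : ℕ) (M : CStarMatrix (Fin m) (Fin m) A) :
    CStarMatrix (Fin n) (Fin n) A :=
  CStarMatrix.ofMatrix (Matrix.of fun i j =>
    if h : i.1 < m ∧ j.1 < m then M ⟨i.1, h.1⟩ ⟨j.1, h.2⟩ else 0)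

theorem cornerFun_apply {m n : ℕ} (M : CStarMatrix (Fin m) (Fin m) A) (i j : Fin n) :
    cornerFun A n M i j = if h : i.1 < m ∧ j.1 < m then M ⟨i.1, h.1⟩ ⟨j.1, h.2⟩ else 0 :=
  rfl

/-- The corner embedding `M_m(A) → M_n(A)`, `a ↦ diag(a, 0)`, for `m ≤ n`. -/
def corner {m n : ℕ} (h : m ≤ n) :
    CStarMatrix (Fin m) (Fin m) A →⋆ₙₐ[ℂ] CStarMatrix (Fin n) (Fin n) A where
  toFun M := cornerFun A n M
  map_smul' c M := by
    ext i j
    by_cases hij : i.1 < m ∧ j.1 < m <;> simp [cornerFun_apply, hij]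
  map_zero' := by
    ext i j
    by_cases hij : i.1 < m ∧ j.1 < m <;> simp [cornerFun_apply]
  map_add' M N := by
    ext i j
    by_cases hij : i.1 < m ∧ j.1 < m <;> simp [cornerFun_apply, hij]
  map_mul' M N := by
    ext i j
    simp only [CStarMatrix.mul_apply, cornerFun_apply]
    by_cases hij : i.1 < m ∧ j.1 < m
    · rw [dif_pos hij]
      refine Fintype.sum_of_injective (Fin.castLE h) (Fin.castLE_injective h) _ _ ?_ ?_
      · intro k hk
        have : ¬ k.1 < m := fun hk' => hk ⟨⟨k.1, hk'⟩, rfl⟩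
        simp [this]
      · intro k
        simp [hij.1, hij.2]
    · rw [dif_neg hij]
      refine (Finset.sum_eq_zero fun k _ => ?_).symm
      by_cases hi : i.1 < m
      · have hj : ¬ j.1 < m := fun hj => hij ⟨hi, hj⟩
        simp [hj]
      · simp [hi]
  map_star' M := by
    ext i j
    simp only [CStarMatrix.star_apply, cornerFun_apply]
    by_cases hij : i.1 < m ∧ j.1 < m
    · rw [dif_pos hij, dif_pos hij.symm]
    · rw [dif_neg hij, dif_neg (fun h => hij h.symm), star_zero]

theorem corner_apply {m n : ℕ} (h : m ≤ n) (M : CStarMatrix (Fin m) (Fin m) A) (i j : Fin n) :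
    corner A h M i j = if h : i.1 < m ∧ j.1 < m then M ⟨i.1, h.1⟩ ⟨j.1, h.2⟩ else 0 :=
  rfl

theorem corner_injective {m n : ℕ} (h : m ≤ n) : Function.Injective (corner A h) := by
  intro M N hMN
  ext i j
  have := congrArg (fun X => X (Fin.castLE h i) (Fin.castLE h j)) hMN
  simpa [corner_apply] using this

theorem norm_corner {m n : ℕ} (h : m ≤ n) (M : CStarMatrix (Fin m) (Fin m) A) :
    ‖corner A h M‖ = ‖M‖ :=
  NonUnitalStarAlgHom.norm_map (corner A h) (corner_injective A h) M

instance : DirectedSystem (fun n : ℕ => CStarMatrix (Fin n) (Fin n) A)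
    (fun _ _ h => corner A h) where
  map_self i x := by
    ext a b
    simp [corner_apply]
  map_map k j i hij hjk x := by
    ext a b
    simp only [corner_apply]
    by_cases h : a.1 < i ∧ b.1 < i
    · have h' : a.1 < j ∧ b.1 < j := ⟨h.1.trans_le hij, h.2.trans_le hij⟩
      simp [h, h']
    · simp [h]

/-- `M_∞(A)`, the algebraic direct limit of the matrix algebras `M_n(A)` along the corner
embeddings. -/
def MInf : Type _ :=
  DirectLimit (fun n : ℕ => CStarMatrix (Fin n) (Fin n) A) (fun _ _ h => corner A h)

instance : NonUnitalRing (MInf A) :=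
  inferInstanceAs (NonUnitalRing (DirectLimit (fun n : ℕ => CStarMatrix (Fin n) (Fin n) A)
    (fun _ _ h => corner A h)))

instance : StarRing (MInf A) :=
  inferInstanceAs (StarRing (DirectLimit (fun n : ℕ => CStarMatrix (Fin n) (Fin n) A)
    (fun _ _ h => corner A h)))

instance : Module ℂ (MInf A) :=
  inferInstanceAs (Module ℂ (DirectLimit (fun n : ℕ => CStarMatrix (Fin n) (Fin n) A)
    (fun _ _ h => corner A h)))

instance : IsScalarTower ℂ (MInf A) (MInf A) :=
  inferInstanceAs (IsScalarTower ℂ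
    (DirectLimit (fun n : ℕ => CStarMatrix (Fin n) (Fin n) A) (fun _ _ h => corner A h))
    (DirectLimit (fun n : ℕ => CStarMatrix (Fin n) (Fin n) A) (fun _ _ h => corner A h)))

instance : SMulCommClass ℂ (MInf A) (MInf A) :=
  inferInstanceAs (SMulCommClass ℂ
    (DirectLimit (fun n : ℕ => CStarMatrix (Fin n) (Fin n) A) (fun _ _ h => corner A h))
    (DirectLimit (fun n : ℕ => CStarMatrix (Fin n) (Fin n) A) (fun _ _ h => corner A h)))

instance : StarModule ℂ (MInf A) :=
  inferInstanceAs (StarModule ℂ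
    (DirectLimit (fun n : ℕ => CStarMatrix (Fin n) (Fin n) A) (fun _ _ h => corner A h)))

/-- The canonical map `M_n(A) → M_∞(A)`. -/
def MInf.of {n : ℕ} (M : CStarMatrix (Fin n) (Fin n) A) : MInf A :=
  (⟦⟨n, M⟩⟧ : DirectLimit (fun n : ℕ => CStarMatrix (Fin n) (Fin n) A) (fun _ _ h => corner A h))

/-- The norm of `M_∞(A)`: the common norm of all representing matrices. -/
instance : Norm (MInf A) where
  norm x := DirectLimit.lift (fun _ _ h => corner A h)
    (fun _ M => ‖M‖) (fun _ _ h M => (norm_corner A h M).symm) x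

variable {A}

theorem MInf.induction {p : MInf A → Prop}
    (h : ∀ n (M : CStarMatrix (Fin n) (Fin n) A), p (MInf.of A M)) (x : MInf A) : p x :=
  DirectLimit.induction _ h x

theorem MInf.induction₂ {p : MInf A → MInf A → Prop}
    (h : ∀ n (M N : CStarMatrix (Fin n) (Fin n) A), p (MInf.of A M) (MInf.of A N))
    (x y : MInf A) : p x y :=
  DirectLimit.induction₂ _ h x y

theorem MInf.norm_of {n : ℕ} (M : CStarMatrix (Fin n) (Fin n) A) : ‖MInf.of A M‖ = ‖M‖ := rfl

theorem MInf.of_add {n : ℕ} (M N : CStarMatrix (Fin n) (Fin n) A) :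
    MInf.of A (M + N) = MInf.of A M + MInf.of A N := (DirectLimit.add_def (G := fun n : ℕ => CStarMatrix (Fin n) (Fin n) A)
    (f := fun _ _ h => corner A h) n M N).symm

theorem MInf.of_neg {n : ℕ} (M : CStarMatrix (Fin n) (Fin n) A) :
    MInf.of A (-M) = -MInf.of A M := (DirectLimit.neg_def (G := fun n : ℕ => CStarMatrix (Fin n) (Fin n) A)
    (f := fun _ _ h => corner A h) n M).symm

theorem MInf.of_mul {n : ℕ} (M N : CStarMatrix (Fin n) (Fin n) A) :
    MInf.of A (M * N) = MInf.of A M * MInf.of A N := (DirectLimit.mul_def (G := fun n : ℕ => CStarMatrix (Fin n) (Fin n) A)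
    (f := fun _ _ h => corner A h) n M N).symm

theorem MInf.of_smul {n : ℕ} (c : ℂ) (M : CStarMatrix (Fin n) (Fin n) A) :
    MInf.of A (c • M) = c • MInf.of A M := (DirectLimit.smul_def (G := fun n : ℕ => CStarMatrix (Fin n) (Fin n) A)
    (f := fun _ _ h => corner A h) n M c).symm

theorem MInf.of_star {n : ℕ} (M : CStarMatrix (Fin n) (Fin n) A) :
    MInf.of A (star M) = star (MInf.of A M) := (DirectLimit.star_def (G := fun n : ℕ => CStarMatrix (Fin n) (Fin n) A)
    (f := fun _ _ h => corner A h) n M).symm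

theorem MInf.of_zero (n : ℕ) : MInf.of A (0 : CStarMatrix (Fin n) (Fin n) A) = 0 :=
  (DirectLimit.zero_def (f := fun _ _ h => corner A h) n).symm

instance : NormedAddCommGroup (MInf A) :=
  AddGroupNorm.toNormedAddCommGroup
    { toFun := fun x => ‖x‖
      map_zero' := by rw [← MInf.of_zero 0, MInf.norm_of, norm_zero]
      add_le' := MInf.induction₂ fun n M N => by
        rw [← MInf.of_add, MInf.norm_of, MInf.norm_of, MInf.norm_of]; exact norm_add_le M N
      neg' := MInf.induction fun n M => by
        rw [← MInf.of_neg, MInf.norm_of, MInf.norm_of, norm_neg]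
      eq_zero_of_map_eq_zero' := MInf.induction fun n M h => by
        have h' : ‖M‖ = 0 := h
        rw [norm_eq_zero.1 h', MInf.of_zero] }

instance : NonUnitalNormedRing (MInf A) :=
  { (inferInstance : NormedAddCommGroup (MInf A)), (inferInstance : NonUnitalRing (MInf A)) with
    norm_mul_le := MInf.induction₂ fun n M N => by
      rw [← MInf.of_mul]; exact norm_mul_le M N }

instance : NormedSpace ℂ (MInf A) where
  norm_smul_le c := MInf.induction fun n M => by
    rw [← MInf.of_smul]; exact norm_smul_le c M

instance : CStarRing (MInf A) where
  norm_mul_self_le := MInf.induction fun n M => by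
    rw [← MInf.of_star, ← MInf.of_mul]
    exact (CStarRing.norm_star_mul_self (x := M)).ge

open UniformSpace in
/-- The stabilization `𝒦 ⊗ A`: the completion of `M_∞(A)` in its C*-norm. -/
def Stab (A : Type*) [NonUnitalCStarAlgebra A] [PartialOrder A] [StarOrderedRing A] : Type _ :=
  Completion (MInf A)

namespace Stab

open UniformSpace

instance : NormedAddCommGroup (Stab A) := inferInstanceAs (NormedAddCommGroup (Completion (MInf A)))

instance : NormedSpace ℂ (Stab A) := inferInstanceAs (NormedSpace ℂ (Completion (MInf A)))

instance : CompleteSpace (Stab A) := inferInstanceAs (CompleteSpace (Completion (MInf A)))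

/-- The inclusion of `M_∞(A)` as a dense subalgebra of `𝒦 ⊗ A`. -/
def ofMInf : MInf A →+ Stab A := (Completion.toCompl : MInf A →+ Completion (MInf A))

theorem isDenseInducing_ofMInf : IsDenseInducing (ofMInf : MInf A → Stab A) :=
  Completion.isDenseInducing_coe

theorem continuous_ofMInf : Continuous (ofMInf : MInf A → Stab A) :=
  isDenseInducing_ofMInf.continuous

theorem norm_ofMInf (x : MInf A) : ‖(ofMInf x : Stab A)‖ = ‖x‖ := Completion.norm_coe x

theorem ofMInf_smul (c : ℂ) (x : MInf A) : (ofMInf (c • x) : Stab A) = c • ofMInf x :=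
  Completion.coe_smul c x

theorem induction {p : Stab A → Prop} (hp : IsClosed {x | p x}) (h : ∀ x : MInf A, p (ofMInf x))
    (x : Stab A) : p x :=
  Completion.induction_on (α := MInf A) x hp h

theorem induction₂ {p : Stab A → Stab A → Prop} (hp : IsClosed {x : Stab A × Stab A | p x.1 x.2})
    (h : ∀ x y : MInf A, p (ofMInf x) (ofMInf y)) (x y : Stab A) : p x y :=
  Completion.induction_on₂ (α := MInf A) (β := MInf A) x y hp h

theorem induction₃ {p : Stab A → Stab A → Stab A → Prop}
    (hp : IsClosed {x : Stab A × Stab A × Stab A | p x.1 x.2.1 x.2.2})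
    (h : ∀ x y z : MInf A, p (ofMInf x) (ofMInf y) (ofMInf z)) (x y z : Stab A) : p x y z :=
  Completion.induction_on₃ (α := MInf A) (β := MInf A) (γ := MInf A) x y z hp h

/-- Multiplication of `𝒦 ⊗ A`, extended by continuity from `M_∞(A)`. -/
instance : Mul (Stab A) where
  mul x y := (isDenseInducing_ofMInf.prodMap isDenseInducing_ofMInf).extend
    (fun p : MInf A × MInf A => (ofMInf (p.1 * p.2) : Stab A)) (x, y)

/-- Involution of `𝒦 ⊗ A`, extended by continuity from `M_∞(A)`. -/
instance : Star (Stab A) where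
  star := Completion.map (star : MInf A → MInf A)

theorem ofMInf_mul (x y : MInf A) : (ofMInf (x * y) : Stab A) = ofMInf x * ofMInf y :=
  ((isDenseInducing_ofMInf.prodMap isDenseInducing_ofMInf).extend_eq
    (continuous_ofMInf.comp continuous_mul) (x, y)).symm

theorem ofMInf_star (x : MInf A) : (ofMInf (star x) : Stab A) = star (ofMInf x) :=
  (Completion.map_coe (star_isometry (E := MInf A)).uniformContinuous x).symm

instance : ContinuousMul (Stab A) where
  continuous_mul := by
    let m := (AddMonoidHom.mul : MInf A →+ MInf A →+ MInf A).compr₂ (ofMInf : MInf A →+ Stab A)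
    have : Continuous fun p : MInf A × MInf A => m p.1 p.2 :=
      continuous_ofMInf.comp continuous_mul
    have di : IsDenseInducing (ofMInf : MInf A →+ Stab A) := isDenseInducing_ofMInf
    exact (di.extend_Z_bilin di this :)

instance : ContinuousStar (Stab A) where
  continuous_star := (Completion.continuous_map : Continuous (Completion.map (star : MInf A → MInf A)))

theorem star_smul' (c : ℂ) (x : Stab A) : star (c • x) = star c • star x :=
  induction (p := fun x : Stab A => star (c • x) = star c • star x)
    (isClosed_eq (continuous_star.comp (continuous_const_smul c))
      ((continuous_const_smul (star c)).comp continuous_star)) (fun x => by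
      rw [← ofMInf_smul, ← ofMInf_star, ← ofMInf_star, ← ofMInf_smul, star_smul]) x

theorem smul_mul' (c : ℂ) (x y : Stab A) : (c • x) * y = c • (x * y) :=
  induction₂ (p := fun x y : Stab A => (c • x) * y = c • (x * y))
    (isClosed_eq (((continuous_const_smul c).comp continuous_fst).mul continuous_snd)
      ((continuous_const_smul c).comp continuous_mul)) (fun x y => by
      rw [← ofMInf_smul, ← ofMInf_mul, ← ofMInf_mul, ← ofMInf_smul, smul_mul_assoc]) x y

theorem mul_smul' (c : ℂ) (x y : Stab A) : x * (c • y) = c • (x * y) :=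
  induction₂ (p := fun x y : Stab A => x * (c • y) = c • (x * y))
    (isClosed_eq (continuous_fst.mul ((continuous_const_smul c).comp continuous_snd))
      ((continuous_const_smul c).comp continuous_mul)) (fun x y => by
      rw [← ofMInf_smul, ← ofMInf_mul, ← ofMInf_mul, ← ofMInf_smul, mul_smul_comm]) x y

instance : NonUnitalNormedRing (Stab A) :=
  { (inferInstance : NormedAddCommGroup (Stab A)), (inferInstance : Mul (Stab A)) with
    left_distrib := induction₃ (isClosed_eq (by fun_prop) (by fun_prop)) fun x y z => by
      rw [← map_add, ← ofMInf_mul, ← ofMInf_mul, ← ofMInf_mul, ← map_add, mul_add]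
    right_distrib := induction₃ (isClosed_eq (by fun_prop) (by fun_prop)) fun x y z => by
      rw [← map_add, ← ofMInf_mul, ← ofMInf_mul, ← ofMInf_mul, ← map_add, add_mul]
    zero_mul := induction (isClosed_eq (by fun_prop) (by fun_prop)) fun x => by
      rw [← map_zero (ofMInf : MInf A →+ Stab A), ← ofMInf_mul, zero_mul]
    mul_zero := induction (isClosed_eq (by fun_prop) (by fun_prop)) fun x => by
      rw [← map_zero (ofMInf : MInf A →+ Stab A), ← ofMInf_mul, mul_zero]
    mul_assoc := induction₃ (isClosed_eq (by fun_prop) (by fun_prop)) fun x y z => by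
      simp only [← ofMInf_mul, mul_assoc]
    norm_mul_le := induction₂ (isClosed_le (by fun_prop) (by fun_prop)) fun x y => by
      rw [← ofMInf_mul, norm_ofMInf, norm_ofMInf, norm_ofMInf]
      exact norm_mul_le x y }

theorem star_star' (x : Stab A) : star (star x) = x :=
  induction (p := fun x : Stab A => star (star x) = x)
    (isClosed_eq (by fun_prop) (by fun_prop)) (fun x => by
      rw [← ofMInf_star, ← ofMInf_star, star_star]) x

theorem star_mul' (x y : Stab A) : star (x * y) = star y * star x :=
  induction₂ (p := fun x y : Stab A => star (x * y) = star y * star x)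
    (isClosed_eq (by fun_prop) (by fun_prop)) (fun x y => by
      rw [← ofMInf_star, ← ofMInf_star, ← ofMInf_mul, ← ofMInf_star, ← ofMInf_mul, star_mul]) x y

theorem star_add' (x y : Stab A) : star (x + y) = star x + star y :=
  induction₂ (p := fun x y : Stab A => star (x + y) = star x + star y)
    (isClosed_eq (by fun_prop) (by fun_prop)) (fun x y => by
      rw [← ofMInf_star, ← ofMInf_star, ← map_add, ← ofMInf_star, ← map_add, star_add]) x y

theorem norm_mul_self_le' (x : Stab A) : ‖x‖ * ‖x‖ ≤ ‖star x * x‖ :=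
  induction (p := fun x : Stab A => ‖x‖ * ‖x‖ ≤ ‖star x * x‖)
    (isClosed_le (by fun_prop) (by fun_prop)) (fun x => by
      rw [← ofMInf_star, ← ofMInf_mul, norm_ofMInf, norm_ofMInf]
      exact (CStarRing.norm_star_mul_self (x := x)).ge) x

instance : StarRing (Stab A) where
  star_involutive := star_star'
  star_mul := star_mul'
  star_add := star_add'

/-- `𝒦 ⊗ A` is a C*-algebra. -/
instance : NonUnitalCStarAlgebra (Stab A) where
  norm_mul_self_le := norm_mul_self_le'
  smul_assoc c x y := smul_mul' c x y
  smul_comm c x y := (mul_smul' c x y).symm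
  star_smul := star_smul'

instance : PartialOrder (Stab A) := CStarAlgebra.spectralOrder (Stab A)

instance : StarOrderedRing (Stab A) := CStarAlgebra.spectralOrderedRing (Stab A)

end Stab

end Stabilization
noncomputable section CuntzComparison

variable {D : Type*} [NonUnitalCStarAlgebra D]

/-- Cuntz subequivalence `a ≾ b` of square matrices over `D`, possibly of different sizes:
`y_k b y_k^* → a` in norm for some sequence `y_k` of matrices over `D` of the fitting rectangular
size. (Cutting down by corners, this is the same as taking `y_k` in `M_∞(D)`.) -/
def CuntzSub {m n : Type*} [Fintype m] [Fintype n] (a : CStarMatrix m m D)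
    (b : CStarMatrix n n D) : Prop :=
  ∃ y : ℕ → CStarMatrix m n D, Tendsto (fun k => y k * b * (y k).conjTranspose) atTop (𝓝 a)

/-- The `1 × 1` matrix with entry `a`, that is, `a` regarded as an element of `M_∞(D)`. -/
def oneByOne (a : D) : CStarMatrix (Fin 1) (Fin 1) D := CStarMatrix.ofMatrix (Matrix.of fun _ _ => a)

/-- The block diagonal matrix `a ⊕ b`. -/
def dsum {m m' n n' : ℕ} (a : CStarMatrix (Fin m) (Fin m') D) (b : CStarMatrix (Fin n) (Fin n') D) :
    CStarMatrix (Fin (m + n)) (Fin (m' + n')) D :=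
  CStarMatrix.ofMatrix (Matrix.reindex finSumFinEquiv finSumFinEquiv
    (Matrix.fromBlocks (CStarMatrix.ofMatrix.symm a) 0 0 (CStarMatrix.ofMatrix.symm b)))

section dsum

variable {m m' n n' k k' : ℕ} (a : CStarMatrix (Fin m) (Fin m') D)
  (b : CStarMatrix (Fin n) (Fin n') D)

@[simp] theorem dsum_left_left (i : Fin m) (j : Fin m') :
    dsum a b (Fin.castAdd n i) (Fin.castAdd n' j) = a i j := by
  change Matrix.fromBlocks _ _ _ _ (finSumFinEquiv.symm (Fin.castAdd n i))
    (finSumFinEquiv.symm (Fin.castAdd n' j)) = _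
  rw [finSumFinEquiv_symm_apply_castAdd, finSumFinEquiv_symm_apply_castAdd]
  rfl

@[simp] theorem dsum_left_right (i : Fin m) (j : Fin n') :
    dsum a b (Fin.castAdd n i) (Fin.natAdd m' j) = 0 := by
  change Matrix.fromBlocks _ _ _ _ (finSumFinEquiv.symm (Fin.castAdd n i))
    (finSumFinEquiv.symm (Fin.natAdd m' j)) = _
  rw [finSumFinEquiv_symm_apply_castAdd, finSumFinEquiv_symm_apply_natAdd]
  rfl

@[simp] theorem dsum_right_left (i : Fin n) (j : Fin m') :
    dsum a b (Fin.natAdd m i) (Fin.castAdd n' j) = 0 := by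
  change Matrix.fromBlocks _ _ _ _ (finSumFinEquiv.symm (Fin.natAdd m i))
    (finSumFinEquiv.symm (Fin.castAdd n' j)) = _
  rw [finSumFinEquiv_symm_apply_castAdd, finSumFinEquiv_symm_apply_natAdd]
  rfl

@[simp] theorem dsum_right_right (i : Fin n) (j : Fin n') :
    dsum a b (Fin.natAdd m i) (Fin.natAdd m' j) = b i j := by
  change Matrix.fromBlocks _ _ _ _ (finSumFinEquiv.symm (Fin.natAdd m i))
    (finSumFinEquiv.symm (Fin.natAdd m' j)) = _
  rw [finSumFinEquiv_symm_apply_natAdd, finSumFinEquiv_symm_apply_natAdd]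
  rfl

theorem dsum_mul (c : CStarMatrix (Fin m') (Fin k) D) (d : CStarMatrix (Fin n') (Fin k') D) :
    dsum a b * dsum c d = dsum (a * c) (b * d) := by
  ext i j
  rw [CStarMatrix.mul_apply, Fin.sum_univ_add]
  induction i using Fin.addCases <;> induction j using Fin.addCases <;>
    simp [CStarMatrix.mul_apply]

theorem conjTranspose_dsum :
    (dsum a b).conjTranspose = dsum a.conjTranspose b.conjTranspose := by
  ext i j
  rw [CStarMatrix.conjTranspose_apply]
  induction i using Fin.addCases <;> induction j using Fin.addCases <;>
    simp [CStarMatrix.conjTranspose_apply]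

end dsum

theorem cuntzSub_iff [PartialOrder D] [StarOrderedRing D] {m n : Type*} [Fintype m] [Fintype n]
    {a : CStarMatrix m m D} {b : CStarMatrix n n D} :
    CuntzSub a b ↔ a ∈ closure (Set.range fun y : CStarMatrix m n D => y * b * y.conjTranspose) := by
  rw [mem_closure_iff_seq_limit]
  constructor
  · rintro ⟨y, hy⟩
    exact ⟨_, fun k => ⟨y k, rfl⟩, hy⟩
  · rintro ⟨x, hx, hxa⟩
    choose y hy using hx
    exact ⟨y, by simpa only [hy] using hxa⟩

theorem continuous_entrywise {X m n : Type*} [TopologicalSpace X] {F : X → CStarMatrix m n D}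
    (h : ∀ i j, Continuous fun x => F x i j) : Continuous F :=
  (continuous_pi fun i => continuous_pi fun j => h i j : Continuous fun x => (F x : m → n → D))

theorem tendsto_entrywise {X m n : Type*} {l : Filter X} {F : X → CStarMatrix m n D}
    {M : CStarMatrix m n D} (h : ∀ i j, Tendsto (fun x => F x i j) l (𝓝 (M i j))) :
    Tendsto F l (𝓝 M) :=
  (tendsto_pi_nhds.2 fun i => tendsto_pi_nhds.2 fun j => h i j :
    Tendsto (fun x => (F x : m → n → D)) l (𝓝 (M : m → n → D)))

theorem tendsto_entry {X m n : Type*} {l : Filter X} {F : X → CStarMatrix m n D}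
    {M : CStarMatrix m n D} (h : Tendsto F l (𝓝 M)) (i : m) (j : n) :
    Tendsto (fun x => F x i j) l (𝓝 (M i j)) :=
  tendsto_pi_nhds.1 (tendsto_pi_nhds.1
    (h : Tendsto (fun x => (F x : m → n → D)) l (𝓝 (M : m → n → D))) i) j

theorem CuntzSub.trans [PartialOrder D] [StarOrderedRing D] {m n k : Type*} [Fintype m] [Fintype n]
    [Fintype k] {a : CStarMatrix m m D} {b : CStarMatrix n n D} {c : CStarMatrix k k D}
    (hab : CuntzSub a b) (hbc : CuntzSub b c) : CuntzSub a c := by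
  rw [cuntzSub_iff] at *
  refine closure_minimal ?_ isClosed_closure hab
  rintro _ ⟨y, rfl⟩
  have hcont : Continuous fun x : CStarMatrix n n D => y * x * y.conjTranspose := by
    refine continuous_entrywise fun i j => ?_
    simp only [CStarMatrix.mul_apply]
    refine continuous_finsetSum _ fun p _ => Continuous.mul (continuous_finsetSum _ fun q _ =>
      Continuous.mul continuous_const ?_) continuous_const
    exact (continuous_apply_apply q p : Continuous fun x : n → n → D => x q p)
  refine map_mem_closure (f := fun x : CStarMatrix n n D => y * x * y.conjTranspose) hcont hbc ?_
  rintro _ ⟨z, rfl⟩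
  refine ⟨y * z, ?_⟩
  have h1 : (y * z).conjTranspose = z.conjTranspose * y.conjTranspose :=
    Matrix.conjTranspose_mul (CStarMatrix.ofMatrix.symm y) (CStarMatrix.ofMatrix.symm z)
  simp only [h1]
  have h2 : ∀ (y : Matrix m n D) (z : Matrix n k D) (c : Matrix k k D) (z' : Matrix k n D)
      (y' : Matrix n m D), y * z * c * (z' * y') = y * (z * c * z') * y' := by
    intro y z c z' y'
    simp only [Matrix.mul_assoc]
  exact h2 y z c z.conjTranspose y.conjTranspose

theorem tendsto_approximateUnit [PartialOrder D] [StarOrderedRing D] (x : D) :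
    Tendsto (fun e : D => e * x * star e) (CStarAlgebra.approximateUnit D) (𝓝 x) := by
  have hl := CStarAlgebra.increasingApproximateUnit D
  have h1 : Tendsto (fun e : D => e * x) (CStarAlgebra.approximateUnit D) (𝓝 x) :=
    hl.tendsto_mul_right x
  have h2 : Tendsto (fun e : D => x * star e) (CStarAlgebra.approximateUnit D) (𝓝 x) := by
    refine (hl.tendsto_mul_left x).congr' ?_
    filter_upwards [hl.eventually_star_eq] with e he
    rw [he]
  rw [tendsto_iff_norm_sub_tendsto_zero] at h1 h2 ⊢
  have h3 := h1.add h2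
  rw [add_zero] at h3
  refine squeeze_zero' (Eventually.of_forall fun _ => norm_nonneg _) ?_ h3
  filter_upwards [hl.eventually_norm] with e he
  have : e * x * star e - x = (e * x - x) * star e + (x * star e - x) := by
    rw [sub_mul]; abel
  rw [this]
  refine (norm_add_le _ _).trans (add_le_add ((norm_mul_le _ _).trans ?_) le_rfl)
  rw [norm_star]
  exact mul_le_of_le_one_right (norm_nonneg _) he

/-- A matrix is Cuntz equivalent to every matrix obtained from it by inserting zero rows and
columns and relabelling. -/
theorem cuntzSub_of_embedding [PartialOrder D] [StarOrderedRing D] {m n : Type*} [Fintype m]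
    [Fintype n] (f : m ↪ n) {a : CStarMatrix m m D} {b : CStarMatrix n n D}
    (h : ∀ i j, b (f i) (f j) = a i j) (hl : ∀ i j, i ∉ Set.range f → b i j = 0)
    (hr : ∀ i j, j ∉ Set.range f → b i j = 0) : CuntzSub a b ∧ CuntzSub b a := by
  classical
  let l := CStarAlgebra.approximateUnit D
  let y : D → CStarMatrix m n D := fun e =>
    CStarMatrix.ofMatrix (Matrix.of fun i j => if f i = j then e else 0)
  have hy : ∀ e i j, y e i j = if f i = j then e else 0 := fun e i j => rfl
  constructor
  · rw [cuntzSub_iff]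
    refine mem_closure_of_tendsto (f := fun e => y e * b * (y e).conjTranspose) (b := l) ?_
      (Eventually.of_forall fun e => ⟨y e, rfl⟩)
    refine tendsto_entrywise fun i j => ?_
    have : ∀ e, (y e * b * (y e).conjTranspose) i j = e * a i j * star e := by
      intro e
      simp [CStarMatrix.mul_apply, hy, h, CStarMatrix.conjTranspose_apply, apply_ite star]
    simp only [this]
    exact tendsto_approximateUnit _
  · rw [cuntzSub_iff]
    refine mem_closure_of_tendsto
      (f := fun e => (y e).conjTranspose * a * (y e).conjTranspose.conjTranspose) (b := l) ?_
      (Eventually.of_forall fun e => ⟨(y e).conjTranspose, rfl⟩)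
    refine tendsto_entrywise fun i j => ?_
    have : ∀ e, ((y e).conjTranspose * a * (y e).conjTranspose.conjTranspose) i j
        = star e * b i j * star (star e) := by
      intro e
      by_cases hi : i ∈ Set.range f
      · by_cases hj : j ∈ Set.range f
        · obtain ⟨i, rfl⟩ := hi
          obtain ⟨j, rfl⟩ := hj
          simp [CStarMatrix.mul_apply, hy, h, CStarMatrix.conjTranspose_apply, apply_ite star]
        · have hj' : ∀ k, f k ≠ j := fun k hk => hj ⟨k, hk⟩
          simp [CStarMatrix.mul_apply, hy, hr i j hj, CStarMatrix.conjTranspose_apply, hj']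
      · have hi' : ∀ k, f k ≠ i := fun k hk => hi ⟨k, hk⟩
        simp [CStarMatrix.mul_apply, hy, hl i j hi, CStarMatrix.conjTranspose_apply, hi']
    simp only [this]
    refine (tendsto_approximateUnit (b i j)).congr' ?_
    filter_upwards [(CStarAlgebra.increasingApproximateUnit D).eventually_star_eq] with e he
    rw [he, he]

theorem CuntzSub.refl [PartialOrder D] [StarOrderedRing D] {m : Type*} [Fintype m]
    (a : CStarMatrix m m D) : CuntzSub a a :=
  (cuntzSub_of_embedding (Function.Embedding.refl m) (fun _ _ => rfl)
    (fun i _ hi => (hi ⟨i, rfl⟩).elim) (fun _ j hj => (hj ⟨j, rfl⟩).elim)).1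

theorem CuntzSub.dsum {m m' n n' : ℕ} {a : CStarMatrix (Fin m) (Fin m) D}
    {a' : CStarMatrix (Fin m') (Fin m') D} {b : CStarMatrix (Fin n) (Fin n) D}
    {b' : CStarMatrix (Fin n') (Fin n') D} (ha : CuntzSub a a') (hb : CuntzSub b b') :
    CuntzSub (dsum a b) (dsum a' b') := by
  obtain ⟨y, hy⟩ := ha
  obtain ⟨z, hz⟩ := hb
  refine ⟨fun k => CuntzSemigroup.dsum (y k) (z k), ?_⟩
  simp only [conjTranspose_dsum, dsum_mul]
  refine tendsto_entrywise fun i j => ?_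
  induction i using Fin.addCases <;> induction j using Fin.addCases
  · simpa using tendsto_entry hy _ _
  · simp
  · simp
  · simpa using tendsto_entry hz _ _

end CuntzComparison

noncomputable section CuntzSemigroups

variable (D : Type*) [NonUnitalCStarAlgebra D] [PartialOrder D] [StarOrderedRing D]

/-- The positive elements of `M_∞(D)`, each presented in a matrix algebra `M_n(D)` containing it. -/
def PosMat : Type _ := Σ n : ℕ, {a : CStarMatrix (Fin n) (Fin n) D // 0 ≤ a}

instance : Preorder (PosMat D) where
  le a b := CuntzSub a.2.1 b.2.1
  le_refl a := CuntzSub.refl a.2.1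
  le_trans _ _ _ := CuntzSub.trans

/-- The semigroup `W(D) = M_∞(D)_+ / ∼`, where `a ∼ b` means `a ≾ b` and `b ≾ a`, with the partial
order induced by `≾`. -/
def W : Type _ := Antisymmetrization (PosMat D) (· ≤ ·)

instance : PartialOrder (W D) := inferInstanceAs (PartialOrder (Antisymmetrization (PosMat D) (· ≤ ·)))

variable {D}

/-- The class `⟨a⟩` of a positive element of `M_n(D) ⊆ M_∞(D)`. -/
def cls {n : ℕ} (a : CStarMatrix (Fin n) (Fin n) D) (ha : 0 ≤ a) : W D :=
  toAntisymmetrization (· ≤ ·) (⟨n, a, ha⟩ : PosMat D)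

theorem cls_le_cls {m n : ℕ} {a : CStarMatrix (Fin m) (Fin m) D} {ha : 0 ≤ a}
    {b : CStarMatrix (Fin n) (Fin n) D} {hb : 0 ≤ b} : cls a ha ≤ cls b hb ↔ CuntzSub a b :=
  Iff.rfl

theorem W.induction {p : W D → Prop}
    (h : ∀ n (a : CStarMatrix (Fin n) (Fin n) D) (ha : 0 ≤ a), p (cls a ha)) (x : W D) : p x :=
  Quotient.inductionOn x fun a => h a.1 a.2.1 a.2.2

theorem cls_eq_of_embedding {m n : ℕ} (f : Fin m ↪ Fin n) {a : CStarMatrix (Fin m) (Fin m) D}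
    {ha : 0 ≤ a} {b : CStarMatrix (Fin n) (Fin n) D} {hb : 0 ≤ b}
    (h : ∀ i j, b (f i) (f j) = a i j) (hl : ∀ i j, i ∉ Set.range f → b i j = 0)
    (hr : ∀ i j, j ∉ Set.range f → b i j = 0) : cls a ha = cls b hb :=
  le_antisymm (cuntzSub_of_embedding f h hl hr).1 (cuntzSub_of_embedding f h hl hr).2

theorem nonneg_iff_exists {E : Type*} [NonUnitalCStarAlgebra E] [PartialOrder E] [StarOrderedRing E]
    {a : E} : 0 ≤ a ↔ ∃ x, a = star x * x :=
  CStarAlgebra.nonneg_iff_eq_star_mul_self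

theorem dsum_nonneg {m n : ℕ} {a : CStarMatrix (Fin m) (Fin m) D} (ha : 0 ≤ a)
    {b : CStarMatrix (Fin n) (Fin n) D} (hb : 0 ≤ b) : 0 ≤ dsum a b := by
  obtain ⟨x, rfl⟩ := nonneg_iff_exists.1 ha
  obtain ⟨y, rfl⟩ := nonneg_iff_exists.1 hb
  have : dsum (star x * x) (star y * y) = star (dsum x y) * dsum x y := by
    rw [CStarMatrix.star_eq_conjTranspose (M := dsum x y), conjTranspose_dsum]
    exact (dsum_mul _ _ _ _).symm
  rw [this]
  exact star_mul_self_nonneg _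

theorem oneByOne_nonneg {a : D} (ha : 0 ≤ a) : 0 ≤ oneByOne a := by
  obtain ⟨x, rfl⟩ := nonneg_iff_exists.1 ha
  have : oneByOne (star x * x) = star (oneByOne x) * oneByOne x := by
    ext i j
    rw [CStarMatrix.mul_apply, Fin.sum_univ_one, CStarMatrix.star_apply]
    rfl
  rw [this]
  exact star_mul_self_nonneg _

theorem projection_nonneg {n : ℕ} {q : CStarMatrix (Fin n) (Fin n) D} (hq : IsStarProjection q) :
    0 ≤ q := by
  have h : star q * q = q := by
    rw [hq.isSelfAdjoint.star_eq, hq.isIdempotentElem.eq]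
  rw [← h]
  exact star_mul_self_nonneg q

instance : Zero (W D) := ⟨cls (0 : CStarMatrix (Fin 0) (Fin 0) D) le_rfl⟩

/-- Addition in `W(D)`: `⟨a⟩ + ⟨b⟩ = ⟨a ⊕ b⟩`. -/
instance : Add (W D) where
  add := Quotient.map₂
    (fun a b : PosMat D => (⟨a.1 + b.1, dsum a.2.1 b.2.1, dsum_nonneg a.2.2 b.2.2⟩ : PosMat D))
    (fun _ _ h _ _ h' => ⟨CuntzSub.dsum h.1 h'.1, CuntzSub.dsum h.2 h'.2⟩)

theorem cls_add_cls {m n : ℕ} {a : CStarMatrix (Fin m) (Fin m) D} (ha : 0 ≤ a)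
    {b : CStarMatrix (Fin n) (Fin n) D} (hb : 0 ≤ b) :
    cls a ha + cls b hb = cls (dsum a b) (dsum_nonneg ha hb) := rfl

theorem cls_eq_of_equiv {m n : ℕ} (f : Fin m ≃ Fin n) {a : CStarMatrix (Fin m) (Fin m) D}
    {ha : 0 ≤ a} {b : CStarMatrix (Fin n) (Fin n) D} {hb : 0 ≤ b}
    (h : ∀ i j, b (f i) (f j) = a i j) : cls a ha = cls b hb :=
  cls_eq_of_embedding f.toEmbedding h (fun i _ hi => (hi (f.surjective i)).elim)
    (fun _ j hj => (hj (f.surjective j)).elim)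

theorem W.add_assoc' (x y z : W D) : x + y + z = x + (y + z) := by
  induction x using W.induction with | _ m a ha
  induction y using W.induction with | _ n b hb
  induction z using W.induction with | _ k c hc
  simp only [cls_add_cls]
  let f : Fin (m + n + k) ≃ Fin (m + (n + k)) := finCongr (Nat.add_assoc m n k)
  have f1 : ∀ i : Fin m, f (Fin.castAdd k (Fin.castAdd n i)) = Fin.castAdd (n + k) i :=
    fun i => rfl
  have f2 : ∀ i : Fin n, f (Fin.castAdd k (Fin.natAdd m i)) = Fin.natAdd m (Fin.castAdd k i) :=
    fun i => rfl
  have f3 : ∀ i : Fin k, f (Fin.natAdd (m + n) i) = Fin.natAdd m (Fin.natAdd n i) :=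
    fun i => Fin.ext (Nat.add_assoc m n i)
  refine cls_eq_of_equiv f fun i j => ?_
  induction i using Fin.addCases with
  | left i =>
    induction j using Fin.addCases with
    | left j =>
      induction i using Fin.addCases <;> induction j using Fin.addCases <;> simp [f1, f2]
    | right j => induction i using Fin.addCases <;> simp [f1, f2, f3]
  | right i =>
    induction j using Fin.addCases with
    | left j => induction j using Fin.addCases <;> simp [f1, f2, f3]
    | right j => simp [f3]

theorem W.add_comm' (x y : W D) : x + y = y + x := by
  induction x using W.induction with | _ m a ha
  induction y using W.induction with | _ n b hb
  simp only [cls_add_cls]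
  refine cls_eq_of_equiv finAddFlip fun i j => ?_
  induction i using Fin.addCases <;> induction j using Fin.addCases <;> simp

theorem W.add_zero' (x : W D) : x + 0 = x := by
  induction x using W.induction with | _ m a ha
  change cls a ha + cls (0 : CStarMatrix (Fin 0) (Fin 0) D) le_rfl = cls a ha
  rw [cls_add_cls]
  symm
  exact cls_eq_of_equiv (finCongr (Nat.add_zero m).symm) fun i j =>
    dsum_left_left a (0 : CStarMatrix (Fin 0) (Fin 0) D) i j

instance : AddCommMonoid (W D) where
  add_assoc := W.add_assoc'
  zero_add x := (W.add_comm' 0 x).trans (W.add_zero' x)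
  add_zero := W.add_zero'
  add_comm := W.add_comm'
  nsmul := nsmulRec

instance : IsOrderedAddMonoid (W D) where
  add_le_add_left x y h z := by
    induction x using W.induction with | _ m a ha
    induction y using W.induction with | _ n b hb
    induction z using W.induction with | _ k c hc
    exact CuntzSub.dsum h (CuntzSub.refl c)

end CuntzSemigroups

noncomputable section CrossedProducts

/-- The crossed product `C*(G, A, α)` of a unital C*-algebra `A` by an action `α` of a finite group
`G`: the functions `a : G → A`, thought of as `∑ g, a g u_g`, with the convolution product
`(a u_g) (b u_h) = a α_g(b) u_{gh}` and involution `(a u_g)^* = α_{g⁻¹}(a^*) u_{g⁻¹}`. -/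
def CrossedProduct {G A : Type*} [Group G] [CStarAlgebra A] (_α : G →* (A ≃⋆ₐ[ℂ] A)) : Type _ :=
  G → A

namespace CrossedProduct

variable {G A : Type*} [Group G] [Fintype G] [CStarAlgebra A] {α : G →* (A ≃⋆ₐ[ℂ] A)}

instance : AddCommGroup (CrossedProduct α) := inferInstanceAs (AddCommGroup (G → A))

instance : Module ℂ (CrossedProduct α) := inferInstanceAs (Module ℂ (G → A))

instance : Mul (CrossedProduct α) where
  mul a b := fun g => ∑ h, a h * α h (b (h⁻¹ * g))

open Classical in
instance : One (CrossedProduct α) where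
  one := fun g => if g = 1 then 1 else 0

instance : Star (CrossedProduct α) where
  star a := fun g => α g (star (a g⁻¹))

/-- The regular representation of `C*(G, A, α)` by matrices over `A` indexed by `G`. -/
def reg (a : CrossedProduct α) : CStarMatrix G G A :=
  CStarMatrix.ofMatrix (Matrix.of fun g h => α g⁻¹ (a (g * h⁻¹)))

theorem reg_apply (a : CrossedProduct α) (g h : G) : reg a g h = α g⁻¹ (a (g * h⁻¹)) := rfl

theorem action_mul (g h : G) (x : A) : α (g * h) x = α g (α h x) := by
  rw [map_mul]; rfl

theorem action_one (x : A) : α 1 x = x := by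
  rw [map_one]; rfl

theorem reg_injective : Function.Injective (reg : CrossedProduct α → CStarMatrix G G A) := by
  intro a b h
  funext g
  have := congrArg (fun M => M 1 g⁻¹) h
  simpa [reg_apply, action_one] using this

theorem reg_add (a b : CrossedProduct α) : reg (a + b) = reg a + reg b := by
  ext g h
  exact map_add (α g⁻¹) _ _

theorem reg_zero : reg (0 : CrossedProduct α) = 0 := by
  ext g h
  exact map_zero (α g⁻¹)

theorem reg_smul (c : ℂ) (a : CrossedProduct α) : reg (c • a) = c • reg a := by
  ext g h
  exact map_smul (α g⁻¹) _ _

theorem reg_mul (a b : CrossedProduct α) : reg (a * b) = reg a * reg b := by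
  ext g h
  rw [CStarMatrix.mul_apply, reg_apply]
  change α g⁻¹ (∑ x, a x * α x (b (x⁻¹ * (g * h⁻¹)))) = _
  rw [map_sum]
  refine Fintype.sum_equiv ((Equiv.inv G).trans (Equiv.mulRight g)) _ _ fun x => ?_
  simp only [Equiv.trans_apply, Equiv.inv_apply, Equiv.coe_mulRight, reg_apply, map_mul (α g⁻¹),
    ← action_mul]
  simp [mul_assoc]

open Classical in
theorem reg_one : reg (1 : CrossedProduct α) = 1 := by
  ext g h
  rw [CStarMatrix.one_apply, reg_apply]
  change α g⁻¹ (if g * h⁻¹ = 1 then 1 else 0) = _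
  by_cases hgh : g = h
  · simp [hgh]
  · have : ¬ g * h⁻¹ = 1 := fun h' => hgh (mul_inv_eq_one.1 h')
    simp [hgh, this]

theorem reg_star (a : CrossedProduct α) : reg (star a) = star (reg a) := by
  ext g h
  rw [CStarMatrix.star_apply, reg_apply, reg_apply]
  change α g⁻¹ (α (g * h⁻¹) (star (a (g * h⁻¹)⁻¹))) = _
  rw [← action_mul, ← map_star]
  simp

open Classical in
instance : Ring (CrossedProduct α) :=
  { (inferInstance : AddCommGroup (CrossedProduct α)),
    (inferInstance : Mul (CrossedProduct α)), (inferInstance : One (CrossedProduct α)) with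
    left_distrib := fun a b c => reg_injective (by simp only [reg_mul, reg_add, mul_add])
    right_distrib := fun a b c => reg_injective (by simp only [reg_mul, reg_add, add_mul])
    zero_mul := fun a => reg_injective (by rw [reg_mul, reg_zero, zero_mul])
    mul_zero := fun a => reg_injective (by rw [reg_mul, reg_zero, mul_zero])
    mul_assoc := fun a b c => reg_injective (by simp only [reg_mul, mul_assoc])
    one_mul := fun a => reg_injective (by rw [reg_mul, reg_one, one_mul])
    mul_one := fun a => reg_injective (by rw [reg_mul, reg_one, mul_one]) }

instance : StarRing (CrossedProduct α) where
  star_involutive a := reg_injective (by rw [reg_star, reg_star, star_star])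
  star_mul a b := reg_injective (by simp only [reg_star, reg_mul, star_mul])
  star_add a b := reg_injective (by simp only [reg_star, reg_add, star_add])

instance : Algebra ℂ (CrossedProduct α) :=
  Algebra.ofModule
    (fun c a b => reg_injective (by rw [reg_mul, reg_smul, reg_smul, reg_mul]; exact CStarMatrix.smul_mul c _ _))
    (fun c a b => reg_injective (by rw [reg_mul, reg_smul, reg_smul, reg_mul]; exact CStarMatrix.mul_smul _ c _))

instance : StarModule ℂ (CrossedProduct α) where
  star_smul c a := reg_injective (by simp only [reg_star, reg_smul, star_smul])

/-- The regular representation as a ring homomorphism. -/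
def regHom : CrossedProduct α →ₙ+* CStarMatrix G G A where
  toFun := reg
  map_mul' := reg_mul
  map_zero' := reg_zero
  map_add' := reg_add

variable [PartialOrder A] [StarOrderedRing A]

/-- The C*-norm of `C*(G, A, α)` (there is only one): the norm in the regular representation, which
is faithful. -/
instance : NormedRing (CrossedProduct α) :=
  { NonUnitalNormedRing.induced (CrossedProduct α) (CStarMatrix G G A) regHom reg_injective,
    (inferInstance : Ring (CrossedProduct α)) with }

theorem norm_def (a : CrossedProduct α) : ‖a‖ = ‖reg a‖ := rfl

theorem isometry_reg : Isometry (reg : CrossedProduct α → CStarMatrix G G A) :=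
  AddMonoidHomClass.isometry_of_norm (regHom : CrossedProduct α →ₙ+* CStarMatrix G G A)
    fun _ => rfl

theorem range_reg : Set.range (reg : CrossedProduct α → CStarMatrix G G A) =
    {M | ∀ g h, M g h = α g⁻¹ (M 1 (h * g⁻¹))} := by
  ext M
  constructor
  · rintro ⟨a, rfl⟩ g h
    simp [reg_apply]
  · intro hM
    let a : CrossedProduct α := fun g => M (1 : G) g⁻¹
    have ha : ∀ g, a g = M (1 : G) g⁻¹ := fun g => rfl
    refine ⟨a, ?_⟩
    ext g h
    rw [reg_apply, hM g h, ha]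
    simp

instance : CompleteSpace (CrossedProduct α) := by
  rw [completeSpace_iff_isComplete_range
    (isometry_reg : Isometry (reg : CrossedProduct α → CStarMatrix G G A)).isUniformInducing,
    range_reg]
  refine IsClosed.isComplete ?_
  simp only [Set.ofPred_forall]
  refine isClosed_iInter fun g => isClosed_iInter fun h => ?_
  have hent : ∀ i j : G, Continuous fun M : CStarMatrix G G A => M i j := fun i j =>
    (continuous_apply_apply i j : Continuous fun x : G → G → A => x i j)
  have hα : Continuous (α g⁻¹) := (StarAlgEquiv.isometry (α g⁻¹)).continuous
  exact isClosed_eq (hent g h) (hα.comp (hent 1 _))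

open Classical in
instance : CStarAlgebra (CrossedProduct α) where
  norm_mul_self_le a := by
    rw [norm_def, norm_def, reg_mul, reg_star]
    exact (CStarRing.norm_star_mul_self (x := reg a)).ge
  norm_smul_le c a := by
    rw [norm_def, norm_def, reg_smul]
    exact norm_smul_le c (reg a)

instance : PartialOrder (CrossedProduct α) := CStarAlgebra.spectralOrder (CrossedProduct α)

instance : StarOrderedRing (CrossedProduct α) := CStarAlgebra.spectralOrderedRing (CrossedProduct α)

end CrossedProduct

end CrossedProducts

noncomputable section Notions

/-- `(a - ε)_+`: the function `t ↦ max (t - ε) 0` applied to the self-adjoint element `a`. -/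
def cutDown {A : Type*} [CStarAlgebra A] (a : A) (ε : ℝ) : A :=
  cfc (fun t : ℝ => max (t - ε) 0) a

/-- A C*-algebra is simple if it is nonzero and has no closed two-sided ideals other than `0` and
itself. -/
def IsSimpleCStar (A : Type*) [CStarAlgebra A] : Prop :=
  Nontrivial A ∧ ∀ I : TwoSidedIdeal A, IsClosed (I : Set A) → I = ⊥ ∨ I = ⊤

/-- A unital C*-algebra is stably finite if every isometry in every `M_n(A)` is unitary. -/
def IsStablyFinite (A : Type*) [CStarAlgebra A] : Prop :=
  ∀ (n : ℕ) (v : CStarMatrix (Fin n) (Fin n) A), star v * v = 1 → v * star v = 1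

/-- A representation on a nonzero Hilbert space is irreducible if it has no closed invariant
subspaces other than `0` and the whole space. -/
def IsIrreducibleRep {A H : Type*} [CStarAlgebra A] [NormedAddCommGroup H] [InnerProductSpace ℂ H]
    [CompleteSpace H] (π : A →⋆ₐ[ℂ] (H →L[ℂ] H)) : Prop :=
  Nontrivial H ∧ ∀ K : Submodule ℂ H, IsClosed (K : Set H) → (∀ a, ∀ ξ ∈ K, π a ξ ∈ K) →
    K = ⊥ ∨ K = ⊤

universe u in
/-- A unital C*-algebra is of type I if the image of each of its irreducible representations
contains a nonzero compact operator (equivalently, all compact operators). Irreducible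
representations are cyclic, so Hilbert spaces in the universe of `A` suffice. -/
def IsTypeI (A : Type u) [CStarAlgebra A] : Prop :=
  ∀ (H : Type u) [NormedAddCommGroup H] [InnerProductSpace ℂ H] [CompleteSpace H]
    (π : A →⋆ₐ[ℂ] (H →L[ℂ] H)), IsIrreducibleRep π → ∃ a, π a ≠ 0 ∧ IsCompactOperator (π a)

/-- An action `α` of a finite group `G` on a unital C*-algebra `A` is weakly tracially strictly
approximately inner. -/
def IsWeaklyTraciallyStrictlyApproxInner {G A : Type*} [Group G] [CStarAlgebra A] [PartialOrder A]
    [StarOrderedRing A] (α : G →* (A ≃⋆ₐ[ℂ] A)) : Prop :=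
  ∀ (F : Finset A) (ε : ℝ), 0 < ε → ∀ x : A, 0 ≤ x → ‖x‖ = 1 →
    ∃ (c : A) (s : G → A), 0 ≤ c ∧ (∀ g, α g c = c) ∧ ‖c‖ ≤ 1 ∧
      (∀ g, ‖s g‖ ≤ 1 ∧ s g ∈ closure (Set.range fun a : A => c * a * c)) ∧
      ‖s 1 - c‖ < ε ∧ (∀ g, ‖star (s g) - s g⁻¹‖ < ε) ∧
      (∀ g h, ‖s g * s h - c * s (g * h)‖ < ε) ∧
      (∀ a ∈ F, ‖c * a - a * c‖ < ε) ∧ (∀ g, ‖c * s g - s g * c‖ < ε) ∧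
      (∀ a ∈ F, ∀ g, ‖α g (c * a * c) - s g * a * star (s g)‖ < ε) ∧
      CuntzSub (oneByOne (cutDown (1 - c) ε)) (oneByOne x) ∧
      1 - ε < ‖c * x * c‖

variable (A : Type*) [NonUnitalCStarAlgebra A] [PartialOrder A] [StarOrderedRing A]

/-- The Cuntz semigroup `Cu(A) = W(𝒦 ⊗ A)`. -/
abbrev Cu : Type _ := W (Stab A)

/-- `Cu_+(A)`: the classes of the positive elements `a` of `𝒦 ⊗ A` such that there is no projection
`q` in `M_∞(𝒦 ⊗ A)` with `⟨a⟩ = ⟨q⟩`. -/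
def CuPlus : Set (Cu A) :=
  {x | ∃ (a : Stab A) (ha : 0 ≤ a), x = cls (oneByOne a) (oneByOne_nonneg ha) ∧
    ¬ ∃ (n : ℕ) (q : CStarMatrix (Fin n) (Fin n) (Stab A)) (hq : IsStarProjection q),
      cls (oneByOne a) (oneByOne_nonneg ha) = cls q (projection_nonneg hq)}

/-- A subset `T` of an ordered semigroup is almost unperforated if for all `x, y ∈ T` and `n > 0`,
`(n + 1) x ≤ n y` implies `x ≤ y`. -/
def AlmostUnperforated {S : Type*} [AddCommMonoid S] [LE S] (T : Set S) : Prop :=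
  ∀ x ∈ T, ∀ y ∈ T, ∀ n : ℕ, 0 < n → (n + 1) • x ≤ n • y → x ≤ y

end Notions

end CuntzSemigroup

/-! The inclusion of `A` into the crossed product B = C*(G, A, α) can be undone up to a small error
on the level of Cuntz comparison. Suppose a ≾ b in B, and let w = ∑ w_g u_g satisfy w b w* ≈ a.
Replace each unitary u_g by the element s_g of `A` and put Y = c ∑ w_g s_g. Up to factors c, the s_g
multiply like the u_g and implement α_g on elements compressed by c. Hence Y b Y* ≈ c³ ∑_k d_k s_k,
where d_k is the coefficient of u_k in w b w*. Since d_1 ≈ a and d_k ≈ 0 for k ≠ 1, this is close to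
a^{1/2} c⁴ a^{1/2}. The missing piece a^{1/2} (1 - c⁴) a^{1/2} is at most 4 a^{1/2} (1 - c) a^{1/2},
and (1 - c - ε)_+ is as small as desired in the Cuntz sense. So ⟨a⟩ ≤ ⟨b⟩ + z in W(A) for every
nonzero z. This is `le_add_of_map_incl_le`, which rests on `covariant_sum`, `tendsto_covariant_sum`
and `le_add_of_compression`.

Two defects remain: the hypothesis on Cu(B) speaks only of classes that are not classes of
projections, and the comparison costs z. Both are repaired by the room available in W(A). A simple
algebra not of type I is prime and has no corner consisting of scalar multiples of one element
(`noMinimal_of_not_isTypeI`). Its nonzero hereditary subalgebras therefore contain infinite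
orthogonal sequences, and so a positive element with 0 as a limit point of its spectrum
(`exists_zeroLimit`). With such elements every nonzero class y is bounded by y' + z, where z is
arbitrarily small, y' has a summand of that kind, and y' + r ≤ y for some nonzero r
(`exists_purelyPos_le`). Since every nonzero class is full (`exists_le_nsmul`), the perturbations
can be absorbed in the inequality (n + 1) x ≤ n y after enlarging n. It then suffices to show x ≤ y
+ r for purely positive x and y (`almostUnperforated_of_purelyPos`).

A purely positive class is still not the class of a projection over B. Compactness of projections
(`exists_projection_cuntzSub`) would give a ≾ (a - δ)_+ for some δ > 0, and small positive spectrum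
of a would then produce a nonunitary isometry (`false_of_csub_cutDown`), while matrix algebras over
B embed in matrix algebras over `A` and are finite (`CrossedProduct.isFinite_matrix`).

Passing between W and Cu is soft. W(D) embeds in Cu(D) as an ordered set because D is a corner of
its stabilization (`Stab.map_incl_le_map_incl`), and almost unperforation extends from W(D) to Cu(D)
because positive matrices over the stabilization are limits of compressions to finite corners
(`almostUnperforated_cu`). -/

namespace CuntzSemigroup

/-! ### Cuntz comparison inside one unital C*-algebra. -/

section Comparison

variable {E : Type*} [CStarAlgebra E] [PartialOrder E] [StarOrderedRing E]

/-- Cuntz subequivalence inside a single C*-algebra, in epsilon form. -/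
def CSub (a b : E) : Prop := ∀ ε : ℝ, 0 < ε → ∃ w : E, ‖w * b * star w - a‖ < ε

theorem CSub.conj (w b : E) : CSub (w * b * star w) b := fun ε hε => ⟨w, by simpa using hε⟩

theorem CSub.refl (b : E) : CSub b b := by simpa using CSub.conj 1 b

theorem CSub.of_approx {a b : E} (h : ∀ ε : ℝ, 0 < ε → ∃ a' : E, ‖a' - a‖ < ε ∧ CSub a' b) :
    CSub a b := by
  intro ε hε
  obtain ⟨a', ha', hs⟩ := h (ε / 2) (half_pos hε)
  obtain ⟨w, hw⟩ := hs (ε / 2) (half_pos hε)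
  refine ⟨w, ?_⟩
  calc ‖w * b * star w - a‖ = ‖(w * b * star w - a') + (a' - a)‖ := by congr 1; abel
    _ ≤ ‖w * b * star w - a'‖ + ‖a' - a‖ := norm_add_le _ _
    _ < ε := by linarith

theorem CSub.trans {a b c : E} (hab : CSub a b) (hbc : CSub b c) : CSub a c := by
  refine CSub.of_approx fun ε hε => ?_
  obtain ⟨w, hw⟩ := hab ε hε
  refine ⟨_, hw, fun δ hδ => ?_⟩
  have hc : Continuous fun x : E => w * x * star w := by fun_prop
  obtain ⟨η, hη, h⟩ := Metric.continuous_iff.1 hc b δ hδ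
  obtain ⟨z, hz⟩ := hbc η hη
  refine ⟨w * z, ?_⟩
  have := h (z * c * star z) (by rwa [dist_eq_norm])
  rw [dist_eq_norm] at this
  simpa [mul_assoc] using this

theorem cfc_isSelfAdjoint (f : ℝ → ℝ) (a : E) : star (cfc f a) = cfc f a :=
  (cfc_predicate f a : IsSelfAdjoint (cfc f a)).star_eq

theorem spectrum_nonneg' {a : E} (ha : 0 ≤ a) {t : ℝ} (ht : t ∈ spectrum ℝ a) : 0 ≤ t :=
  spectrum_nonneg_of_nonneg ha ht

theorem cfc_mul_cfc {f g : ℝ → ℝ} (hf : Continuous f) (hg : Continuous g) (a : E) :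
    cfc f a * cfc g a = cfc (fun t => f t * g t) a :=
  (cfc_mul f g a hf.continuousOn hg.continuousOn).symm

theorem cfc_mul_self_mul {f : ℝ → ℝ} (hf : Continuous f) {a : E} (ha : IsSelfAdjoint a) :
    cfc f a * a = cfc (fun t => f t * t) a := by
  conv_lhs => rw [← cfc_id' ℝ a ha]
  rw [cfc_id' ℝ a ha]
  nth_rw 2 [← cfc_id' ℝ a ha]
  exact cfc_mul_cfc hf continuous_id' a

theorem cfc_conj_self {f : ℝ → ℝ} (hf : Continuous f) {a : E} (ha : IsSelfAdjoint a) :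
    cfc f a * a * star (cfc f a) = cfc (fun t => f t * t * f t) a := by
  rw [cfc_isSelfAdjoint, cfc_mul_self_mul hf ha, cfc_mul_cfc (by fun_prop) hf]

theorem norm_cfc_sub_le {f : ℝ → ℝ} (hf : Continuous f) {a : E} (ha : 0 ≤ a) {δ : ℝ} (hδ : 0 ≤ δ)
    (h : ∀ t, 0 ≤ t → |f t - t| ≤ δ) : ‖cfc f a - a‖ ≤ δ := by
  have hsa : IsSelfAdjoint a := ha.isSelfAdjoint
  nth_rw 2 [← cfc_id' ℝ a hsa]
  rw [← cfc_sub f (fun t => t) a hf.continuousOn]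
  exact norm_cfc_le hδ fun t ht => h t (spectrum_nonneg' ha ht)

/-- The function √t / max(t, δ) is a bounded substitute for t^{-1/2}. Conjugating a² by it gives t
(t / max(t, δ))², which is within δ of t on [0, ∞). -/
theorem csub_sq {a : E} (ha : 0 ≤ a) : CSub a (a * a) := by
  intro ε hε
  obtain ⟨δ, hδ, hδε⟩ : ∃ δ : ℝ, 0 < δ ∧ δ < ε := ⟨ε / 2, half_pos hε, half_lt_self hε⟩
  have hm : ∀ t : ℝ, 0 < max t δ := fun t => lt_max_of_lt_right hδ
  have hc : Continuous fun t : ℝ => √t / max t δ :=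
    Real.continuous_sqrt.div₀ (by fun_prop) fun t => (hm t).ne'
  have hsa : IsSelfAdjoint a := ha.isSelfAdjoint
  refine ⟨cfc (fun t : ℝ => √t / max t δ) a, lt_of_le_of_lt ?_ hδε⟩
  have : cfc (fun t : ℝ => √t / max t δ) a * (a * a) * star (cfc (fun t : ℝ => √t / max t δ) a)
      = cfc (fun t => √t / max t δ * t * t * (√t / max t δ)) a := by
    rw [cfc_isSelfAdjoint, ← mul_assoc, cfc_mul_self_mul hc hsa, cfc_mul_self_mul (by fun_prop) hsa,
      cfc_mul_cfc (by fun_prop) hc]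
  rw [this]
  refine norm_cfc_sub_le (by fun_prop) ha hδ.le fun t ht => ?_
  have h1 : √t / max t δ * t * t * (√t / max t δ) = t * (t / max t δ) ^ 2 := by
    have := Real.mul_self_sqrt ht
    field_simp
    nlinarith
  rw [h1]
  rcases le_total δ t with h | h
  · rw [max_eq_left h, div_self (hδ.trans_le h).ne']; simp [hδ.le]
  · rw [max_eq_right h, abs_le]
    have h2 : 0 ≤ t / δ := by positivity
    have h3 : t / δ ≤ 1 := (div_le_one hδ).2 h
    have h4 : (t / δ) ^ 2 ≤ 1 := pow_le_one₀ h2 h3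
    constructor <;> nlinarith [sq_nonneg (t / δ)]

theorem conj_le_conj {a b : E} (h : a ≤ b) (c : E) : c * a * star c ≤ c * b * star c := by
  simpa using star_left_conjugate_le_conjugate h (star c)

theorem exists_sqrt {a : E} (ha : 0 ≤ a) : ∃ c : E, 0 ≤ c ∧ c * c = a :=
  ⟨CFC.sqrt a, CFC.sqrt_nonneg a, CFC.sqrt_mul_sqrt_self a ha⟩

/-- Put s = a^{1/2} and w = s h(b) with h(t) = max(t, δ)^{-1/2}. Then h(b) b h(b) = 1 - q² with q² =
1 - t / max(t, δ) evaluated at b, so the error is (q s)*(q s). Its norm is ‖q a q‖ ≤ ‖q b q‖ ≤ δ. -/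
theorem csub_of_le {a b : E} (ha : 0 ≤ a) (hab : a ≤ b) : CSub a b := by
  have hb : 0 ≤ b := ha.trans hab
  intro ε hε
  obtain ⟨δ, hδ, hδε⟩ : ∃ δ : ℝ, 0 < δ ∧ δ < ε := ⟨ε / 2, half_pos hε, half_lt_self hε⟩
  have hm : ∀ t : ℝ, 0 < max t δ := fun t => lt_max_of_lt_right hδ
  obtain ⟨s, hs0, hs⟩ := exists_sqrt ha
  have hsa : star s = s := hs0.isSelfAdjoint.star_eq
  have hc : Continuous fun t : ℝ => 1 / √(max t δ) :=
    continuous_const.div₀ (by fun_prop) fun t => (Real.sqrt_pos.2 (hm t)).ne'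
  have hq : Continuous fun t : ℝ => √(1 - t / max t δ) :=
    (continuous_const.sub (continuous_id.div₀ (by fun_prop) fun t => (hm t).ne')).sqrt
  have hk : Continuous fun t : ℝ => t / max t δ :=
    continuous_id.div₀ (by fun_prop) fun t => (hm t).ne'
  set q := cfc (fun t : ℝ => √(1 - t / max t δ)) b with hqd
  refine ⟨s * cfc (fun t : ℝ => 1 / √(max t δ)) b, lt_of_le_of_lt ?_ hδε⟩
  have hle : ∀ t : ℝ, t / max t δ ≤ 1 := fun t => (div_le_one (hm t)).2 (le_max_left _ _)
  have h1 : cfc (fun t : ℝ => 1 / √(max t δ)) b * b * star (cfc (fun t : ℝ => 1 / √(max t δ)) b)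
      = 1 - q * q := by
    rw [cfc_conj_self hc hb.isSelfAdjoint, hqd, cfc_mul_cfc hq hq]
    rw [← cfc_one ℝ b hb.isSelfAdjoint, ← cfc_sub (1 : ℝ → ℝ) _ b (by fun_prop) (by fun_prop)]
    refine cfc_congr fun t ht => ?_
    simp only [Pi.one_apply]
    rw [Real.mul_self_sqrt (by linarith [hle t])]
    have h2 := Real.sqrt_pos.2 (hm t)
    have h3 := (hm t).ne'
    field_simp
    rw [Real.sq_sqrt (hm t).le]
    ring
  have h2 : s * cfc (fun t : ℝ => 1 / √(max t δ)) b * b *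
      star (s * cfc (fun t : ℝ => 1 / √(max t δ)) b) - a = -(star (q * s) * (q * s)) := by
    have hqs : star q = q := cfc_isSelfAdjoint _ _
    calc _ = s * (cfc (fun t : ℝ => 1 / √(max t δ)) b * b *
      star (cfc (fun t : ℝ => 1 / √(max t δ)) b)) * s - a := by
            rw [star_mul, hsa]; simp only [mul_assoc]
      _ = _ := by
        rw [h1, ← hs, star_mul, hqs, hsa]; noncomm_ring
  -- Exchanging x*x for xx* brings a = s² between two factors q, where a ≤ b applies.
  rw [h2, norm_neg, CStarRing.norm_star_mul_self, ← CStarRing.norm_self_mul_star]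
  have hqs : star q = q := cfc_isSelfAdjoint _ _
  have h3 : q * s * star (q * s) = q * a * star q := by
    rw [star_mul, hsa, ← hs]; simp only [mul_assoc]
  rw [h3]
  refine (CStarAlgebra.norm_le_norm_of_nonneg_of_le (by simpa using conj_le_conj ha q)
    (conj_le_conj hab q)).trans ?_
  rw [hqd, cfc_conj_self hq hb.isSelfAdjoint]
  refine norm_cfc_le hδ.le fun t ht => ?_
  have ht := spectrum_nonneg' hb ht
  have h4 : √(1 - t / max t δ) * t * √(1 - t / max t δ) = t * (1 - t / max t δ) := by
    have := Real.mul_self_sqrt (show 0 ≤ 1 - t / max t δ by linarith [hle t])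
    linear_combination t * this
  rw [h4, Real.norm_eq_abs]
  rcases le_total δ t with h | h
  · rw [max_eq_left h, div_self (hδ.trans_le h).ne']; simp [hδ.le]
  · rw [max_eq_right h, abs_le]
    have h2 : 0 ≤ t / δ := by positivity
    have h3 : t / δ ≤ 1 := (div_le_one hδ).2 h
    constructor <;> nlinarith

/-- `(a - 2η)_+` is obtained from `a - η` by a symmetric multiplication. -/
theorem exists_conj_eq_cutDown {a : E} (ha : 0 ≤ a) {η : ℝ} (hη : 0 < η) :
    ∃ e : E, e * (a - algebraMap ℝ E η) * star e = cutDown a (2 * η) := by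
  have hm : ∀ t : ℝ, 0 < max (t - η) η := fun t => lt_max_of_lt_right hη
  have hc : Continuous fun t : ℝ => √(max (t - 2 * η) 0 / max (t - η) η) :=
    (Continuous.div₀ (by fun_prop) (by fun_prop) fun t => (hm t).ne').sqrt
  have hsa := ha.isSelfAdjoint
  refine ⟨cfc (fun t : ℝ => √(max (t - 2 * η) 0 / max (t - η) η)) a, ?_⟩
  have h1 : a - algebraMap ℝ E η = cfc (fun t : ℝ => t - η) a := by
    rw [cfc_sub (fun t : ℝ => t) (fun _ => η) a, cfc_id' ℝ a, cfc_const η a]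
  rw [cfc_isSelfAdjoint, h1, cfc_mul_cfc hc (by fun_prop), cfc_mul_cfc (by fun_prop) hc, cutDown]
  refine cfc_congr fun t _ => ?_
  have h0 : 0 ≤ max (t - 2 * η) 0 / max (t - η) η := div_nonneg (le_max_right _ _) (hm t).le
  have h2 := Real.mul_self_sqrt h0
  have h3 : √(max (t - 2 * η) 0 / max (t - η) η) * (t - η) * √(max (t - 2 * η) 0 / max (t - η) η)
    = (t - η) * (max (t - 2 * η) 0 / max (t - η) η) := by linear_combination (t - η) * h2
  rw [h3]
  rcases le_total (t - 2 * η) 0 with h | h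
  · rw [max_eq_right h]; simp
  · have : η ≤ t - η := by linarith
    rw [max_eq_left h, max_eq_left this]
    have : t - η ≠ 0 := by linarith
    field_simp

theorem cutDown_nonneg (a : E) (η : ℝ) : 0 ≤ cutDown a η :=
  cfc_nonneg fun _ _ => le_max_right _ _

theorem norm_cutDown_sub_le {a : E} (ha : 0 ≤ a) {η : ℝ} (hη : 0 ≤ η) : ‖cutDown a η - a‖ ≤ η := by
  refine norm_cfc_sub_le (by fun_prop) ha hη fun t ht => ?_
  rcases le_total (t - η) 0 with h | h
  · rw [max_eq_right h, abs_le]; constructor <;> linarith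
  · rw [max_eq_left h, abs_le]; constructor <;> linarith

/-- Conjugating a - η ≤ d by the element that carries a - η to (a - 2η)_+ turns an order relation
with a scalar error into an exact comparison. -/
theorem cutDown_csub {a b d : E} (ha : 0 ≤ a) {η : ℝ} (hη : 0 < η) (hdb : CSub d b)
    (h : a ≤ d + algebraMap ℝ E η) : CSub (cutDown a (2 * η)) b := by
  obtain ⟨e, he⟩ := exists_conj_eq_cutDown ha hη
  have h1 : cutDown a (2 * η) ≤ e * d * star e := by
    rw [← he]; exact conj_le_conj (sub_le_iff_le_add.2 h) e
  exact (csub_of_le (cutDown_nonneg _ _) h1).trans ((CSub.conj e d).trans hdb)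

theorem csub_of_forall_le {a b : E} (ha : 0 ≤ a)
    (h : ∀ ε : ℝ, 0 < ε → ∃ d : E, CSub d b ∧ a ≤ d + algebraMap ℝ E ε) : CSub a b := by
  refine CSub.of_approx fun ε hε => ?_
  obtain ⟨d, hd, hle⟩ := h (ε / 4) (by linarith)
  refine ⟨cutDown a (2 * (ε / 4)), ?_, cutDown_csub ha (by linarith) hd hle⟩
  exact (norm_cutDown_sub_le ha (by linarith)).trans_lt (by linarith)

theorem le_add_of_norm_sub_le {a d : E} (ha : IsSelfAdjoint a) (hd : IsSelfAdjoint d) {ε : ℝ}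
    (h : ‖a - d‖ ≤ ε) : a ≤ d + algebraMap ℝ E ε := by
  have h1 := (ha.sub hd).le_algebraMap_norm_self
  have h2 : algebraMap ℝ E ‖a - d‖ ≤ algebraMap ℝ E ε := algebraMap_mono E h
  have := h1.trans h2
  rwa [sub_le_iff_le_add, add_comm] at this

end Comparison

/-! ### Hereditary subalgebras, and orthogonal elements inside them. -/

section Hereditary

variable {E : Type*} [CStarAlgebra E] [PartialOrder E] [StarOrderedRing E]

theorem csub_smul {r : ℝ} (hr : 0 ≤ r) (b : E) : CSub (r • b) b := by
  have : r • b = (algebraMap ℝ E (√r)) * b * star (algebraMap ℝ E (√r)) := by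
    rw [← algebraMap_star_comm, Algebra.algebraMap_eq_smul_one, star_trivial,
      Algebra.algebraMap_eq_smul_one, smul_mul_assoc, one_mul, mul_smul_comm, mul_one, smul_smul,
      Real.mul_self_sqrt hr]
  rw [this]
  exact CSub.conj _ _

theorem csub_of_le_smul {a b : E} {r : ℝ} (hr : 0 ≤ r) (ha : 0 ≤ a) (h : a ≤ r • b) : CSub a b :=
  (csub_of_le ha h).trans (csub_smul hr b)

/-- The hereditary subspace `closure (c E c)`. -/
def Her (c : E) : Set E := closure (Set.range fun m : E => c * m * c)

theorem Her.mem (c m : E) : c * m * c ∈ Her c := subset_closure ⟨m, rfl⟩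

theorem Her.add {c x y : E} (hx : x ∈ Her c) (hy : y ∈ Her c) : x + y ∈ Her c := by
  refine map_mem_closure₂ (f := fun x y : E => x + y) continuous_add hx hy ?_
  rintro _ ⟨m, rfl⟩ _ ⟨m', rfl⟩
  exact ⟨m + m', by simp only [mul_add, add_mul]⟩

theorem Her.conj {c x : E} (hx : x ∈ Her c) (k : E) : x * k * x ∈ Her c := by
  refine map_mem_closure (f := fun x : E => x * k * x) (by fun_prop) hx ?_
  rintro _ ⟨m, rfl⟩
  exact ⟨m * c * k * c * m, by simp only [mul_assoc]⟩

theorem Her.trans {c d x : E} (hx : x ∈ Her d) (hd : d ∈ Her c) : x ∈ Her c := by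
  refine closure_minimal ?_ isClosed_closure hx
  rintro _ ⟨m, rfl⟩
  exact Her.conj hd m

theorem Her.mul_eq_of_mul_eq {c φ x : E} (hc : φ * c = c) (hx : x ∈ Her c) : φ * x = x := by
  have : IsClosed {x : E | φ * x = x} := isClosed_eq (by fun_prop) (by fun_prop)
  refine closure_minimal ?_ this hx
  rintro _ ⟨m, rfl⟩
  simp [← mul_assoc, hc]

theorem conj_le_norm_smul {m : E} (hm : IsSelfAdjoint m) (c : E) :
    star c * m * c ≤ ‖m‖ • (star c * c) := CStarAlgebra.star_left_conjugate_le_norm_smul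

/-- Approximate a by c m c. Replacing m by its self-adjoint part n does not worsen the
approximation, and c n c ≤ ‖n‖ c². -/
theorem csub_of_mem_her {a c : E} (hc : IsSelfAdjoint c) (ha : 0 ≤ a) (h : a ∈ Her c) :
    CSub a (c * c) := by
  refine csub_of_forall_le ha fun ε hε => ?_
  obtain ⟨_, ⟨m, rfl⟩, hm⟩ := Metric.mem_closure_iff.1 h ε hε
  rw [dist_eq_norm] at hm
  simp only at hm
  set n : E := (2⁻¹ : ℝ) • (m + star m) with hn
  have hns : IsSelfAdjoint n := by
    rw [hn, IsSelfAdjoint, star_smul, star_add, star_star, star_trivial, add_comm]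
  refine ⟨‖n‖ • (c * c), csub_smul (norm_nonneg _) _, ?_⟩
  have h1 : c * n * c ≤ ‖n‖ • (c * c) := by
    have := conj_le_norm_smul hns c
    rwa [hc.star_eq] at this
  have h2 : ‖a - c * n * c‖ ≤ ε := by
    have : a - c * n * c = (2⁻¹ : ℝ) • ((a - c * m * c) + star (a - c * m * c)) := by
      have h3 : (2⁻¹ : ℝ) • (a + a) = a := by rw [← two_smul ℝ a, smul_smul]; norm_num
      conv_lhs => rw [← h3]
      rw [star_sub, star_mul, star_mul, hc.star_eq, ha.isSelfAdjoint.star_eq, hn,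
        mul_smul_comm, smul_mul_assoc, ← smul_sub]
      congr 1
      noncomm_ring
    rw [this, norm_smul]
    calc ‖(2⁻¹ : ℝ)‖ * ‖(a - c * m * c) + star (a - c * m * c)‖
        ≤ ‖(2⁻¹ : ℝ)‖ * (ε + ε) := by
          gcongr
          exact (norm_add_le _ _).trans (by rw [norm_star]; linarith)
      _ = ε := by norm_num; ring
  have h3 := le_add_of_norm_sub_le ha.isSelfAdjoint (show IsSelfAdjoint (c * n * c) by
    rw [IsSelfAdjoint, star_mul, star_mul, hc.star_eq, hns.star_eq, mul_assoc]) h2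
  exact h3.trans (add_le_add_left h1 _)

/-- `h` generates a "corner" `h E h` which is not one-dimensional. -/
def NoMinimal (E : Type*) [CStarAlgebra E] : Prop :=
  ∀ h : E, h ≠ 0 → ∃ m : E, ∀ r : ℂ, h * m * h ≠ r • h

/-- `E` is prime. -/
def IsPrimeRing (E : Type*) [CStarAlgebra E] : Prop :=
  ∀ c t : E, c ≠ 0 → t ≠ 0 → ∃ m : E, c * m * t ≠ 0

theorem eq_zero_of_cfc_eq_zero {a : E} (ha : IsSelfAdjoint a) {f : ℝ → ℝ} (hf : Continuous f)
    (h : cfc f a = 0) {t : ℝ} (ht : t ∈ spectrum ℝ a) : f t = 0 := by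
  have h1 : f t ∈ spectrum ℝ (cfc f a) := by
    rw [cfc_map_spectrum f a ha hf.continuousOn]; exact ⟨t, ht, rfl⟩
  rw [h] at h1
  have : Nontrivial E := by
    by_contra hn
    rw [not_nontrivial_iff_subsingleton] at hn
    simp [spectrum.of_subsingleton] at ht
  simpa using h1

theorem nonpos_of_spectrum {h : E} (hs : IsSelfAdjoint h) (H : ∀ t ∈ spectrum ℝ h, t ≤ 0) :
    h ≤ 0 := by
  rw [← cfc_id' ℝ h hs]
  exact cfc_nonpos _ _ H

theorem nonneg_of_spectrum {h : E} (hs : IsSelfAdjoint h) (H : ∀ t ∈ spectrum ℝ h, 0 ≤ t) :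
    0 ≤ h := by
  rw [← cfc_id' ℝ h hs]
  exact cfc_nonneg H

/-- Without such a pair, every self-adjoint element of f E f has vanishing positive or negative
part, so f m f is comparable with r f² for each real r. Connectedness of ℝ then forces f m f = r f²
for some r, so f E f is spanned by f², against `NoMinimal`. -/
theorem exists_orthogonal (hN : NoMinimal E) {f : E} (hf : 0 ≤ f) (hf0 : f ≠ 0) :
    ∃ m n : E, 0 ≤ f * m * f ∧ 0 ≤ f * n * f ∧ f * m * f ≠ 0 ∧ f * n * f ≠ 0 ∧
      (f * m * f) * (f * n * f) = 0 := by
  by_contra hcon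
  push Not at hcon
  have hfs := hf.isSelfAdjoint
  have hff : 0 ≤ f * f := by
    have := star_mul_self_nonneg f
    rwa [hfs.star_eq] at this
  have key : ∀ m : E, IsSelfAdjoint m → ∀ r : ℝ, f * m * f ≤ r • (f * f) ∨ r • (f * f) ≤ f * m * f := by
    intro m hm r
    set k : E := m - algebraMap ℝ E r with hk
    have hks : IsSelfAdjoint k := hm.sub (IsSelfAdjoint.algebraMap E (IsSelfAdjoint.all r))
    have hh : f * k * f = f * m * f - r • (f * f) := by
      rw [hk, mul_sub, sub_mul, Algebra.algebraMap_eq_smul_one, mul_smul_comm, smul_mul_assoc,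
        mul_one]
    set h : E := f * k * f with hhd
    have hs : IsSelfAdjoint h := by
      rw [hhd, IsSelfAdjoint, star_mul, star_mul, hfs.star_eq, hks.star_eq, mul_assoc]
    -- Multiplying p(h) by h on both sides puts it visibly in the form f (…) f, without changing
    -- whether the positive or negative part vanishes.
    have e1 : ∀ p : ℝ → ℝ, Continuous p →
        f * (k * f * cfc p h * f * k) * f = cfc (fun s => s * p s * s) h := by
      intro p hp
      calc f * (k * f * cfc p h * f * k) * f = h * cfc p h * h := by
            rw [hhd]; simp only [mul_assoc]
        _ = _ := by
            conv_lhs => rw [mul_assoc, cfc_mul_self_mul hp hs]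
            nth_rw 1 [← cfc_id' ℝ h hs]
            rw [cfc_mul_cfc continuous_id' (by fun_prop)]
            simp only [mul_assoc]
    have hp1 : Continuous fun s : ℝ => max s 0 := by fun_prop
    have hp2 : Continuous fun s : ℝ => max (-s) 0 := by fun_prop
    have := hcon (k * f * cfc (fun s : ℝ => max s 0) h * f * k)
      (k * f * cfc (fun s : ℝ => max (-s) 0) h * f * k)
    rw [e1 _ hp1, e1 _ hp2] at this
    by_cases hx : cfc (fun s : ℝ => s * max s 0 * s) h = 0
    · left
      rw [← sub_nonpos, ← hh]
      refine nonpos_of_spectrum hs fun t ht => ?_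
      have h2 := eq_zero_of_cfc_eq_zero hs (by fun_prop) hx ht
      by_contra h3
      push Not at h3
      rw [max_eq_left h3.le] at h2
      have : 0 < t * t * t := by positivity
      linarith
    by_cases hy : cfc (fun s : ℝ => s * max (-s) 0 * s) h = 0
    · right
      rw [← sub_nonneg, ← hh]
      refine nonneg_of_spectrum hs fun t ht => ?_
      have h2 := eq_zero_of_cfc_eq_zero hs (by fun_prop) hy ht
      by_contra h3
      push Not at h3
      rw [max_eq_left (by linarith)] at h2
      have : 0 < (-t) * (-t) * (-t) := by
        have : 0 < -t := by linarith
        positivity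
      linarith
    · refine absurd ?_ (this (cfc_nonneg fun t _ => ?_) (cfc_nonneg fun t _ => ?_) hx hy)
      · rw [cfc_mul_cfc (by fun_prop) (by fun_prop)]
        rw [← cfc_zero ℝ h]
        refine cfc_congr fun t _ => ?_
        simp only [Pi.zero_apply]
        rcases le_total t 0 with h | h
        · simp [max_eq_right h]
        · simp [max_eq_right (neg_nonpos.2 h)]
      · have := mul_nonneg (mul_self_nonneg t) (le_max_right t 0)
        linarith
      · have := mul_nonneg (mul_self_nonneg t) (le_max_right (-t) 0)
        linarith
  -- The sets of r with f m f ≤ r f² and with r f² ≤ f m f are closed, nonempty and cover ℝ, hence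
  -- they meet.
  have key2 : ∀ m : E, IsSelfAdjoint m → ∃ r : ℝ, f * m * f = r • (f * f) := by
    intro m hm
    have hc1 : IsClosed {r : ℝ | f * m * f ≤ r • (f * f)} :=
      isClosed_le continuous_const (continuous_id.smul continuous_const)
    have hc2 : IsClosed {r : ℝ | r • (f * f) ≤ f * m * f} :=
      isClosed_le (continuous_id.smul continuous_const) continuous_const
    have h1 : f * m * f ≤ ‖m‖ • (f * f) := by
      have := conj_le_norm_smul hm f
      rwa [hfs.star_eq] at this
    have h2 : (-‖m‖) • (f * f) ≤ f * m * f := by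
      have := conj_le_norm_smul hm.neg f
      rw [hfs.star_eq, norm_neg, mul_neg, neg_mul] at this
      rw [neg_smul]
      exact neg_le.1 this
    obtain ⟨r, -, hr1, hr2⟩ := isPreconnected_closed_iff.1 (isPreconnected_univ (α := ℝ)) _ _ hc1 hc2
      (fun r _ => key m hm r) ⟨_, trivial, h1⟩ ⟨_, trivial, h2⟩
    exact ⟨r, le_antisymm hr1 hr2⟩
  have key3 : ∀ m : E, ∃ r : ℂ, f * m * f = r • (f * f) := by
    intro m
    obtain ⟨r, hr⟩ := key2 _ (realPart m).2
    obtain ⟨s, hs⟩ := key2 _ (imaginaryPart m).2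
    refine ⟨r + Complex.I * s, ?_⟩
    conv_lhs => rw [← realPart_add_I_smul_imaginaryPart m]
    rw [mul_add, add_mul, hr, mul_smul_comm, smul_mul_assoc, hs, add_smul, mul_smul]
    simp only [Complex.coe_smul]
  have hff0 : f * f ≠ 0 := by
    intro h0
    have := CStarRing.star_mul_self_eq_zero_iff f
    rw [hfs.star_eq] at this
    exact hf0 (this.1 h0)
  -- The hypothesis is used at f² because the multiples found above are multiples of f², and f² m f²
  -- = f (f m f) f.
  obtain ⟨m, hm⟩ := hN _ hff0
  obtain ⟨r, hr⟩ := key3 (f * m * f)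
  exact hm r (by rw [← hr]; simp only [mul_assoc])

/-- One has (r - v) x = r x (1 - x). If r - v were invertible, x would be a left multiple of 1 - x,
hence so would 1 = x + (1 - x), making 1 - x invertible. -/
theorem mem_spectrum_of_mul {v x : E} {r : ℝ} (hx : IsSelfAdjoint x) (h1 : (1 : ℝ) ∈ spectrum ℝ x)
    (h : v * x = r • (x * x)) : r ∈ spectrum ℝ v := by
  rw [spectrum.mem_iff] at h1 ⊢
  intro hu
  apply h1
  rw [map_one]
  obtain ⟨u, hu⟩ := hu
  have e1 : (u : E) * x = r • (x * (1 - x)) := by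
    rw [hu, sub_mul, h, Algebra.algebraMap_eq_smul_one, smul_mul_assoc, one_mul, mul_sub, mul_one,
      smul_sub]
  have e2 : x = (r • (↑u⁻¹ * x)) * (1 - x) := by
    rw [smul_mul_assoc, mul_assoc, ← mul_smul_comm, ← e1, Units.inv_mul_cancel_left]
  have e3 : (r • (↑u⁻¹ * x) + 1) * (1 - x) = 1 := by
    rw [add_mul, ← e2, one_mul]; abel
  -- A left inverse of a self-adjoint element is also a right inverse: take adjoints.
  refine ⟨⟨1 - x, r • (↑u⁻¹ * x) + 1, ?_, e3⟩, rfl⟩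
  have e4 := congrArg star e3
  rw [star_mul, star_one, star_sub, star_one, hx.star_eq] at e4
  calc (1 - x) * (r • (↑u⁻¹ * x) + 1) = (1 - x) * ((r • (↑u⁻¹ * x) + 1) * ((1 - x) *
        star (r • (↑u⁻¹ * x) + 1))) := by rw [e4, mul_one]
    _ = (1 - x) * ((r • (↑u⁻¹ * x) + 1) * (1 - x)) * star (r • (↑u⁻¹ * x) + 1) := by
        simp only [mul_assoc]
    _ = 1 := by rw [e3, mul_one, e4]

/-- `0` is a limit point of the spectrum. -/
def ZeroLimit (a : E) : Prop := ∀ δ : ℝ, 0 < δ → ∃ t ∈ spectrum ℝ a, 0 < t ∧ t < δ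

/-- Split off one element of an orthogonal pair and continue inside the hereditary subalgebra of the
other. This gives pairwise orthogonal positive X_k ≠ 0, and v = ∑ 2^{-k} X_k / ‖X_k‖ has every
2^{-k} in its spectrum. -/
theorem exists_zeroLimit (hN : NoMinimal E) {f : E} (hf : 0 ≤ f) (hf0 : f ≠ 0) :
    ∃ v ∈ Her f, 0 ≤ v ∧ ZeroLimit v := by
  choose! m n h1 h2 h3 h4 h5 using fun (f : E) (h : 0 ≤ f ∧ f ≠ 0) => exists_orthogonal hN h.1 h.2
  let F : ℕ → E := fun k => Nat.rec f (fun _ f => f * n f * f) k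
  have F0 : F 0 = f := rfl
  have Fs : ∀ k, F (k + 1) = F k * n (F k) * F k := fun k => rfl
  have hF : ∀ k, 0 ≤ F k ∧ F k ≠ 0 := by
    intro k
    induction k with
    | zero => exact ⟨hf, hf0⟩
    | succ k ih => rw [Fs]; exact ⟨h2 _ ih, h4 _ ih⟩
  let X : ℕ → E := fun k => F k * m (F k) * F k
  have hX : ∀ k, 0 ≤ X k ∧ X k ≠ 0 := fun k => ⟨h1 _ (hF k), h3 _ (hF k)⟩
  have hXF : ∀ k, X k * F (k + 1) = 0 := fun k => h5 _ (hF k)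
  -- Since F j lies in the right ideal of F (i + 1) for j > i, the relation X i * F (i + 1) = 0
  -- gives orthogonality to all later X j.
  have hdiv : ∀ i j, i ≤ j → ∃ K, F j = F i * K := by
    intro i j hij
    induction j, hij using Nat.le_induction with
    | base => exact ⟨1, by simp⟩
    | succ j _ ih =>
      obtain ⟨K, hK⟩ := ih
      exact ⟨K * n (F j) * F j, by rw [Fs]; nth_rw 1 [hK]; simp only [mul_assoc]⟩
  have hXX : ∀ i j, i < j → X i * X j = 0 := by
    intro i j hij
    obtain ⟨K, hK⟩ := hdiv (i + 1) j hij
    change X i * (F j * m (F j) * F j) = 0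
    rw [hK]
    simp only [← mul_assoc, hXF, zero_mul]
  have hXX' : ∀ i j, j ≠ i → X j * X i = 0 := by
    intro i j hij
    rcases lt_or_gt_of_ne hij with h | h
    · exact hXX _ _ h
    · have := congrArg star (hXX _ _ h)
      rwa [star_mul, (hX i).1.isSelfAdjoint.star_eq, (hX j).1.isSelfAdjoint.star_eq, star_zero]
        at this
  have hXher : ∀ k, X k ∈ Her f := by
    have hFher : ∀ k, F k = f ∨ F k ∈ Her f := by
      intro k
      induction k with
      | zero => exact Or.inl rfl
      | succ k ih =>
        right
        rcases ih with h | h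
        · rw [Fs, h]; exact Her.mem _ _
        · exact Her.conj h _
    intro k
    rcases hFher k with h | h
    · change F k * m (F k) * F k ∈ _
      rw [h]; exact Her.mem _ _
    · exact Her.conj h _
  let Y : ℕ → E := fun k => ‖X k‖⁻¹ • X k
  have hYn : ∀ k, ‖Y k‖ = 1 := fun k => by
    change ‖‖X k‖⁻¹ • X k‖ = 1
    rw [norm_smul, norm_inv, norm_norm, inv_mul_cancel₀ (norm_ne_zero_iff.2 (hX k).2)]
  have hY0 : ∀ k, 0 ≤ Y k := fun k => smul_nonneg (by positivity) (hX k).1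
  have hYY : ∀ i j, j ≠ i → Y j * Y i = 0 := fun i j hij => by
    change (‖X j‖⁻¹ • X j) * (‖X i‖⁻¹ • X i) = 0
    rw [smul_mul_assoc, mul_smul_comm, hXX' i j hij, smul_zero, smul_zero]
  let Z : ℕ → E := fun k => ((1 / 2 : ℝ) ^ k) • Y k
  have hsum : Summable Z := by
    refine Summable.of_norm_bounded (g := fun k => (1 / 2 : ℝ) ^ k) summable_geometric_two fun k => ?_
    change ‖((1 / 2 : ℝ) ^ k) • Y k‖ ≤ _
    rw [norm_smul, hYn, mul_one]
    simp
  refine ⟨∑' k, Z k, ?_, ?_, ?_⟩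
  · have hc : IsClosed (Her f) := isClosed_closure
    refine hc.mem_of_tendsto hsum.hasSum (Eventually.of_forall fun s => ?_)
    induction s using Finset.cons_induction with
    | empty => simpa using Her.mem f 0
    | cons a s ha ih =>
      rw [Finset.sum_cons]
      refine Her.add ?_ ih
      have : ∀ (r : ℝ) (x : E), x ∈ Her f → r • x ∈ Her f := by
        intro r x hx
        refine map_mem_closure (f := fun x : E => r • x) (by fun_prop) hx ?_
        rintro _ ⟨m, rfl⟩
        exact ⟨r • m, by simp⟩
      exact this _ _ (this _ _ (hXher a))
  · exact tsum_nonneg fun k => smul_nonneg (by positivity) (hY0 k)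
  · intro δ hδ
    obtain ⟨k, hk⟩ := exists_pow_lt_of_lt_one hδ (show (1 / 2 : ℝ) < 1 by norm_num)
    refine ⟨(1 / 2 : ℝ) ^ k, ?_, by positivity, hk⟩
    refine mem_spectrum_of_mul (x := Y k) (hY0 k).isSelfAdjoint ?_ ?_
    · have : Nontrivial E := ⟨f, 0, hf0⟩
      have := CStarAlgebra.norm_mem_spectrum_of_nonneg (hY0 k)
      rwa [hYn] at this
    · rw [← hsum.tsum_mul_right, tsum_eq_single k]
      · change (((1 / 2 : ℝ) ^ k) • Y k) * Y k = _
        rw [smul_mul_assoc]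
      · intro j hj
        change (((1 / 2 : ℝ) ^ j) • Y j) * Y k = _
        rw [smul_mul_assoc, hYY _ _ hj, smul_zero]

end Hereditary

/-! ### Splitting positive elements, and the obstruction coming from finiteness. -/

section Splitting

variable {E : Type*} [CStarAlgebra E] [PartialOrder E] [StarOrderedRing E]

theorem ZeroLimit.ne_zero {a : E} (h : ZeroLimit a) : a ≠ 0 := by
  rintro rfl
  obtain ⟨t, ht, h0, -⟩ := h 1 one_pos
  have : Nontrivial E := by
    by_contra hn
    rw [not_nontrivial_iff_subsingleton] at hn
    simp [spectrum.of_subsingleton] at ht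
  rw [spectrum.zero_eq] at ht
  exact h0.ne' ht

theorem mul_cfc_mul_self {p : ℝ → ℝ} (hp : Continuous p) {a : E} (ha : IsSelfAdjoint a) :
    a * cfc p a * a = cfc (fun s => s * p s * s) a := by
  have h : cfc (fun s : ℝ => s) a * cfc p a * cfc (fun s : ℝ => s) a
      = cfc (fun s => s * p s * s) a := by
    rw [cfc_mul_cfc continuous_id' hp, cfc_mul_cfc (by fun_prop) continuous_id']
  rwa [cfc_id' ℝ a ha] at h

theorem ZeroLimit.of_cfc {a : E} (h : ZeroLimit a) (ha : IsSelfAdjoint a) {f : ℝ → ℝ}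
    (hf : Continuous f) {s : ℝ} (hs : 0 < s) (hfs : ∀ t, 0 < t → t < s → 0 < f t ∧ f t ≤ t) :
    ZeroLimit (cfc f a) := by
  intro δ hδ
  obtain ⟨t, ht, h0, h1⟩ := h (min δ s) (lt_min hδ hs)
  obtain ⟨h2, h3⟩ := hfs t h0 (h1.trans_le (min_le_right _ _))
  refine ⟨f t, ?_, h2, h3.trans_lt (h1.trans_le (min_le_left _ _))⟩
  rw [cfc_map_spectrum f a ha hf.continuousOn]
  exact ⟨t, ht, rfl⟩

/-- In a hereditary subalgebra there are orthogonal elements, one of which has `0` as a limit point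
of its spectrum. -/
theorem exists_split_zeroLimit (hN : NoMinimal E) {f : E} (hf : 0 ≤ f) (hf0 : f ≠ 0) :
    ∃ w ∈ Her f, ∃ x ∈ Her f, 0 ≤ w ∧ 0 ≤ x ∧ ZeroLimit w ∧ x ≠ 0 ∧ w * x = 0 := by
  obtain ⟨v, hv, hv0, hvz⟩ := exists_zeroLimit hN hf hf0
  obtain ⟨t, ht, h0, -⟩ := hvz 1 one_pos
  have hsa := hv0.isSelfAdjoint
  have e1 : ∀ p : ℝ → ℝ, Continuous p → cfc (fun s => s * p s * s) v ∈ Her f := by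
    intro p hp
    have := Her.conj hv (cfc p v)
    rwa [mul_cfc_mul_self hp hsa] at this
  have hmax : ∀ s : ℝ, 0 < max s (t / 4) := fun s => lt_max_of_lt_right (by linarith)
  -- Cut the spectrum of v at t/2, where t is a spectral point: the part below keeps 0 as a limit
  -- point, and the part above is nonzero because it sees t.
  refine ⟨_, e1 (fun s => max (1 - 2 * s / t) 0) (by fun_prop), _,
    e1 (fun s => max (s - t / 2) 0) (by fun_prop), cfc_nonneg fun s _ => ?_,
    cfc_nonneg fun s _ => ?_, hvz.of_cfc hsa (by fun_prop)
      (s := min 1 (t / 2)) (by positivity) fun s h1 h2 => ?_, fun h => ?_, ?_⟩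
  · have := mul_nonneg (mul_self_nonneg s) (le_max_right (1 - 2 * s / t) 0)
    linarith
  · have := mul_nonneg (mul_self_nonneg s) (le_max_right (s - t / 2) 0)
    linarith
  · have h3 : s < 1 := h2.trans_le (min_le_left _ _)
    have h4 : s < t / 2 := h2.trans_le (min_le_right _ _)
    have h5 : 2 * s / t < 1 := by rw [div_lt_one h0]; linarith
    rw [max_eq_left (by linarith)]
    have h6 : 0 < 2 * s / t := by positivity
    have h7 : 0 < 1 - 2 * s / t := by linarith
    refine ⟨by positivity, ?_⟩
    have h8 : s * (1 - 2 * s / t) ≤ 1 := by nlinarith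
    nlinarith
  · have := eq_zero_of_cfc_eq_zero hsa (by fun_prop) h ht
    rw [max_eq_left (by linarith)] at this
    have h2 : 0 < t - t / 2 := by linarith
    have : 0 < t * (t - t / 2) * t := by positivity
    linarith
  · rw [cfc_mul_cfc (by fun_prop) (by fun_prop), ← cfc_zero ℝ v]
    refine cfc_congr fun s _ => ?_
    simp only [Pi.zero_apply]
    rcases le_total s (t / 2) with h | h
    · rw [max_eq_right (show s - t / 2 ≤ 0 by linarith)]; simp
    · have : 1 ≤ 2 * s / t := by rw [le_div_iff₀ h0]; linarith
      rw [max_eq_right (show 1 - 2 * s / t ≤ 0 by linarith)]; simp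

theorem mul_self_nonneg' {c : E} (hc : IsSelfAdjoint c) : 0 ≤ c * c := by
  have := star_mul_self_nonneg c
  rwa [hc.star_eq] at this

theorem conj_nonneg' {a : E} (ha : 0 ≤ a) (c : E) : 0 ≤ c * a * star c := by
  simpa using conj_le_conj ha c

theorem csub_self_mul_self {t : E} (ht : 0 ≤ t) : CSub (t * t) t := by
  refine csub_of_le_smul (norm_nonneg t) (mul_self_nonneg' ht.isSelfAdjoint) ?_
  obtain ⟨s, hs0, hs⟩ := exists_sqrt ht
  have := conj_le_norm_smul ht.isSelfAdjoint s
  rw [hs0.isSelfAdjoint.star_eq, hs] at this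
  have h2 : s * t * s = t * t := by rw [← hs]; simp only [mul_assoc]
  rwa [h2] at this

/-- uu* ≾ (uu*)² = u (u*u) u*. -/
theorem csub_mul_star_self (u : E) : CSub (u * star u) (star u * u) := by
  refine (csub_sq (mul_star_self_nonneg u)).trans ?_
  have : u * star u * (u * star u) = u * (star u * u) * star u := by simp only [mul_assoc]
  rw [this]
  exact CSub.conj _ _

/-- A nonzero positive element `b` can be compared with a sum of an element `b₁`, an element `z`
dominated by a prescribed nonzero element `t`, such that below `b` there is room for `b₁` and two
more nonzero elements. -/
theorem exists_small_splitting (hN : NoMinimal E) (hP : IsPrimeRing E) {b t : E} (hb : 0 ≤ b)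
    (hb0 : b ≠ 0) (ht : 0 ≤ t) (ht0 : t ≠ 0) :
    ∃ b₁ z w x : E, 0 ≤ b₁ ∧ 0 ≤ z ∧ 0 ≤ w ∧ 0 ≤ x ∧ CSub b (b₁ + z) ∧ CSub z t ∧
      CSub (b₁ + w + x) b ∧ ZeroLimit w ∧ x ≠ 0 ∧ b₁ * w = 0 ∧ (b₁ + w) * x = 0 := by
  obtain ⟨c, hc, rfl⟩ := exists_sqrt hb
  have hcs := hc.isSelfAdjoint
  have hc0 : c ≠ 0 := by rintro rfl; simp at hb0
  obtain ⟨m, hm⟩ := hP c t hc0 ht0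
  have hu0 : (c * m * t) * star (c * m * t) ≠ 0 := by
    rwa [Ne, CStarRing.mul_star_self_eq_zero_iff]
  -- The element u links b = c² with t: uu* lies in c E c, while u*u lies in t E t.
  set u := c * m * t with hu
  set f : E := ‖u * star u‖⁻¹ • (u * star u) with hf
  have hf0 : 0 ≤ f := smul_nonneg (by positivity) (mul_star_self_nonneg u)
  have hfs := hf0.isSelfAdjoint
  have hfn : ‖f‖ = 1 := by
    rw [hf, norm_smul, norm_inv, norm_norm, inv_mul_cancel₀ (norm_ne_zero_iff.2 hu0)]
  have hnt : Nontrivial E := ⟨c, 0, hc0⟩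
  obtain ⟨R, hR⟩ : ∃ R, f = c * R * c := by
    refine ⟨‖u * star u‖⁻¹ • (m * t * star t * star m), ?_⟩
    rw [hf, hu, star_mul, star_mul, hcs.star_eq, mul_smul_comm, smul_mul_assoc]
    simp only [mul_assoc]
  have hmax : ∀ s : ℝ, 0 < max s (1 / 2) := fun s => lt_max_of_lt_right (by norm_num)
  have hl : Continuous fun s : ℝ => 1 / max s (1 / 2) ^ 2 :=
    continuous_const.div₀ (by fun_prop) fun s => (pow_pos (hmax s) 2).ne'
  -- This function is 1 on [1/2, ∞), so φ is a unit for g = (f - 1/2)_+. Its outer factors s keep φ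
  -- inside f E f.
  have hφ : Continuous fun s : ℝ => s * (1 / max s (1 / 2) ^ 2) * s := by fun_prop
  set L := cfc (fun s : ℝ => 1 / max s (1 / 2) ^ 2) f with hL
  set φ := cfc (fun s : ℝ => s * (1 / max s (1 / 2) ^ 2) * s) f with hφd
  have hφs : star φ = φ := cfc_isSelfAdjoint _ _
  have hLs : star L = L := cfc_isSelfAdjoint _ _
  have hφL : φ = f * L * f := by
    rw [hL, mul_cfc_mul_self hl hfs]
  obtain ⟨Q, hQ⟩ : ∃ Q, φ = c * Q * c :=
    ⟨R * c * L * c * R, by rw [hφL, hR]; simp only [mul_assoc]⟩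
  set g : E := cutDown f (1 / 2) with hg
  have hgc : Continuous fun s : ℝ => max (s - 1 / 2) 0 := by fun_prop
  have hg0 : 0 ≤ g := cutDown_nonneg _ _
  have hgne : g ≠ 0 := by
    intro h
    have h1 := CStarAlgebra.norm_mem_spectrum_of_nonneg hf0
    rw [hfn] at h1
    have := eq_zero_of_cfc_eq_zero hfs hgc h h1
    norm_num at this
  have hφg : φ * g = g := by
    rw [hφd, hg, cutDown, cfc_mul_cfc hφ hgc]
    refine cfc_congr fun s _ => ?_
    rcases le_total s (1 / 2) with h | h
    · rw [max_eq_right (show s - 1 / 2 ≤ 0 by linarith)]; simp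
    · rw [max_eq_left h]
      have : s ≠ 0 := by linarith
      field_simp
  have hgher : g ∈ Her c := by
    have hj : Continuous fun s : ℝ => max (s - 1 / 2) 0 * (1 / max s (1 / 2) ^ 2) := by fun_prop
    have : g = f * cfc (fun s : ℝ => max (s - 1 / 2) 0 * (1 / max s (1 / 2) ^ 2)) f * f := by
      rw [mul_cfc_mul_self hj hfs, hg, cutDown]
      refine cfc_congr fun s _ => ?_
      rcases le_total s (1 / 2) with h | h
      · rw [max_eq_right (show s - 1 / 2 ≤ 0 by linarith)]; simp
      · rw [max_eq_left h]
        have : s ≠ 0 := by linarith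
        field_simp
    rw [this]
    refine Her.conj ?_ _
    rw [hR]; exact Her.mem _ _
  -- Everything in the hereditary subalgebra of g is fixed by φ, hence killed by 1 - φ, and so
  -- orthogonal to b₁ = (1 - φ) b (1 - φ).
  obtain ⟨w, hw, x, hx, hw0, hx0, hwz, hxne, hwx⟩ := exists_split_zeroLimit hN hg0 hgne
  have hφw := Her.mul_eq_of_mul_eq hφg hw
  have hφx := Her.mul_eq_of_mul_eq hφg hx
  have hb₁ : 0 ≤ (1 - φ) * (c * c) * star (1 - φ) := conj_nonneg' hb _
  have hz₁ : 0 ≤ φ * (c * c) * star φ := conj_nonneg' hb _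
  have hk : star (1 - φ) = 1 - φ := by rw [star_sub, star_one, hφs]
  rw [hk] at hb₁
  rw [hφs] at hz₁
  have hb₁w : (1 - φ) * (c * c) * (1 - φ) * w = 0 := by
    rw [mul_assoc, sub_mul 1 φ w, one_mul, hφw, sub_self, mul_zero]
  have hb₁x : (1 - φ) * (c * c) * (1 - φ) * x = 0 := by
    rw [mul_assoc, sub_mul 1 φ x, one_mul, hφx, sub_self, mul_zero]
  refine ⟨(1 - φ) * (c * c) * (1 - φ), φ * (c * c) * φ, w, x, hb₁, hz₁, hw0, hx0, ?_, ?_, ?_, hwz,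
    hxne, hb₁w, by rw [add_mul, hb₁x, hwx, add_zero]⟩
  -- The difference 2 ((1 - φ) b (1 - φ) + φ b φ) - b equals (1 - 2φ) b (1 - 2φ).
  · refine csub_of_le_smul (r := 2) (by norm_num) hb ?_
    rw [← sub_nonneg]
    have h1 := conj_nonneg' hb (1 - 2 * φ)
    have h2 : star (1 - 2 * φ) = 1 - 2 * φ := by
      rw [two_mul, star_sub, star_one, star_add, hφs]
    rw [h2] at h1
    convert h1 using 1
    rw [two_smul]
    noncomm_ring
  -- The chain is φ b φ ≾ f² ≾ f ≾ uu* ≾ u*u ≾ t² ≾ t.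
  · have h1 : φ * (c * c) * φ = f * (L * f * (c * c) * f * L) * f := by
      rw [hφL]; simp only [mul_assoc]
    have h2 : CSub (φ * (c * c) * φ) (f * f) := by
      refine csub_of_le_smul (norm_nonneg (L * f * (c * c) * f * L)) hz₁ ?_
      rw [h1]
      have h3 : IsSelfAdjoint (L * f * (c * c) * f * L) := by
        simp only [IsSelfAdjoint, star_mul, hLs, hfs.star_eq, hcs.star_eq, mul_assoc]
      have := conj_le_norm_smul h3 f
      rwa [hfs.star_eq] at this
    have h3 : CSub f (u * star u) := csub_smul (by positivity) _
    have h4 : CSub (star u * u) (t * t) := by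
      have h5 : star u * u = star t * (star m * c * c * m) * t := by
        rw [hu, star_mul, star_mul, hcs.star_eq]; simp only [mul_assoc]
      have h6 : IsSelfAdjoint (star m * c * c * m) := by
        simp only [IsSelfAdjoint, star_mul, hcs.star_eq, mul_assoc, star_star]
      refine csub_of_le_smul (norm_nonneg (star m * c * c * m)) (star_mul_self_nonneg u) ?_
      have := conj_le_norm_smul h6 t
      rw [h5]
      rwa [ht.isSelfAdjoint.star_eq] at this ⊢
    exact h2.trans ((csub_self_mul_self hf0).trans (h3.trans ((csub_mul_star_self u).trans
      (h4.trans (csub_self_mul_self ht)))))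
  · refine csub_of_mem_her hcs (add_nonneg (add_nonneg hb₁ hw0) hx0)
      (Her.add (Her.add ?_ (Her.trans hw hgher)) (Her.trans hx hgher))
    have : (1 - φ) * (c * c) * (1 - φ) = c * ((1 - Q * (c * c)) * (1 - (c * c) * Q)) * c := by
      rw [hQ]; noncomm_ring
    rw [this]
    exact Her.mem _ _

/-- Every isometry is a unitary. -/
def IsFinite' (E : Type*) [CStarAlgebra E] : Prop := ∀ v : E, star v * v = 1 → v * star v = 1

/-- Let G = g(a) with g(s) = s / max(s, 2t), k = (1 - G)^{1/2} and d² = (a - δ)_+, so that k d = 0.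
From G ≾ d² choose w with w d² w* ≈ G. Then v = d w* + k satisfies v*v ≈ 1, and it is corrected to
an isometry v q, which finiteness makes unitary. Compressing v q² v* = 1 by k yields (1 - G) q² (1 -
G) = 1 - G with q² ≈ 1, so 1 - G is nearly idempotent. But g(t) = 1/2. -/
theorem false_of_csub_cutDown (hE : IsFinite' E) {a : E} (ha : 0 ≤ a) {δ t : ℝ}
    (h : CSub a (cutDown a δ)) (ht : t ∈ spectrum ℝ a) (ht0 : 0 < t) (htδ : 2 * t ≤ δ) : False := by
  have hnt : Nontrivial E := by
    by_contra hn
    rw [not_nontrivial_iff_subsingleton] at hn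
    simp [spectrum.of_subsingleton] at ht
  have hsa := ha.isSelfAdjoint
  have hmax : ∀ s : ℝ, 0 < max s (2 * t) := fun s => lt_max_of_lt_right (by linarith)
  have hg1 : Continuous fun s : ℝ => 1 / √(max s (2 * t)) :=
    continuous_const.div₀ (by fun_prop) fun s => (Real.sqrt_pos.2 (hmax s)).ne'
  have hg : Continuous fun s : ℝ => s / max s (2 * t) :=
    continuous_id.div₀ (by fun_prop) fun s => (hmax s).ne'
  set G := cfc (fun s : ℝ => s / max s (2 * t)) a with hG
  have hGa : CSub G a := by
    have : G = cfc (fun s : ℝ => 1 / √(max s (2 * t))) a * a *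
        star (cfc (fun s : ℝ => 1 / √(max s (2 * t))) a) := by
      rw [cfc_conj_self hg1 hsa]
      refine cfc_congr fun s _ => ?_
      have h2 := Real.sqrt_pos.2 (hmax s)
      have h3 := (hmax s).ne'
      field_simp
      rw [Real.sq_sqrt (hmax s).le]
    rw [this]
    exact CSub.conj _ _
  -- The tolerance 1/16 leads to ‖q² - 1‖ ≤ 1/15, which is below the value 1/4 reached at t.
  obtain ⟨w, hw⟩ := (hGa.trans h) (1 / 16) (by norm_num)
  have hle : ∀ s : ℝ, s / max s (2 * t) ≤ 1 := fun s => (div_le_one (hmax s)).2 (le_max_left _ _)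
  have hk : Continuous fun s : ℝ => √(1 - s / max s (2 * t)) := by fun_prop
  have hd : Continuous fun s : ℝ => √(max (s - δ) 0) := by fun_prop
  set k := cfc (fun s : ℝ => √(1 - s / max s (2 * t))) a with hkd
  set d := cfc (fun s : ℝ => √(max (s - δ) 0)) a with hdd
  have hks : star k = k := cfc_isSelfAdjoint _ _
  have hds : star d = d := cfc_isSelfAdjoint _ _
  have hdd' : d * d = cutDown a δ := by
    rw [hdd, cfc_mul_cfc hd hd, cutDown]
    exact cfc_congr fun s _ => Real.mul_self_sqrt (le_max_right _ _)
  have hkk : k * k = 1 - G := by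
    rw [hkd, cfc_mul_cfc hk hk, hG, ← cfc_one ℝ a hsa, ← cfc_sub (1 : ℝ → ℝ) _ a (by fun_prop)
      hg.continuousOn]
    exact cfc_congr fun s _ => Real.mul_self_sqrt (by linarith [hle s])
  have hkd0 : k * d = 0 := by
    rw [hkd, hdd, cfc_mul_cfc hk hd, ← cfc_zero ℝ a]
    refine cfc_congr fun s _ => ?_
    simp only [Pi.zero_apply]
    rcases le_total s δ with h | h
    · rw [max_eq_right (show s - δ ≤ 0 by linarith)]; simp
    · have : 2 * t ≤ s := htδ.trans h
      rw [max_eq_left this, div_self (by linarith)]; simp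
  have hdk0 : d * k = 0 := by
    have := congrArg star hkd0
    rwa [star_mul, hks, hds, star_zero] at this
  set v := d * star w + k with hv
  set p := star v * v with hp
  have hp1 : p = w * cutDown a δ * star w + (1 - G) := by
    rw [hp, hv, star_add, star_mul, star_star, hds, hks, ← hdd', ← hkk]
    have e1 : w * d * k = 0 := by rw [mul_assoc, hdk0, mul_zero]
    have e2 : k * (d * star w) = 0 := by rw [← mul_assoc, hkd0, zero_mul]
    rw [add_mul, mul_add, mul_add, e1, e2]
    simp only [mul_assoc, add_zero, zero_add]
  have hpn : ‖p - 1‖ < 1 / 16 := by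
    have : p - 1 = w * cutDown a δ * star w - G := by rw [hp1]; abel
    rwa [this]
  have hps : IsSelfAdjoint p := IsSelfAdjoint.star_mul_self v
  have hsp : ∀ s ∈ spectrum ℝ p, |s - 1| < 1 / 16 := by
    intro s hs
    have : s - 1 ∈ spectrum ℝ (p - 1) := by
      have h1 : p - 1 = cfc (fun s : ℝ => s - 1) p := by
        rw [cfc_sub (fun s : ℝ => s) (fun _ => 1) p, cfc_id' ℝ p, cfc_const_one ℝ p]
      rw [h1, cfc_map_spectrum (fun s : ℝ => s - 1) p]
      exact ⟨s, hs, rfl⟩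
    exact (spectrum.norm_le_norm_of_mem this).trans_lt hpn
  have hmax2 : ∀ s : ℝ, 0 < max s (1 / 2) := fun s => lt_max_of_lt_right (by norm_num)
  have hqc : Continuous fun s : ℝ => 1 / √(max s (1 / 2)) :=
    continuous_const.div₀ (by fun_prop) fun s => (Real.sqrt_pos.2 (hmax2 s)).ne'
  set q := cfc (fun s : ℝ => 1 / √(max s (1 / 2))) p with hq
  have hqs : star q = q := cfc_isSelfAdjoint _ _
  have hqpq : q * p * q = 1 := by
    rw [hq, cfc_mul_self_mul hqc hps, cfc_mul_cfc (by fun_prop) hqc, ← cfc_one ℝ p hps]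
    refine cfc_congr fun s hs => ?_
    have h1 := abs_lt.1 (hsp s hs)
    simp only [Pi.one_apply]
    rw [max_eq_left (by linarith [h1.1])]
    have h2 : 0 < s := by linarith [h1.1]
    have h3 := Real.sqrt_pos.2 h2
    field_simp
    rw [Real.sq_sqrt h2.le]
  have hqq : ‖q * q - 1‖ ≤ 1 / 15 := by
    rw [hq, cfc_mul_cfc hqc hqc, ← cfc_one ℝ p hps, ← cfc_sub _ (1 : ℝ → ℝ) p (by fun_prop)
      (by fun_prop)]
    refine norm_cfc_le (by norm_num) fun s hs => ?_
    have h1 := abs_lt.1 (hsp s hs)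
    simp only [Pi.one_apply]
    rw [max_eq_left (by linarith [h1.1])]
    have h2 : 0 < s := by linarith [h1.1]
    have h4 : 1 / √s * (1 / √s) = 1 / s := by
      rw [div_mul_div_comm, one_mul, Real.mul_self_sqrt h2.le]
    rw [h4, Real.norm_eq_abs, abs_le, div_sub_one h2.ne', le_div_iff₀ h2, div_le_iff₀ h2]
    constructor <;> linarith [h1.1, h1.2]
  have hiso : star (v * q) * (v * q) = 1 := by
    rw [star_mul, hqs, ← hqpq, hp]; simp only [mul_assoc]
  have huni := hE _ hiso
  rw [star_mul, hqs] at huni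
  have hkv : k * v = 1 - G := by
    rw [hv, mul_add, ← mul_assoc, hkd0, zero_mul, zero_add, hkk]
  have hvk : star v * k = 1 - G := by
    have := congrArg star hkv
    rwa [star_mul, hks, star_sub, star_one, show star G = G from cfc_isSelfAdjoint _ _] at this
  have hfin : (1 - G) * (q * q) * (1 - G) = 1 - G := by
    calc (1 - G) * (q * q) * (1 - G) = k * (v * q * (q * star v)) * k := by
          nth_rw 1 [← hkv]; rw [← hvk]; simp only [mul_assoc]
      _ = 1 - G := by rw [huni, mul_one, hkk]
  have hG1 : ‖1 - G‖ ≤ 1 := by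
    rw [hG, ← cfc_one ℝ a hsa, ← cfc_sub (1 : ℝ → ℝ) _ a (by fun_prop) hg.continuousOn]
    refine norm_cfc_le (by norm_num) fun s hs => ?_
    have h1 : 0 ≤ s / max s (2 * t) := div_nonneg (spectrum_nonneg' ha hs) (hmax s).le
    simp only [Pi.one_apply]
    rw [Real.norm_eq_abs, abs_le]
    constructor <;> linarith [hle s]
  have h1 : (1 - G) - (1 - G) * (1 - G) = (1 - G) * (q * q - 1) * (1 - G) := by
    nth_rw 1 [← hfin]; noncomm_ring
  have h2 : ‖(1 - G) - (1 - G) * (1 - G)‖ ≤ 1 / 15 := by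
    rw [h1]
    calc _ ≤ ‖1 - G‖ * ‖q * q - 1‖ * ‖1 - G‖ := norm_mul₃_le
      _ ≤ 1 * (1 / 15) * 1 := by gcongr
      _ = 1 / 15 := by norm_num
  have h3 : (1 - G) - (1 - G) * (1 - G) =
      cfc (fun s : ℝ => s / max s (2 * t) * (1 - s / max s (2 * t))) a := by
    have : (1 - G) - (1 - G) * (1 - G) = G * (1 - G) := by noncomm_ring
    rw [this, hG, ← cfc_one ℝ a hsa, ← cfc_sub (1 : ℝ → ℝ) _ a (by fun_prop) hg.continuousOn,
      cfc_mul_cfc hg (by fun_prop)]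
    rfl
  -- At s = t the function g (1 - g) takes the value 1/2 · 1/2.
  have h4 : (1 / 4 : ℝ) ∈ spectrum ℝ ((1 - G) - (1 - G) * (1 - G)) := by
    rw [h3, cfc_map_spectrum _ a hsa (by fun_prop)]
    refine ⟨t, ht, ?_⟩
    simp only
    rw [max_eq_right (by linarith)]
    field_simp
    norm_num
  have h5 := (spectrum.norm_le_norm_of_mem h4).trans h2
  norm_num at h5

end Splitting

/-! ### Consequences of simplicity and of not being of type I. -/

section Simple

variable {A : Type*} [CStarAlgebra A]

/-- In a simple unital C*-algebra, every nonzero (algebraic) ideal contains the unit. -/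
theorem IsSimpleCStar.one_mem (hA : IsSimpleCStar A) (J : Set A)
    (hadd : ∀ x ∈ J, ∀ y ∈ J, x + y ∈ J) (hl : ∀ (x : A), ∀ y ∈ J, x * y ∈ J)
    (hr : ∀ x ∈ J, ∀ y : A, x * y ∈ J) {b : A} (hb : b ∈ J) (hb0 : b ≠ 0) : (1 : A) ∈ J := by
  have hnt := hA.1
  have h0 : (0 : A) ∈ closure J := subset_closure (by simpa using hl 0 b hb)
  let I : TwoSidedIdeal A := TwoSidedIdeal.mk' (closure J) h0
    (fun {x y} hx hy => map_mem_closure₂ continuous_add hx hy hadd)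
    (fun {x} hx => map_mem_closure continuous_neg hx fun x hx => by simpa using hl (-1) x hx)
    (fun {x y} hy => map_mem_closure (continuous_const_mul x) hy fun y hy => hl x y hy)
    (fun {x y} hx => map_mem_closure (f := fun x => x * y) (by fun_prop) hx fun x hx => hr x hx y)
  have hI : ∀ x, x ∈ I ↔ x ∈ closure J := fun x => TwoSidedIdeal.mem_mk' _ _ _ _ _ _ x
  have hIc : IsClosed (I : Set A) := by
    have : (I : Set A) = closure J := Set.ext hI
    rw [this]; exact isClosed_closure
  have h1 : (1 : A) ∈ closure J := by
    rcases hA.2 I hIc with h | h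
    · have : b ∈ I := (hI b).2 (subset_closure hb)
      rw [h] at this
      exact absurd ((TwoSidedIdeal.mem_bot _).1 this) hb0
    · rw [← hI, h]; trivial
  -- The ideal is dense, so it contains an element at distance less than 1 from the unit, which is
  -- invertible.
  obtain ⟨x, hx, hx1⟩ := Metric.mem_closure_iff.1 h1 1 one_pos
  rw [dist_eq_norm] at hx1
  have hu : IsUnit x := by
    have := isUnit_one_sub_of_norm_lt_one hx1
    simpa using this
  obtain ⟨u, rfl⟩ := hu
  simpa using hl (↑u⁻¹) _ hx

/-- The elements x with x A t = 0 form a two-sided ideal. If it contained c ≠ 0 it would contain 1,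
giving t = 0. -/
theorem IsSimpleCStar.isPrimeRing (hA : IsSimpleCStar A) : IsPrimeRing A := by
  intro c t hc ht
  by_contra hcon
  push Not at hcon
  have : (1 : A) ∈ {x : A | ∀ y, x * y * t = 0} :=
    hA.one_mem _ (fun x hx y hy z => by rw [add_mul, add_mul, hx, hy, add_zero])
      (fun x y hy z => by rw [mul_assoc x, mul_assoc x, hy, mul_zero])
      (fun x hx y z => by rw [mul_assoc x]; exact hx _) (b := c) hcon hc
  exact ht (by simpa using this 1)

/-- In an irreducible representation π(h) has rank one, hence is compact. The vectors whose whole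
A-orbit is mapped by π(h) into the line of π(h)η form a closed invariant subspace, and h A h ⊆ ℂ h
puts π(h)η in it. -/
theorem exists_compact_of_scalar_corner (hA : IsSimpleCStar A) {h : A} (h0 : h ≠ 0)
    (hh : ∀ m : A, ∃ r : ℂ, h * m * h = r • h) : IsTypeI A := by
  intro H _ _ _ π hπ
  obtain ⟨hnt, hirr⟩ := hπ
  have hne : π h ≠ 0 := by
    intro hz
    have : (1 : A) ∈ {x : A | π x = 0} :=
      hA.one_mem _ (fun x hx y hy => by simp_all) (fun x y hy => by simp_all)
        (fun x hx y => by simp_all) (b := h) hz h0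
    rw [Set.mem_ofPred_eq, map_one] at this
    exact one_ne_zero this
  refine ⟨h, hne, ?_⟩
  obtain ⟨η, hη⟩ : ∃ η, π h η ≠ 0 := by
    by_contra hcon
    push Not at hcon
    exact hne (ContinuousLinearMap.ext hcon)
  let S : Submodule ℂ H := Submodule.span ℂ {π h η}
  have hSc : IsClosed (S : Set H) := S.closed_of_finiteDimensional
  let K : Submodule ℂ H := ⨅ a : A, S.comap (π h * π a : H →L[ℂ] H).toLinearMap
  have hK : ∀ ζ, ζ ∈ K ↔ ∀ a, π h (π a ζ) ∈ S := fun ζ => by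
    simp [K, Submodule.mem_iInf]
  have hKtop : K = ⊤ := by
    have hKc : IsClosed (K : Set H) := by
      have : (K : Set H) = ⋂ a : A, (fun ζ => π h (π a ζ)) ⁻¹' (S : Set H) := by
        ext ζ; simp [hK]
      rw [this]
      exact isClosed_iInter fun a => hSc.preimage (by fun_prop)
    refine (hirr K hKc fun a ζ hζ => ?_).resolve_left fun hbot => hη ?_
    · rw [hK] at hζ ⊢
      intro a'
      have := hζ (a' * a)
      rwa [map_mul] at this
    · have : π h η ∈ K := by
        rw [hK]
        intro a
        obtain ⟨r, hr⟩ := hh a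
        have : π h (π a (π h η)) = r • π h η := by
          have := congrArg (fun x => π x η) hr
          simpa using this
        rw [this]
        exact S.smul_mem _ (Submodule.mem_span_singleton_self _)
      rw [hbot] at this
      exact (Submodule.mem_bot ℂ).1 this
  have hrange : ∀ ζ, π h ζ ∈ S := fun ζ => by
    have : ζ ∈ K := by rw [hKtop]; trivial
    simpa using (hK ζ).1 this 1
  have : ProperSpace S := FiniteDimensional.proper ℂ S
  have h1 : IsCompactOperator ((π h).codRestrict S hrange) :=
    isCompactOperator_of_locallyCompactSpace_dom _
  exact h1.clm_comp S.subtypeL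

theorem noMinimal_of_not_isTypeI (hA : IsSimpleCStar A) (hI : ¬ IsTypeI A) : NoMinimal A := by
  intro h h0
  by_contra hcon
  push Not at hcon
  exact hI (exists_compact_of_scalar_corner hA h0 hcon)

end Simple

/-! ### Primeness and absence of scalar corners pass to matrix algebras. -/

section Matrices

variable {A : Type*} [CStarAlgebra A] [PartialOrder A] [StarOrderedRing A]
variable {n : Type*} [Fintype n] [DecidableEq n]

/-- The matrix with a single nonzero entry `a`. -/
def single {m n D : Type*} [DecidableEq m] [DecidableEq n] [Zero D] (i : m) (j : n) (a : D) :
    CStarMatrix m n D :=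
  CStarMatrix.ofMatrix (Matrix.of fun p q => if p = i ∧ q = j then a else 0)

theorem single_apply {m n D : Type*} [DecidableEq m] [DecidableEq n] [Zero D] (i : m) (j : n)
    (a : D) (p : m) (q : n) : single i j a p q = if p = i ∧ q = j then a else 0 := rfl

theorem mul_single_mul_apply {m k D : Type*} [NonUnitalRing D] (x : CStarMatrix m n D) (i j : n)
    (a : D) (y : CStarMatrix n k D) (p : m) (q : k) :
    (x * single i j a * y) p q = x p i * a * y j q := by
  rw [CStarMatrix.mul_apply, Finset.sum_eq_single j]
  · rw [CStarMatrix.mul_apply, Finset.sum_eq_single i]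
    · simp [single_apply]
    · intro b _ hb; simp [single_apply, hb]
    · simp
  · intro b _ hb
    rw [CStarMatrix.mul_apply, Finset.sum_eq_zero, zero_mul]
    intro c _
    simp [single_apply, hb]
  · simp

theorem exists_entry_ne_zero {m k D : Type*} [Zero D] {x : CStarMatrix m k D} (hx : x ≠ 0) :
    ∃ i j, x i j ≠ 0 := by
  by_contra hcon
  push Not at hcon
  exact hx (CStarMatrix.ext hcon)

/-- A matrix with a single entry between two matrices isolates one entry of each, which reduces the
claim to `A`. -/
theorem isPrimeRing_matrix (hA : IsPrimeRing A) : IsPrimeRing (CStarMatrix n n A) := by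
  intro c t hc ht
  obtain ⟨i, j, hij⟩ := exists_entry_ne_zero hc
  obtain ⟨p, q, hpq⟩ := exists_entry_ne_zero ht
  obtain ⟨a, ha⟩ := hA _ _ hij hpq
  refine ⟨single j p a, fun h => ha ?_⟩
  rw [← mul_single_mul_apply, h]
  rfl

theorem noMinimal_matrix (hA : NoMinimal A) : NoMinimal (CStarMatrix n n A) := by
  intro h h0
  obtain ⟨i, j, hij⟩ := exists_entry_ne_zero h0
  obtain ⟨m, hm⟩ := hA _ hij
  refine ⟨single j i m, fun r hr => hm r ?_⟩
  rw [← mul_single_mul_apply, hr]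
  rfl

end Matrices

/-! ### Cuntz comparison for matrices of different sizes. -/

section RectangularMatrices

variable {D : Type*} [NonUnitalCStarAlgebra D]
variable {m n k l : Type*} [Fintype m] [Fintype n] [Fintype k] [Fintype l]

theorem rect_mul_assoc (x : CStarMatrix m n D) (y : CStarMatrix n k D) (z : CStarMatrix k l D) :
    x * y * z = x * (y * z) := Matrix.mul_assoc (CStarMatrix.ofMatrix.symm x) _ _

theorem rect_conjTranspose_mul (x : CStarMatrix m n D) (y : CStarMatrix n k D) :
    (x * y).conjTranspose = y.conjTranspose * x.conjTranspose :=
  Matrix.conjTranspose_mul (CStarMatrix.ofMatrix.symm x) (CStarMatrix.ofMatrix.symm y)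

theorem rect_conjTranspose_conjTranspose (x : CStarMatrix m n D) :
    x.conjTranspose.conjTranspose = x :=
  Matrix.conjTranspose_conjTranspose (CStarMatrix.ofMatrix.symm x)

theorem CuntzSub.conj (y : CStarMatrix m n D) (b : CStarMatrix n n D) :
    CuntzSub (y * b * y.conjTranspose) b := ⟨fun _ => y, tendsto_const_nhds⟩

theorem cuntzSub_iff_csub {A : Type*} [CStarAlgebra A] [PartialOrder A] [StarOrderedRing A]
    [DecidableEq n] {a b : CStarMatrix n n A} : CuntzSub a b ↔ CSub a b := by
  rw [cuntzSub_iff, Metric.mem_closure_iff]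
  simp only [Set.exists_range_iff, dist_comm a, dist_eq_norm]
  rfl

theorem cuntzSub_mul_conjTranspose {A : Type*} [CStarAlgebra A] [PartialOrder A]
    [StarOrderedRing A] [DecidableEq m] (z : CStarMatrix m n A)
    (hz : 0 ≤ z * z.conjTranspose) :
    CuntzSub (z * z.conjTranspose) (z.conjTranspose * z) := by
  have h1 : CuntzSub (z * z.conjTranspose) ((z * z.conjTranspose) * (z * z.conjTranspose)) :=
    cuntzSub_iff_csub.2 (csub_sq hz)
  have h2 : (z * z.conjTranspose) * (z * z.conjTranspose)
      = z * (z.conjTranspose * z) * z.conjTranspose := by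
    simp only [rect_mul_assoc]
  exact h1.trans (h2 ▸ CuntzSub.conj z _)

theorem CuntzSub.of_tendsto [PartialOrder D] [StarOrderedRing D] {ι : Type*} {f : Filter ι}
    [f.NeBot] {a : CStarMatrix m m D}
    {b : CStarMatrix n n D} {u : ι → CStarMatrix m m D} (hu : Tendsto u f (𝓝 a))
    (h : ∀ i, CuntzSub (u i) b) : CuntzSub a b := by
  rw [cuntzSub_iff]
  exact isClosed_closure.mem_of_tendsto hu (Eventually.of_forall fun i => cuntzSub_iff.1 (h i))

end RectangularMatrices

/-! ### Order and addition in W(A). -/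

section WLemmas

variable {A : Type*} [CStarAlgebra A] [PartialOrder A] [StarOrderedRing A]

theorem cls_le_of_csub {n : ℕ} {a b : CStarMatrix (Fin n) (Fin n) A} {ha : 0 ≤ a} {hb : 0 ≤ b}
    (h : CSub a b) : cls a ha ≤ cls b hb := cls_le_cls.2 (cuntzSub_iff_csub.2 h)

theorem W.zero_le {D : Type*} [NonUnitalCStarAlgebra D] [PartialOrder D] [StarOrderedRing D]
    (x : W D) : 0 ≤ x := by
  induction x using W.induction with | _ n a ha
  refine cls_le_cls.2 ⟨fun _ => 0, ?_⟩
  exact tendsto_entrywise fun i => i.elim0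

theorem cls_eq_zero_iff {D : Type*} [NonUnitalCStarAlgebra D] [PartialOrder D] [StarOrderedRing D]
    {n : ℕ} {a : CStarMatrix (Fin n) (Fin n) D} {ha : 0 ≤ a} :
    cls a ha = 0 ↔ a = 0 := by
  constructor
  · intro h
    obtain ⟨y, hy⟩ := cls_le_cls.1 (show cls a ha ≤ cls (0 : CStarMatrix (Fin 0) (Fin 0) D) le_rfl
      from h.le)
    refine tendsto_nhds_unique hy ?_
    refine tendsto_entrywise fun i j => ?_
    simp [CStarMatrix.mul_apply, CStarMatrix.zero_apply]
  · rintro rfl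
    refine le_antisymm ?_ (W.zero_le _)
    refine cls_le_cls.2 ⟨fun _ => 0, ?_⟩
    exact tendsto_entrywise fun i j => by
      simp [CStarMatrix.mul_apply, CStarMatrix.zero_apply]

/-- The row (1 1) conjugates a ⊕ b to a + b. -/
theorem cls_add_le {n : ℕ} {a b : CStarMatrix (Fin n) (Fin n) A} (ha : 0 ≤ a) (hb : 0 ≤ b) :
    cls (a + b) (add_nonneg ha hb) ≤ cls a ha + cls b hb := by
  rw [cls_add_cls, cls_le_cls]
  let y : CStarMatrix (Fin n) (Fin (n + n)) A := CStarMatrix.ofMatrix (Matrix.of fun i j =>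
    Fin.addCases (fun j => if i = j then 1 else 0) (fun j => if i = j then 1 else 0) j)
  have hl : ∀ i j, y i (Fin.castAdd n j) = if i = j then 1 else 0 := fun i j => by simp [-Fin.natAdd_eq_addNat, y]
  have hr : ∀ i j, y i (Fin.natAdd n j) = if i = j then 1 else 0 := fun i j => by simp [-Fin.natAdd_eq_addNat, y]
  have : a + b = y * dsum a b * y.conjTranspose := by
    ext i j
    simp [-Fin.natAdd_eq_addNat, CStarMatrix.mul_apply, Fin.sum_univ_add, hl, hr, CStarMatrix.conjTranspose_apply,
      apply_ite star]
  rw [this]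
  exact CuntzSub.conj _ _

theorem mul_eq_zero_of_sq {E : Type*} [CStarAlgebra E] {s t : E} (hs : IsSelfAdjoint s)
    (ht : IsSelfAdjoint t) (h : (s * s) * (t * t) = 0) : s * t = 0 := by
  have h1 : s * (t * t) = 0 := by
    rw [← CStarRing.star_mul_self_eq_zero_iff, star_mul, star_mul, ht.star_eq, hs.star_eq]
    calc t * t * s * (s * (t * t)) = t * t * ((s * s) * (t * t)) := by simp only [mul_assoc]
      _ = 0 := by rw [h, mul_zero]
  rw [← CStarRing.mul_star_self_eq_zero_iff, star_mul, ht.star_eq, hs.star_eq]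
  calc s * t * (t * s) = s * (t * t) * s := by simp only [mul_assoc]
    _ = 0 := by rw [h1, zero_mul]

/-- For the column z with entries s = a^{1/2} and t = b^{1/2}, orthogonality gives zz* = a ⊕ b,
while z*z = a + b. -/
theorem add_cls_le_of_mul_eq_zero {n : ℕ} {a b : CStarMatrix (Fin n) (Fin n) A} (ha : 0 ≤ a)
    (hb : 0 ≤ b) (hab : a * b = 0) :
    cls a ha + cls b hb ≤ cls (a + b) (add_nonneg ha hb) := by
  rw [cls_add_cls, cls_le_cls]
  obtain ⟨s, hs0, rfl⟩ := exists_sqrt ha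
  obtain ⟨t, ht0, rfl⟩ := exists_sqrt hb
  have hs := hs0.isSelfAdjoint
  have ht := ht0.isSelfAdjoint
  have hst := mul_eq_zero_of_sq hs ht hab
  have hts : t * s = 0 := by
    have := congrArg star hst
    rwa [star_mul, hs.star_eq, ht.star_eq, star_zero] at this
  let z : CStarMatrix (Fin (n + n)) (Fin n) A := CStarMatrix.ofMatrix (Matrix.of fun i j =>
    Fin.addCases (fun i => s i j) (fun i => t i j) i)
  have hl : ∀ i j, z (Fin.castAdd n i) j = s i j := fun i j => by simp [-Fin.natAdd_eq_addNat, z]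
  have hr : ∀ i j, z (Fin.natAdd n i) j = t i j := fun i j => by simp [-Fin.natAdd_eq_addNat, z]
  have hs' : ∀ i j, star (s i j) = s j i := fun i j => by
    rw [← CStarMatrix.star_apply, hs.star_eq]
  have ht' : ∀ i j, star (t i j) = t j i := fun i j => by
    rw [← CStarMatrix.star_apply, ht.star_eq]
  have e1 : dsum (s * s) (t * t) = z * z.conjTranspose := by
    ext i j
    rw [CStarMatrix.mul_apply]
    induction i using Fin.addCases with
    | left i =>
      induction j using Fin.addCases with
      | left j => simp [-Fin.natAdd_eq_addNat, hl, CStarMatrix.conjTranspose_apply, hs', CStarMatrix.mul_apply]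
      | right j =>
        have := congrArg (fun M => M i j) hst
        simp only [CStarMatrix.mul_apply] at this
        simp [-Fin.natAdd_eq_addNat, hl, hr, CStarMatrix.conjTranspose_apply, ht', this, CStarMatrix.zero_apply]
    | right i =>
      induction j using Fin.addCases with
      | left j =>
        have := congrArg (fun M => M i j) hts
        simp only [CStarMatrix.mul_apply] at this
        simp [-Fin.natAdd_eq_addNat, hl, hr, CStarMatrix.conjTranspose_apply, hs', this, CStarMatrix.zero_apply]
      | right j => simp [-Fin.natAdd_eq_addNat, hr, CStarMatrix.conjTranspose_apply, ht', CStarMatrix.mul_apply]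
  have e2 : s * s + t * t = z.conjTranspose * z := by
    ext i j
    simp [-Fin.natAdd_eq_addNat, CStarMatrix.mul_apply, Fin.sum_univ_add, hl, hr, CStarMatrix.conjTranspose_apply, hs',
      ht']
  rw [e1, e2]
  refine cuntzSub_mul_conjTranspose z ?_
  rw [← e1]
  exact dsum_nonneg ha hb

/-- The class of a positive element of `A`. -/
noncomputable def cls₁ (a : A) (ha : 0 ≤ a) : W A := cls (oneByOne a) (oneByOne_nonneg ha)

theorem oneByOne_mul (a b : A) : oneByOne (a * b) = oneByOne a * oneByOne b := by
  ext i j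
  rw [CStarMatrix.mul_apply, Fin.sum_univ_one]
  rfl

theorem cuntzSub_oneByOne {a b : A} (h : CSub a b) : CuntzSub (oneByOne a) (oneByOne b) := by
  choose w hw using fun k : ℕ => h (1 / (k + 1)) Nat.one_div_pos_of_nat
  refine ⟨fun k => oneByOne (w k), ?_⟩
  have : ∀ k, oneByOne (w k) * oneByOne b * (oneByOne (w k)).conjTranspose
      = oneByOne (w k * b * star (w k)) := fun k => by
    rw [oneByOne_mul, oneByOne_mul]; rfl
  simp only [this]
  refine tendsto_entrywise fun i j => ?_
  change Tendsto (fun k => w k * b * star (w k)) atTop (𝓝 a)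
  rw [tendsto_iff_norm_sub_tendsto_zero]
  exact squeeze_zero (fun _ => norm_nonneg _) (fun k => (hw k).le)
    tendsto_one_div_add_atTop_nhds_zero_nat

theorem cls₁_le_of_csub {a b : A} {ha : 0 ≤ a} {hb : 0 ≤ b} (h : CSub a b) :
    cls₁ a ha ≤ cls₁ b hb := cls_le_cls.2 (cuntzSub_oneByOne h)

theorem cls₁_congr {a b : A} {ha : 0 ≤ a} (h : a = b) : cls₁ a ha = cls₁ b (h ▸ ha) := by
  subst h; rfl

theorem cls₁_add_le {a b : A} (ha : 0 ≤ a) (hb : 0 ≤ b) :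
    cls₁ (a + b) (add_nonneg ha hb) ≤ cls₁ a ha + cls₁ b hb :=
  cls_add_le (oneByOne_nonneg ha) (oneByOne_nonneg hb)

theorem add_cls₁_le_of_mul_eq_zero {a b : A} (ha : 0 ≤ a) (hb : 0 ≤ b) (hab : a * b = 0) :
    cls₁ a ha + cls₁ b hb ≤ cls₁ (a + b) (add_nonneg ha hb) :=
  add_cls_le_of_mul_eq_zero (oneByOne_nonneg ha) (oneByOne_nonneg hb)
    (by rw [← oneByOne_mul, hab]; rfl)

theorem cls₁_ne_zero {a : A} {ha : 0 ≤ a} (h : a ≠ 0) : cls₁ a ha ≠ 0 := fun h0 =>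
  h (congrArg (fun M => M 0 0) (cls_eq_zero_iff.1 h0))

/-- The matrix `d ⊗ 1ₙ`. -/
def scalarMatrix {D : Type*} [Zero D] (n : Type*) [DecidableEq n] (d : D) : CStarMatrix n n D :=
  CStarMatrix.ofMatrix (Matrix.of fun i j => if i = j then d else 0)

theorem scalarMatrix_apply {D n : Type*} [Zero D] [DecidableEq n] (d : D) (i j : n) :
    scalarMatrix n d i j = if i = j then d else 0 := rfl

theorem scalarMatrix_mul {D n : Type*} [NonUnitalCStarAlgebra D] [Fintype n] [DecidableEq n]
    (d e : D) : scalarMatrix n (d * e) = scalarMatrix n d * scalarMatrix n e := by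
  ext i j
  simp [CStarMatrix.mul_apply, scalarMatrix_apply]

theorem scalarMatrix_star {D n : Type*} [NonUnitalCStarAlgebra D] [Fintype n] [DecidableEq n]
    (d : D) : scalarMatrix n (star d) = star (scalarMatrix n d) := by
  ext i j
  simp [CStarMatrix.star_apply, scalarMatrix_apply, apply_ite star, eq_comm]

theorem scalarMatrix_nonneg {n : Type*} [Fintype n] [DecidableEq n] {d : A} (hd : 0 ≤ d) :
    0 ≤ scalarMatrix n d := by
  obtain ⟨x, rfl⟩ := nonneg_iff_exists.1 hd
  rw [scalarMatrix_mul, scalarMatrix_star]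
  exact star_mul_self_nonneg _

theorem cls_scalarMatrix (n : ℕ) {d : A} (hd : 0 ≤ d) :
    cls (scalarMatrix (Fin n) d) (scalarMatrix_nonneg hd) = n • cls₁ d hd := by
  induction n with
  | zero =>
    rw [zero_nsmul, cls_eq_zero_iff]
    ext i; exact i.elim0
  | succ n ih =>
    rw [succ_nsmul, ← ih, cls₁, cls_add_cls]
    refine cls_eq_of_equiv (Equiv.refl _) fun i j => ?_
    simp only [Equiv.refl_apply]
    induction i using Fin.addCases with
    | left i =>
      induction j using Fin.addCases with
      | left j => simp [scalarMatrix_apply]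
      | right j =>
        rw [dsum_left_right, scalarMatrix_apply, if_neg]
        intro h
        have := congrArg Fin.val h
        simp at this
        omega
    | right i =>
      induction j using Fin.addCases with
      | left j =>
        rw [dsum_right_left, scalarMatrix_apply, if_neg]
        intro h
        have := congrArg Fin.val h
        simp at this
        omega
      | right j =>
        rw [dsum_right_right, scalarMatrix_apply, if_pos (by congr 1; exact Subsingleton.elim _ _)]
        rfl

theorem cls_single_le {n : ℕ} (i : Fin n) {d : A} (hd : 0 ≤ d)
    (hs : 0 ≤ single i i d) : cls (single i i d) hs ≤ cls₁ d hd := by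
  rw [cls₁, cls_le_cls]
  have : single i i d = single i (0 : Fin 1) (1 : A) * oneByOne d *
      (single i (0 : Fin 1) (1 : A)).conjTranspose := by
    ext p q
    simp [CStarMatrix.mul_apply, single_apply, CStarMatrix.conjTranspose_apply, apply_ite star,
      oneByOne]
    split_ifs <;> simp_all
  rw [this]
  exact CuntzSub.conj _ _

theorem single_nonneg {n : ℕ} (i : Fin n) {d : A} (hd : 0 ≤ d) : 0 ≤ single i i d := by
  obtain ⟨x, rfl⟩ := nonneg_iff_exists.1 hd
  have : single i i (star x * x) = star (single i i x) * single i i x := by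
    ext p q
    by_cases hp : p = i <;> by_cases hq : q = i <;>
      simp [CStarMatrix.mul_apply, single_apply, CStarMatrix.star_apply, apply_ite star, hp, hq]
  rw [this]
  exact star_mul_self_nonneg _

theorem oneByOne_entry {n : Type*} [Fintype n] [DecidableEq n] (M : CStarMatrix n n A) (j : n) :
    oneByOne (M j j) = single (0 : Fin 1) j (1 : A) * M *
      (single (0 : Fin 1) j (1 : A)).conjTranspose := by
  ext p q
  obtain rfl : p = 0 := Subsingleton.elim _ _
  obtain rfl : q = 0 := Subsingleton.elim _ _
  simp [CStarMatrix.mul_apply, single_apply, CStarMatrix.conjTranspose_apply, oneByOne,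
    apply_ite star]

/-- A diagonal entry of c*c is a compression of it, and is a sum of terms c_{kj}* c_{kj}. It is
nonzero for any nonzero column j. -/
theorem exists_cls₁_le {x : W A} (hx : x ≠ 0) : ∃ (d : A) (hd : 0 ≤ d), d ≠ 0 ∧ cls₁ d hd ≤ x := by
  induction x using W.induction with | _ n b hb
  obtain ⟨c, rfl⟩ := nonneg_iff_exists.1 hb
  have hc : c ≠ 0 := by
    rintro rfl
    exact hx (cls_eq_zero_iff.2 (by simp))
  obtain ⟨i, j, hij⟩ := exists_entry_ne_zero hc
  have h1 : (star c * c) j j = ∑ k, star (c k j) * c k j := by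
    simp [CStarMatrix.mul_apply, CStarMatrix.star_apply]
  have h0 : 0 ≤ (star c * c) j j := by
    rw [h1]
    exact Finset.sum_nonneg fun k _ => star_mul_self_nonneg _
  refine ⟨(star c * c) j j, h0, fun h => ?_, ?_⟩
  · rw [h1, Finset.sum_eq_zero_iff_of_nonneg fun k _ => star_mul_self_nonneg _] at h
    exact hij ((CStarRing.star_mul_self_eq_zero_iff _).1 (h i (Finset.mem_univ i)))
  · rw [cls₁, cls_le_cls]
    rw [oneByOne_entry]
    exact CuntzSub.conj _ _

end WLemmas

/-! ### Divisibility in W(A), and reduction to purely positive classes. -/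

section SimpleCuntz

variable {A : Type*} [CStarAlgebra A] [PartialOrder A] [StarOrderedRing A]

theorem le_norm_smul_one {E : Type*} [CStarAlgebra E] [PartialOrder E] [StarOrderedRing E] {b : E}
    (hb : 0 ≤ b) : b ≤ ‖b‖ • (1 : E) := by
  rw [← Algebra.algebraMap_eq_smul_one]
  exact hb.isSelfAdjoint.le_algebraMap_norm_self

theorem one_nonneg' : (0 : A) ≤ 1 := by
  simp

/-- In a simple unital C*-algebra, every nonzero class is full. -/
theorem exists_le_nsmul (hA : IsSimpleCStar A) {x : W A} (hx : x ≠ 0) (y : W A) :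
    ∃ m : ℕ, y ≤ m • x := by
  obtain ⟨d, hd, hd0, hdx⟩ := exists_cls₁_le hx
  obtain ⟨s, hs0, rfl⟩ := exists_sqrt hd
  have hs := hs0.isSelfAdjoint
  -- The elements a whose a*a is dominated by a multiple of x form an algebraic ideal, so simplicity
  -- puts the unit in it.
  let J : Set A := {a | ∃ m : ℕ, cls₁ (star a * a) (star_mul_self_nonneg a) ≤ m • x}
  have h1 : (1 : A) ∈ J := by
    refine hA.one_mem J ?_ ?_ ?_ (b := s) ?_ ?_
    · rintro a ⟨m, hm⟩ a' ⟨m', hm'⟩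
      refine ⟨m + m', ?_⟩
      have hle : star (a + a') * (a + a') ≤ (2 : ℝ) • (star a * a + star a' * a') := by
        rw [← sub_nonneg]
        have : (2 : ℝ) • (star a * a + star a' * a') - star (a + a') * (a + a')
            = star (a - a') * (a - a') := by
          rw [star_add, star_sub, two_smul]; noncomm_ring
        rw [this]
        exact star_mul_self_nonneg _
      have h2 : cls₁ (star (a + a') * (a + a')) (star_mul_self_nonneg _) ≤ cls₁ _
          (add_nonneg (star_mul_self_nonneg a) (star_mul_self_nonneg a')) :=
        cls₁_le_of_csub (csub_of_le_smul (by norm_num) (star_mul_self_nonneg _) hle)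
      rw [add_nsmul]
      exact h2.trans ((cls₁_add_le _ _).trans (add_le_add hm hm'))
    · rintro y a ⟨m, hm⟩
      refine ⟨m, le_trans (cls₁_le_of_csub (csub_of_le_smul (norm_nonneg (star y * y))
        (star_mul_self_nonneg _) ?_)) hm⟩
      have := conj_le_norm_smul (IsSelfAdjoint.star_mul_self y) a
      rwa [star_mul, mul_assoc, ← mul_assoc (star y), ← mul_assoc (star a)]
    · rintro a ⟨m, hm⟩ y
      refine ⟨m, le_trans (cls₁_le_of_csub ?_) hm⟩
      have := CSub.conj (star y) (star a * a)
      rw [star_star] at this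
      rw [star_mul]
      simpa only [mul_assoc] using this
    · refine ⟨1, ?_⟩
      rw [one_nsmul]
      refine le_trans (cls₁_le_of_csub (hb := hd) ?_) hdx
      rw [hs.star_eq]
      exact CSub.refl _
    · rintro rfl
      simp at hd0
  obtain ⟨m, hm⟩ := h1
  induction y using W.induction with | _ n b hb
  refine ⟨n * m, ?_⟩
  have h2 : cls b hb ≤ cls (scalarMatrix (Fin n) (1 : A)) (scalarMatrix_nonneg one_nonneg') := by
    refine cls_le_of_csub (csub_of_le_smul (norm_nonneg b) hb ?_)
    exact le_norm_smul_one hb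
  rw [cls_scalarMatrix n one_nonneg'] at h2
  refine h2.trans ?_
  rw [mul_comm, mul_nsmul]
  refine nsmul_le_nsmul_right (le_trans (le_of_eq ?_) hm) n
  exact cls₁_congr (by simp)

/-- Primeness gives u = d m e ≠ 0. Then uu* lies in d A d, and uu* ≾ u*u with u*u in e A e. -/
theorem exists_le_le (hP : IsPrimeRing A) {x y : W A} (hx : x ≠ 0) (hy : y ≠ 0) :
    ∃ z : W A, z ≠ 0 ∧ z ≤ x ∧ z ≤ y := by
  obtain ⟨d, hd, hd0, hdx⟩ := exists_cls₁_le hx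
  obtain ⟨e, he, he0, hey⟩ := exists_cls₁_le hy
  obtain ⟨m, hm⟩ := hP d e hd0 he0
  set u := d * m * e with hu
  refine ⟨cls₁ (u * star u) (mul_star_self_nonneg u), cls₁_ne_zero ?_,
    le_trans (cls₁_le_of_csub ?_) hdx, le_trans (cls₁_le_of_csub ?_) hey⟩
  · rwa [Ne, CStarRing.mul_star_self_eq_zero_iff]
  · refine CSub.trans (b := d * d) ?_ (csub_self_mul_self hd)
    refine csub_of_mem_her hd.isSelfAdjoint (mul_star_self_nonneg u) ?_
    have : u * star u = d * (m * e * star e * star m) * d := by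
      rw [hu, star_mul, star_mul, hd.isSelfAdjoint.star_eq]; simp only [mul_assoc]
    rw [this]
    exact Her.mem _ _
  · refine (csub_mul_star_self u).trans (CSub.trans (b := e * e) ?_ (csub_self_mul_self he))
    refine csub_of_mem_her he.isSelfAdjoint (star_mul_self_nonneg u) ?_
    have : star u * u = e * (star m * star d * d * m) * e := by
      rw [hu, star_mul, star_mul, he.isSelfAdjoint.star_eq]; simp only [mul_assoc]
    rw [this]
    exact Her.mem _ _

/-- Take two orthogonal nonzero elements below x and a common nonzero class below both. -/
theorem exists_add_self_le (hN : NoMinimal A) (hP : IsPrimeRing A) {x : W A} (hx : x ≠ 0) :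
    ∃ z : W A, z ≠ 0 ∧ z + z ≤ x := by
  obtain ⟨d, hd, hd0, hdx⟩ := exists_cls₁_le hx
  obtain ⟨m, n, h1, h2, h3, h4, h5⟩ := exists_orthogonal hN hd hd0
  obtain ⟨z, hz, hz1, hz2⟩ := exists_le_le hP (cls₁_ne_zero (ha := h1) h3)
    (cls₁_ne_zero (ha := h2) h4)
  refine ⟨z, hz, (add_le_add hz1 hz2).trans ((add_cls₁_le_of_mul_eq_zero h1 h2 h5).trans
    (le_trans (cls₁_le_of_csub ?_) hdx))⟩
  exact (csub_of_mem_her hd.isSelfAdjoint (add_nonneg h1 h2)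
    (Her.add (Her.mem _ _) (Her.mem _ _))).trans (csub_self_mul_self hd)

theorem exists_nsmul_le (hN : NoMinimal A) (hP : IsPrimeRing A) (N : ℕ) {x : W A} (hx : x ≠ 0) :
    ∃ z : W A, z ≠ 0 ∧ N • z ≤ x := by
  -- Halving N times gives 2^N copies, more than the N required.
  suffices h : ∀ k : ℕ, ∀ x : W A, x ≠ 0 → ∃ z : W A, z ≠ 0 ∧ 2 ^ k • z ≤ x by
    obtain ⟨z, hz, hzx⟩ := h N x hx
    exact ⟨z, hz, (nsmul_le_nsmul_left (W.zero_le z) Nat.lt_two_pow_self.le).trans hzx⟩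
  intro k
  induction k with
  | zero => exact fun x hx => ⟨x, hx, by simp⟩
  | succ k ih =>
    intro x hx
    obtain ⟨y, hy, hyx⟩ := exists_add_self_le hN hP hx
    obtain ⟨z, hz, hzy⟩ := ih y hy
    refine ⟨z, hz, ?_⟩
    rw [pow_succ, mul_two, add_nsmul]
    exact (add_le_add hzy hzy).trans hyx

/-- A sufficient condition for a class to be purely positive: one of its summands is the class of
an element which has `0` as a limit point of its spectrum. -/
def PurelyPos (x : W A) : Prop :=
  ∃ (x₁ : W A) (n : ℕ) (w : CStarMatrix (Fin n) (Fin n) A) (hw : 0 ≤ w), ZeroLimit w ∧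
    x = x₁ + cls w hw

theorem PurelyPos.add {x : W A} (hx : PurelyPos x) (y : W A) : PurelyPos (y + x) := by
  obtain ⟨x₁, n, w, hw, h, rfl⟩ := hx
  exact ⟨y + x₁, n, w, hw, h, (add_assoc _ _ _).symm⟩

theorem W.le_add_left (x y : W A) : x ≤ y + x := le_add_of_nonneg_left (W.zero_le y)

theorem W.le_add_right (x y : W A) : x ≤ x + y := le_add_of_nonneg_right (W.zero_le y)

theorem W.eq_zero_of_le {x : W A} (h : x ≤ 0) : x = 0 := le_antisymm h (W.zero_le x)

theorem PurelyPos.ne_zero {x : W A} (hx : PurelyPos x) : x ≠ 0 := by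
  obtain ⟨x₁, n, w, hw, h, rfl⟩ := hx
  intro h0
  have := W.eq_zero_of_le ((W.le_add_left (cls w hw) x₁).trans h0.le)
  exact h.ne_zero (cls_eq_zero_iff.1 this)

/-- Every nonzero class `y` is at most the sum of a purely positive class `y'` and an arbitrarily
small class, with `y' + r ≤ y` for some nonzero `r`. -/
theorem exists_purelyPos_le (hN : NoMinimal A) (hP : IsPrimeRing A) {y t : W A} (hy : y ≠ 0)
    (ht : t ≠ 0) :
    ∃ y' z r : W A, y ≤ y' + z ∧ z ≤ t ∧ y' + r ≤ y ∧ r ≠ 0 ∧ PurelyPos y' := by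
  obtain ⟨e, he, he0, het⟩ := exists_cls₁_le ht
  induction y using W.induction with | _ n b hb
  have hb0 : b ≠ 0 := fun h => hy (cls_eq_zero_iff.2 h)
  -- Only an index is needed, to place e on the diagonal of a matrix of the size of b.
  obtain ⟨i, -, -⟩ := exists_entry_ne_zero hb0
  have hs := single_nonneg i he
  have hs0 : single i i e ≠ 0 := fun h => he0 <| by
    have := congrArg (fun M => M i i) h
    simpa [single_apply, CStarMatrix.zero_apply] using this
  obtain ⟨b₁, z, w, x, hb₁, hz, hw, hx, h1, h2, h3, h4, h5, h6, h7⟩ :=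
    exists_small_splitting (noMinimal_matrix hN) (isPrimeRing_matrix hP) hb hb0 hs hs0
  refine ⟨cls b₁ hb₁ + cls w hw, cls z hz, cls x hx, ?_, ?_, ?_, ?_, ⟨_, n, w, hw, h4, rfl⟩⟩
  · refine (cls_le_of_csub (hb := add_nonneg hb₁ hz) h1).trans ((cls_add_le hb₁ hz).trans ?_)
    exact add_le_add (W.le_add_right _ _) le_rfl
  · exact (cls_le_of_csub (hb := hs) h2).trans ((cls_single_le i he hs).trans het)
  · refine le_trans (add_le_add (add_cls_le_of_mul_eq_zero hb₁ hw h6) le_rfl) ?_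
    exact (add_cls_le_of_mul_eq_zero (add_nonneg hb₁ hw) hx h7).trans (cls_le_of_csub h3)
  · exact fun h => h5 (cls_eq_zero_iff.1 h)

/-- Iterating `x + z ≤ y + z` in ordered monoids. -/
theorem nsmul_add_le_of_add_le {S : Type*} [AddCommMonoid S] [PartialOrder S] [IsOrderedAddMonoid S]
    {x y z : S} (h : x + z ≤ y + z) (k : ℕ) : k • x + z ≤ k • y + z := by
  induction k with
  | zero => simp
  | succ k ih =>
    calc (k + 1) • x + z = k • x + (x + z) := by rw [succ_nsmul, add_assoc]
      _ ≤ k • x + (y + z) := by gcongr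
      _ = (k • x + z) + y := by abel
      _ ≤ (k • y + z) + y := by gcongr
      _ = (k + 1) • y + z := by rw [succ_nsmul]; abel

/-- Almost unperforation of `W(A)` follows from an approximate version for purely positive
classes. -/
theorem almostUnperforated_of_purelyPos (hA : IsSimpleCStar A) (hI : ¬ IsTypeI A)
    (H : ∀ x y : W A, PurelyPos x → PurelyPos y → ∀ n : ℕ, 0 < n → (n + 1) • x ≤ n • y →
      ∀ r : W A, r ≠ 0 → x ≤ y + r) :
    AlmostUnperforated (Set.univ : Set (W A)) := by
  have hN := noMinimal_of_not_isTypeI hA hI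
  have hP := hA.isPrimeRing
  rintro x - y - n hn hxy
  by_cases hx : x = 0
  · rw [hx]; exact W.zero_le y
  have hy : y ≠ 0 := by
    rintro rfl
    rw [nsmul_zero] at hxy
    refine hx (W.eq_zero_of_le (le_trans ?_ hxy))
    rw [succ_nsmul]
    exact W.le_add_left _ _
  -- After doubling the inequality, the 2n copies of the error z ≤ t cost a single x, which the
  -- surplus of two copies of x can spare.
  obtain ⟨t, ht0, ht⟩ := exists_nsmul_le hN hP (2 * n) hx
  obtain ⟨y', z, r, h1, h2, h3, hr, hy'⟩ := exists_purelyPos_le hN hP hy ht0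
  obtain ⟨m, hm⟩ := exists_le_nsmul hA hy'.ne_zero x
  have e1 : (2 * n + 1) • x + x ≤ (2 * n) • y' + x :=
    calc (2 * n + 1) • x + x = 2 • ((n + 1) • x) := by
          rw [← succ_nsmul, ← mul_nsmul']; congr 1
      _ ≤ 2 • (n • y) := nsmul_le_nsmul_right hxy 2
      _ = (2 * n) • y := by rw [← mul_nsmul']
      _ ≤ (2 * n) • (y' + z) := nsmul_le_nsmul_right h1 _
      _ = (2 * n) • y' + (2 * n) • z := nsmul_add _ _ _
      _ ≤ (2 * n) • y' + x := by
          gcongr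
          exact (nsmul_le_nsmul_right h2 _).trans ht
  -- Iterating m + 1 times leaves only one summand x on the right, absorbed by m y'. The new
  -- multiple satisfies M + 1 = (m + 1)(2n + 1).
  have e2 := nsmul_add_le_of_add_le e1 (m + 1)
  set M := (m + 1) * (2 * n) + m with hM
  have hM0 : 0 < M := by positivity
  have e3 : (M + 1) • x ≤ M • y' :=
    calc (M + 1) • x = (m + 1) • ((2 * n + 1) • x) := by
          rw [← mul_nsmul']; congr 1
      _ ≤ (m + 1) • ((2 * n + 1) • x) + x := W.le_add_right _ _
      _ ≤ (m + 1) • ((2 * n) • y') + x := e2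
      _ ≤ (m + 1) • ((2 * n) • y') + m • y' := by gcongr
      _ = M • y' := by rw [← mul_nsmul', ← add_nsmul]
  -- Now x is made purely positive by adding a small purely positive w. Its 2M + 1 copies cost one
  -- x, again paid for by doubling.
  obtain ⟨s, hs0, hs⟩ := exists_nsmul_le hN hP (2 * M + 1) hx
  obtain ⟨w, -, r', -, -, hws, -, hw⟩ := exists_purelyPos_le hN hP hs0 hs0
  have hws' : w ≤ s := (W.le_add_right _ _).trans hws
  have e4 : (2 * M + 1) • (x + w) ≤ (2 * M) • y' :=
    calc (2 * M + 1) • (x + w) = (2 * M + 1) • x + (2 * M + 1) • w := nsmul_add _ _ _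
      _ ≤ (2 * M + 1) • x + x := by
          gcongr
          exact (nsmul_le_nsmul_right hws' _).trans hs
      _ = 2 • ((M + 1) • x) := by rw [← succ_nsmul, ← mul_nsmul']; congr 1
      _ ≤ 2 • (M • y') := nsmul_le_nsmul_right e3 2
      _ = (2 * M) • y' := by rw [← mul_nsmul']
  -- The room r left between y' and y absorbs the error in the approximate comparison.
  exact (W.le_add_right x w).trans ((H _ _ (hw.add x) hy' (2 * M) (by omega) e4 r hr).trans h3)

end SimpleCuntz

/-! ### Functoriality of W. -/

section Functoriality

variable {D E : Type*} [NonUnitalCStarAlgebra D] [NonUnitalCStarAlgebra E]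
variable {m n k : Type*}

theorem continuous_starHom (f : D →⋆ₙₐ[ℂ] E) : Continuous f := map_continuous f

theorem map_rect_mul [Fintype n] (f : D →⋆ₙₐ[ℂ] E) (x : CStarMatrix m n D)
    (y : CStarMatrix n k D) : (x * y).map f = x.map f * y.map f := by
  ext i j
  simp [CStarMatrix.mul_apply, map_sum]

theorem map_conjTranspose (f : D →⋆ₙₐ[ℂ] E) (x : CStarMatrix m n D) :
    x.conjTranspose.map f = (x.map f).conjTranspose := by
  ext i j
  exact map_star f _

theorem tendsto_map {X : Type*} {l : Filter X} (f : D →⋆ₙₐ[ℂ] E) {F : X → CStarMatrix m n D}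
    {M : CStarMatrix m n D} (h : Tendsto F l (𝓝 M)) : Tendsto (fun x => (F x).map f) l (𝓝 (M.map f)) :=
  tendsto_entrywise fun i j =>
    ((continuous_starHom f).tendsto _).comp (tendsto_entry h i j)

theorem CuntzSub.map [Fintype m] [Fintype n] (f : D →⋆ₙₐ[ℂ] E) {a : CStarMatrix m m D}
    {b : CStarMatrix n n D} (h : CuntzSub a b) : CuntzSub (a.map f) (b.map f) := by
  obtain ⟨y, hy⟩ := h
  refine ⟨fun k => (y k).map f, ?_⟩
  simpa only [map_rect_mul, map_conjTranspose] using tendsto_map f hy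

variable [PartialOrder D] [StarOrderedRing D] [PartialOrder E] [StarOrderedRing E]

theorem map_nonneg' {n : Type*} [Fintype n] (f : D →⋆ₙₐ[ℂ] E) {a : CStarMatrix n n D} (ha : 0 ≤ a) :
    0 ≤ a.map f := by
  obtain ⟨x, rfl⟩ := nonneg_iff_exists.1 ha
  have : (star x * x).map f = star (x.map f) * x.map f :=
    (map_rect_mul f _ _).trans (congrArg (· * _) (map_conjTranspose f x))
  rw [this]
  exact star_mul_self_nonneg _

theorem map_dsum {m m' n n' : ℕ} (f : D →⋆ₙₐ[ℂ] E) (a : CStarMatrix (Fin m) (Fin m') D)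
    (b : CStarMatrix (Fin n) (Fin n') D) : (dsum a b).map f = dsum (a.map f) (b.map f) := by
  ext i j
  induction i using Fin.addCases <;> induction j using Fin.addCases <;> simp

/-- The map `W(D) → W(E)` induced by a homomorphism `D → E`. -/
def W.map (f : D →⋆ₙₐ[ℂ] E) : W D →+ W E where
  toFun := Quotient.map (fun a : PosMat D => (⟨a.1, a.2.1.map f, map_nonneg' f a.2.2⟩ : PosMat E))
    (fun _ _ h => ⟨CuntzSub.map f h.1, CuntzSub.map f h.2⟩)
  map_zero' := le_antisymm
    (cls_le_cls.2 ⟨fun _ => 0, tendsto_entrywise fun i => i.elim0⟩) (W.zero_le _)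
  map_add' x y := by
    induction x using W.induction with | _ m a ha
    induction y using W.induction with | _ n b hb
    rw [cls_add_cls]
    change cls ((dsum a b).map f) _ = cls (a.map f) (map_nonneg' f ha) +
      cls (b.map f) (map_nonneg' f hb)
    rw [cls_add_cls]
    congr 1
    exact map_dsum f a b

theorem W.map_cls (f : D →⋆ₙₐ[ℂ] E) {n : ℕ} {a : CStarMatrix (Fin n) (Fin n) D} (ha : 0 ≤ a) :
    W.map f (cls a ha) = cls (a.map f) (map_nonneg' f ha) := rfl

theorem W.map_mono (f : D →⋆ₙₐ[ℂ] E) {x y : W D} (h : x ≤ y) : W.map f x ≤ W.map f y := by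
  induction x using W.induction with | _ m a ha
  induction y using W.induction with | _ n b hb
  exact cls_le_cls.2 (CuntzSub.map f (cls_le_cls.1 h))

end Functoriality

/-! ### Coefficients, inclusion and finiteness of the crossed product. -/

namespace CrossedProduct

variable {G A : Type*} [Group G] [Fintype G] [CStarAlgebra A] [PartialOrder A] [StarOrderedRing A]
variable (α : G →* (A ≃⋆ₐ[ℂ] A))

theorem mul_coeff (a b : CrossedProduct α) (g : G) : (a * b) g = ∑ h, a h * α h (b (h⁻¹ * g)) := rfl

theorem star_coeff (a : CrossedProduct α) (g : G) : (star a) g = α g (star (a g⁻¹)) := rfl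

theorem coeff_eq_reg (a : CrossedProduct α) (g : G) : a g = reg a 1 g⁻¹ := by
  rw [reg_apply, inv_one, action_one, one_mul, inv_inv]

theorem continuous_coeff (g : G) : Continuous fun a : CrossedProduct α => a g := by
  simp only [coeff_eq_reg]
  have : Continuous fun M : CStarMatrix G G A => M 1 g⁻¹ :=
    (continuous_apply_apply (1 : G) g⁻¹ : Continuous fun x : G → G → A => x 1 g⁻¹)
  exact this.comp isometry_reg.continuous

/-- The coefficient of `u_g` as an additive map. -/
def coeff (g : G) : CrossedProduct α →+ A where
  toFun a := a g
  map_zero' := rfl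
  map_add' _ _ := rfl

theorem sum_coeff {ι : Type*} (s : Finset ι) (x : ι → CrossedProduct α) (g : G) :
    (∑ i ∈ s, x i : CrossedProduct α) g = ∑ i ∈ s, x i g := map_sum (coeff α g) x s

open Classical in
/-- The element `a u_1` of the crossed product. -/
noncomputable def inclFun (a : A) : CrossedProduct α := fun g => if g = 1 then a else 0

open Classical in
theorem inclFun_apply (a : A) (g : G) : inclFun α a g = if g = 1 then a else 0 := rfl

/-- The inclusion `A → C*(G, A, α)`. -/
noncomputable def incl : A →⋆ₙₐ[ℂ] CrossedProduct α where
  toFun := inclFun α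
  map_smul' c a := by
    funext g
    change inclFun α (c • a) g = c • (inclFun α a g)
    simp only [inclFun_apply]
    split_ifs <;> simp
  map_zero' := by
    funext g
    change inclFun α 0 g = (0 : A)
    simp [inclFun_apply]
  map_add' a b := by
    funext g
    change inclFun α (a + b) g = inclFun α a g + inclFun α b g
    simp only [inclFun_apply]
    split_ifs <;> simp
  map_mul' a b := by
    funext g
    rw [mul_coeff, Finset.sum_eq_single 1]
    · simp only [inclFun_apply, if_true, action_one, inv_one, one_mul]
      split_ifs <;> simp
    · intro h _ hh
      simp [inclFun_apply, hh]
    · simp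
  map_star' a := by
    funext g
    rw [star_coeff]
    by_cases hg : g = 1
    · simp [inclFun_apply, hg]
    · simp [inclFun_apply, hg]

open Classical in
theorem incl_apply (a : A) (g : G) : incl α a g = if g = 1 then a else 0 := rfl

theorem mul_incl_coeff (w : CrossedProduct α) (b : A) (g : G) :
    (w * incl α b) g = w g * α g b := by
  rw [mul_coeff, Finset.sum_eq_single g]
  · simp [incl_apply]
  · intro h _ hh
    rw [incl_apply, if_neg, map_zero, mul_zero]
    intro h1
    exact hh (inv_mul_eq_one.1 h1)
  · simp

theorem mul_star_coeff (x w : CrossedProduct α) (k : G) :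
    (x * star w) k = ∑ g, x g * α k (star (w (k⁻¹ * g))) := by
  rw [mul_coeff]
  refine Finset.sum_congr rfl fun g _ => ?_
  rw [star_coeff, ← action_mul]
  simp

theorem incl_injective : Function.Injective (incl α) := fun a b h => by
  have := congrFun h 1
  simpa [incl_apply] using this

theorem incl_one : incl α (1 : A) = 1 := rfl

/-- If `A` is stably finite then so is the crossed product by a finite group. -/
theorem isFinite_matrix (hA : IsStablyFinite A) (n : ℕ) :
    IsFinite' (CStarMatrix (Fin n) (Fin n) (CrossedProduct α)) := by
  classical
  intro v hv
  let e : Fin n × G ≃ Fin (Fintype.card (Fin n × G)) := Fintype.equivFin _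
  -- Applying the regular representation entrywise gives an injective unital *-map into matrices of
  -- size n |G| over A, where isometries are unitary.
  let T : CStarMatrix (Fin n) (Fin n) (CrossedProduct α) →
      CStarMatrix (Fin (Fintype.card (Fin n × G))) (Fin (Fintype.card (Fin n × G))) A :=
    fun M => CStarMatrix.ofMatrix (Matrix.of fun p q =>
      reg (M (e.symm p).1 (e.symm q).1) (e.symm p).2 (e.symm q).2)
  have hT : ∀ M p q, T M p q = reg (M (e.symm p).1 (e.symm q).1) (e.symm p).2 (e.symm q).2 :=
    fun M p q => rfl
  have hsum : ∀ (s : Finset (Fin n)) (x : Fin n → CrossedProduct α) (g h : G),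
      reg (∑ i ∈ s, x i) g h = ∑ i ∈ s, reg (x i) g h := by
    intro s x g h
    have : reg (∑ i ∈ s, x i) = ∑ i ∈ s, reg (x i) := map_sum (regHom (α := α)) x s
    rw [this]
    induction s using Finset.cons_induction with
    | empty => rfl
    | cons a s ha ih =>
      have h2 : reg (∑ i ∈ s, x i) = ∑ i ∈ s, reg (x i) := map_sum (regHom (α := α)) x s
      rw [Finset.sum_cons, Finset.sum_cons, CStarMatrix.add_apply, ih h2]
  have hmul : ∀ M N, T (M * N) = T M * T N := by
    intro M N
    ext p q
    rw [CStarMatrix.mul_apply, hT, CStarMatrix.mul_apply, hsum, ← e.sum_comp,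
      Fintype.sum_prod_type]
    simp only [reg_mul, CStarMatrix.mul_apply, hT, Equiv.symm_apply_apply]
  have hstar : ∀ M, T (star M) = star (T M) := by
    intro M
    ext p q
    rw [CStarMatrix.star_apply, hT, hT, CStarMatrix.star_apply, reg_star, CStarMatrix.star_apply]
  have hone : T 1 = 1 := by
    ext p q
    rw [hT, CStarMatrix.one_apply, CStarMatrix.one_apply]
    by_cases h : (e.symm p).1 = (e.symm q).1
    · rw [if_pos h, reg_one, CStarMatrix.one_apply]
      by_cases h2 : (e.symm p).2 = (e.symm q).2
      · rw [if_pos h2, if_pos (e.symm.injective (Prod.ext h h2))]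
      · rw [if_neg h2, if_neg fun hpq => h2 (by rw [hpq])]
    · rw [if_neg h, if_neg fun hpq => h (by rw [hpq]), reg_zero]
      rfl
  have hinj : Function.Injective T := by
    intro M N h
    ext i j
    refine reg_injective (CStarMatrix.ext fun g g' => ?_)
    have := congrArg (fun X => X (e (i, g)) (e (j, g'))) h
    simpa [hT] using this
  refine hinj ?_
  rw [hmul, hstar, hone]
  exact hA _ (T v) (by rw [← hstar, ← hmul, hv, hone])

end CrossedProduct

/-! ### Exact algebra of the covariant relations. -/

section CovariantRelations

/-- This models (w u_g) b (u_h* W) = w B U u_{gh⁻¹} with B = α_g(b) and U = α_{gh⁻¹}(W). Because s_g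
s_h = c s_{gh} rather than s_{gh}, factors of c must be moved around; c commutes with all the other
elements, apart from b, and a total of c³ is left over. -/
theorem covariant_term {Q G : Type*} [Ring Q] [Group G] {c : Q} {s : G → Q}
    (h1 : s 1 = c) (hmul : ∀ g h, s g * s h = c * s (g * h)) (cs : ∀ g, Commute c (s g))
    {w b B W U : Q} {g h : G} (cw : Commute c w) (cB : Commute c B) (cW : Commute c W)
    (cU : Commute c U) (hB : s g * b * s g⁻¹ = c * B * c)
    (hU : s (g * h⁻¹) * W * s (g * h⁻¹)⁻¹ = c * U * c) :
    c * (w * s g) * b * (s h⁻¹ * W * c) = c * c * c * (w * B * U * s (g * h⁻¹)) := by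
  set k := g * h⁻¹ with hk
  -- A spare c splits s_{h⁻¹}, so that s_g b s_{g⁻¹} appears and s_k is left to act on W.
  have e1 : c * s h⁻¹ = s g⁻¹ * s k := by rw [hmul, hk, inv_mul_cancel_left]
  have e2 : s k⁻¹ * s k = c * c := by rw [hmul, inv_mul_cancel, h1]
  have e3 : c * c * (s k * W) = c * U * c * s k :=
    calc c * c * (s k * W) = s k * W * (c * c) :=
          (((cs k).mul_right cW).mul_left ((cs k).mul_right cW)).eq
      _ = (s k * W * s k⁻¹) * s k := by rw [← e2]; simp only [mul_assoc]
      _ = _ := by rw [hU]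
  calc c * (w * s g) * b * (s h⁻¹ * W * c) = c * (w * s g) * b * (c * (s h⁻¹ * W)) := by
        rw [(((cs h⁻¹).mul_right cW).eq).symm]
    _ = c * w * (s g * b * s g⁻¹) * (s k * W) := by
        rw [← mul_assoc c (s h⁻¹), e1]; simp only [mul_assoc]
    _ = c * w * (c * B * c) * (s k * W) := by rw [hB]
    _ = w * B * c * (c * c * (s k * W)) := by
        have h2 : c * w * (c * B * c) = w * B * c * (c * c) := by
          rw [cB.eq, cw.eq]
          have h3 : w * c * (B * c * c) = w * (c * B) * c * c := by simp only [mul_assoc]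
          rw [h3, cB.eq]; simp only [mul_assoc]
        rw [h2, mul_assoc]
    _ = w * B * (c * (c * U) * c) * s k := by rw [e3]; simp only [mul_assoc]
    _ = w * B * U * (c * c * c) * s k := by
        have h2 : c * (c * U) * c = U * (c * c * c) := by
          rw [cU.eq, ← mul_assoc, cU.eq]; simp only [mul_assoc]
        rw [h2]; simp only [mul_assoc]
    _ = c * c * c * (w * B * U) * s k := by
        have h3 : Commute c (w * B * U) := (cw.mul_right cB).mul_right cU
        rw [((h3.mul_left h3).mul_left h3).eq]
    _ = _ := by simp only [mul_assoc]

/-- Collecting the terms with k = gh⁻¹ makes the inner sum the coefficient of u_k in w b w*, as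
computed in `coeffMat_conj`. -/
theorem covariant_sum {Q G : Type*} [Ring Q] [Group G] [Fintype G] {c : Q} {s : G → Q}
    (h1 : s 1 = c) (hmul : ∀ g h, s g * s h = c * s (g * h)) (cs : ∀ g, Commute c (s g))
    {w B W : G → Q} {U : G → G → Q} {b : Q} (cw : ∀ g, Commute c (w g)) (cB : ∀ g, Commute c (B g))
    (cW : ∀ g, Commute c (W g)) (cU : ∀ k h, Commute c (U k h))
    (hB : ∀ g, s g * b * s g⁻¹ = c * B g * c) (hU : ∀ k h, s k * W h * s k⁻¹ = c * U k h * c) :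
    c * (∑ g, w g * s g) * b * ((∑ h, s h⁻¹ * W h) * c)
      = c * c * c * ∑ k, (∑ g, w g * B g * U k (k⁻¹ * g)) * s k := by
  calc c * (∑ g, w g * s g) * b * ((∑ h, s h⁻¹ * W h) * c)
      = ∑ g, ∑ h, c * (w g * s g) * b * (s h⁻¹ * W h * c) := by
        rw [Finset.mul_sum, Finset.sum_mul, Finset.sum_mul, Finset.sum_mul]
        simp only [Finset.mul_sum]
    _ = ∑ g, ∑ h, c * c * c * (w g * B g * U (g * h⁻¹) h * s (g * h⁻¹)) := by
        refine Finset.sum_congr rfl fun g _ => Finset.sum_congr rfl fun h _ => ?_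
        exact covariant_term h1 hmul cs (cw g) (cB g) (cW h) (cU _ h) (hB g) (hU _ h)
    _ = ∑ g, ∑ k, c * c * c * (w g * B g * U k (k⁻¹ * g) * s k) := by
        refine Finset.sum_congr rfl fun g _ => ?_
        refine Fintype.sum_equiv ((Equiv.inv G).trans (Equiv.mulLeft g)) _ _ fun h => ?_
        simp
    _ = _ := by
        rw [Finset.sum_comm]
        simp only [Finset.mul_sum, Finset.sum_mul]

end CovariantRelations

/-! ### Bounded sequences modulo null sequences. -/

section SequenceAlgebra

/-- The ring of bounded sequences in `E`. -/
def boundedSeq (E : Type*) [NormedRing E] : Subring (ℕ → E) where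
  carrier := {x | ∃ C, ∀ n, ‖x n‖ ≤ C}
  mul_mem' := by
    rintro x y ⟨C, hC⟩ ⟨C', hC'⟩
    exact ⟨C * C', fun n => (norm_mul_le _ _).trans
      (mul_le_mul (hC n) (hC' n) (norm_nonneg _) ((norm_nonneg _).trans (hC n)))⟩
  one_mem' := ⟨‖(1 : E)‖, fun n => le_rfl⟩
  add_mem' := by
    rintro x y ⟨C, hC⟩ ⟨C', hC'⟩
    exact ⟨C + C', fun n => (norm_add_le _ _).trans (add_le_add (hC n) (hC' n))⟩
  zero_mem' := ⟨0, fun n => by simp⟩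
  neg_mem' := by
    rintro x ⟨C, hC⟩
    exact ⟨C, fun n => by simpa using hC n⟩

/-- Bounded sequences modulo sequences converging to zero. -/
def nullCon (E : Type*) [NormedRing E] : RingCon (boundedSeq E) where
  r x y := Tendsto (fun n => x.1 n - y.1 n) atTop (𝓝 0)
  iseqv :=
    { refl := fun x => by simp
      symm := fun {x y} h => by simpa using h.neg
      trans := fun {x y z} h h' => by simpa using h.add h' }
  add' := by
    intro x x' y y' h h'
    have := Tendsto.add h h'
    rw [add_zero] at this
    refine this.congr fun n => ?_
    change x.1 n - x'.1 n + (y.1 n - y'.1 n) = (x.1 n + y.1 n) - (x'.1 n + y'.1 n)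
    abel
  mul' := by
    intro x x' y y' h h'
    obtain ⟨C, hC⟩ := x.2
    obtain ⟨C', hC'⟩ := y'.2
    have h1 : Tendsto (fun n => x.1 n * (y.1 n - y'.1 n)) atTop (𝓝 0) := by
      rw [tendsto_zero_iff_norm_tendsto_zero] at h' ⊢
      refine squeeze_zero (fun _ => norm_nonneg _) (g := fun n => C * ‖y.1 n - y'.1 n‖)
        (fun n => (norm_mul_le _ _).trans (mul_le_mul_of_nonneg_right (hC n) (norm_nonneg _))) ?_
      simpa using h'.const_mul C
    have h2 : Tendsto (fun n => (x.1 n - x'.1 n) * y'.1 n) atTop (𝓝 0) := by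
      rw [tendsto_zero_iff_norm_tendsto_zero] at h ⊢
      refine squeeze_zero (fun _ => norm_nonneg _) (g := fun n => ‖x.1 n - x'.1 n‖ * C')
        (fun n => (norm_mul_le _ _).trans (mul_le_mul_of_nonneg_left (hC' n) (norm_nonneg _))) ?_
      simpa using h.mul_const C'
    have := h1.add h2
    rw [add_zero] at this
    refine this.congr fun n => ?_
    change x.1 n * (y.1 n - y'.1 n) + (x.1 n - x'.1 n) * y'.1 n = x.1 n * y.1 n - x'.1 n * y'.1 n
    noncomm_ring

theorem nullCon_mk_eq {E : Type*} [NormedRing E] {x y : boundedSeq E} :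
    (nullCon E).mk' x = (nullCon E).mk' y ↔ Tendsto (fun n => x.1 n - y.1 n) atTop (𝓝 0) :=
  RingCon.eq (nullCon E)

end SequenceAlgebra

/-! ### Coefficient matrices over the crossed product. -/

section Coefficients

variable {G A : Type*} [Group G] [Fintype G] [CStarAlgebra A] [PartialOrder A] [StarOrderedRing A]
variable (α : G →* (A ≃⋆ₐ[ℂ] A))

/-- The action on matrices. -/
noncomputable def matAction (n : Type*) [Fintype n] (g : G) : CStarMatrix n n A →⋆ₙₐ[ℂ] CStarMatrix n n A :=
  CStarMatrix.mapₙₐ ((α g : A ≃⋆ₐ[ℂ] A) : A →⋆ₙₐ[ℂ] A)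

theorem matAction_apply {n : Type*} [Fintype n] (g : G) (M : CStarMatrix n n A) (i j : n) :
    matAction α n g M i j = α g (M i j) := rfl

/-- The embedding `d ↦ d ⊗ 1ₙ`. -/
noncomputable def scalarHom (n : Type*) [Fintype n] [DecidableEq n] : A →⋆ₙₐ[ℂ] CStarMatrix n n A where
  toFun := scalarMatrix n
  map_smul' c a := by ext i j; simp [scalarMatrix_apply]
  map_zero' := by ext i j; simp [scalarMatrix_apply, CStarMatrix.zero_apply]
  map_add' a b := by
    ext i j
    simp only [scalarMatrix_apply, CStarMatrix.add_apply]
    split_ifs <;> simp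
  map_mul' := scalarMatrix_mul
  map_star' := scalarMatrix_star

theorem scalarHom_apply {n : Type*} [Fintype n] [DecidableEq n] (a : A) (i j : n) :
    scalarHom n a i j = if i = j then a else 0 := rfl

theorem scalarHom_mul_apply {n : Type*} [Fintype n] [DecidableEq n] (a : A) (M : CStarMatrix n n A)
    (i j : n) : (scalarHom n a * M) i j = a * M i j := by
  simp [CStarMatrix.mul_apply, scalarHom_apply]

theorem mul_scalarHom_apply {n : Type*} [Fintype n] [DecidableEq n] (a : A) (M : CStarMatrix n n A)
    (i j : n) : (M * scalarHom n a) i j = M i j * a := by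
  simp [CStarMatrix.mul_apply, scalarHom_apply]

/-- The entry as an additive map. -/
def entryHom {m n D : Type*} [AddCommMonoid D] (i : m) (j : n) : CStarMatrix m n D →+ D where
  toFun M := M i j
  map_zero' := rfl
  map_add' _ _ := rfl

theorem sum_entry {m n D ι : Type*} [AddCommMonoid D] (s : Finset ι) (f : ι → CStarMatrix m n D)
    (i : m) (j : n) : (∑ x ∈ s, f x) i j = ∑ x ∈ s, f x i j :=
  map_sum (entryHom i j : CStarMatrix m n D →+ D) f s

/-- The matrix of coefficients of `u_g`. -/
def coeffMat {n : Type*} (g : G) (M : CStarMatrix n n (CrossedProduct α)) : CStarMatrix n n A :=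
  CStarMatrix.ofMatrix (Matrix.of fun i j => M i j g)

theorem coeffMat_apply {n : Type*} (g : G) (M : CStarMatrix n n (CrossedProduct α)) (i j : n) :
    coeffMat α g M i j = M i j g := rfl

theorem tendsto_coeffMat {n X : Type*} {l : Filter X} {F : X → CStarMatrix n n (CrossedProduct α)}
    {M : CStarMatrix n n (CrossedProduct α)} (h : Tendsto F l (𝓝 M)) (g : G) :
    Tendsto (fun x => coeffMat α g (F x)) l (𝓝 (coeffMat α g M)) :=
  tendsto_entrywise fun i j =>
    ((CrossedProduct.continuous_coeff α g).tendsto _).comp (tendsto_entry h i j)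

theorem coeffMat_map_incl [DecidableEq G] {n : Type*} (a : CStarMatrix n n A) (g : G) :
    coeffMat α g (a.map (CrossedProduct.incl α)) = if g = 1 then a else 0 := by
  ext i j
  rw [coeffMat_apply, CStarMatrix.map_apply, CrossedProduct.incl_apply]
  split_ifs <;> rfl

theorem coeffMat_conj {n : Type*} [Fintype n] (w : CStarMatrix n n (CrossedProduct α))
    (b : CStarMatrix n n A) (k : G) :
    coeffMat α k (w * b.map (CrossedProduct.incl α) * w.conjTranspose) =
      ∑ g, coeffMat α g w * matAction α n g b * matAction α n k (star (coeffMat α (k⁻¹ * g) w)) := by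
  ext p q
  rw [coeffMat_apply, CStarMatrix.mul_apply, CrossedProduct.sum_coeff, sum_entry]
  simp only [CStarMatrix.conjTranspose_apply, CrossedProduct.mul_star_coeff]
  rw [Finset.sum_comm]
  refine Finset.sum_congr rfl fun g _ => ?_
  rw [CStarMatrix.mul_apply]
  refine Finset.sum_congr rfl fun s _ => ?_
  rw [matAction_apply, CStarMatrix.star_apply, coeffMat_apply, CStarMatrix.mul_apply,
    CrossedProduct.sum_coeff, CStarMatrix.mul_apply]
  congr 1
  refine Finset.sum_congr rfl fun r _ => ?_
  rw [CStarMatrix.map_apply, CrossedProduct.mul_incl_coeff]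
  rfl

end Coefficients

/-! ### The covariant relations in asymptotic form. -/

section AsymptoticRelations

variable {G E : Type*} [Group G] [Fintype G] [CStarAlgebra E]

/-- Constant sequences. -/
def constSeq (x : E) : boundedSeq E := ⟨fun _ => x, ‖x‖, fun _ => le_rfl⟩

theorem boundedSeq_sum_apply (f : G → boundedSeq E) (k : ℕ) :
    (∑ g, f g).1 k = ∑ g, (f g).1 k := by
  have : (∑ g, f g).1 = ∑ g, (f g).1 := map_sum (boundedSeq E).subtype f _
  rw [this, Finset.sum_apply]

/-- In the ring of bounded sequences modulo null sequences all the asymptotic relations become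
exact, so the identity follows from `covariant_sum` without tracking errors. -/
theorem tendsto_covariant_sum {C : ℕ → E} {S : G → ℕ → E} (hCs : ∀ k, star (C k) = C k)
    (hC : ∀ k, ‖C k‖ ≤ 1) (hS : ∀ g k, ‖S g k‖ ≤ 1) {w B : G → E} {U : G → G → E} {b q : E}
    (h1 : Tendsto (fun k => S 1 k - C k) atTop (𝓝 0))
    (h2 : ∀ g, Tendsto (fun k => star (S g k) - S g⁻¹ k) atTop (𝓝 0))
    (h3 : ∀ g h, Tendsto (fun k => S g k * S h k - C k * S (g * h) k) atTop (𝓝 0))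
    (h4 : ∀ g, Tendsto (fun k => C k * S g k - S g k * C k) atTop (𝓝 0))
    (hq : Tendsto (fun k => C k * q - q * C k) atTop (𝓝 0))
    (hw : ∀ g, Tendsto (fun k => C k * w g - w g * C k) atTop (𝓝 0))
    (hW : ∀ g, Tendsto (fun k => C k * star (w g) - star (w g) * C k) atTop (𝓝 0))
    (hB : ∀ g, Tendsto (fun k => C k * B g - B g * C k) atTop (𝓝 0))
    (hU : ∀ g h, Tendsto (fun k => C k * U g h - U g h * C k) atTop (𝓝 0))
    (hSB : ∀ g, Tendsto (fun k => S g k * b * star (S g k) - C k * B g * C k) atTop (𝓝 0))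
    (hSU : ∀ g h, Tendsto (fun k => S g k * star (w h) * star (S g k) - C k * U g h * C k)
      atTop (𝓝 0)) :
    Tendsto (fun k => (C k * ∑ g, w g * S g k) * b * star (C k * ∑ g, w g * S g k) -
      C k * C k * C k * ∑ l, (∑ g, w g * B g * U l (l⁻¹ * g)) * S l k) atTop (𝓝 0) ∧
    Tendsto (fun k => q * C k ^ 4 * q - C k * C k * C k * (q * q * S 1 k)) atTop (𝓝 0) := by
  let c : boundedSeq E := ⟨C, 1, hC⟩
  let s : G → boundedSeq E := fun g => ⟨S g, 1, hS g⟩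
  let s' : G → boundedSeq E := fun g => ⟨fun k => star (S g k), 1, fun k => by
    rw [norm_star]; exact hS g k⟩
  let φ := (nullCon E).mk'
  have hc : ∀ x : E, Tendsto (fun k => C k * x - x * C k) atTop (𝓝 0) →
      Commute (φ c) (φ (constSeq x)) := fun x hx => by
    rw [commute_iff_eq, ← map_mul, ← map_mul]
    exact nullCon_mk_eq.2 hx
  have r1 : φ (s 1) = φ c := nullCon_mk_eq.2 h1
  have r2 : ∀ g, φ (s' g) = φ (s g⁻¹) := fun g => nullCon_mk_eq.2 (h2 g)
  have r3 : ∀ g h, φ (s g) * φ (s h) = φ c * φ (s (g * h)) := fun g h => by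
    rw [← map_mul, ← map_mul]; exact nullCon_mk_eq.2 (h3 g h)
  have r4 : ∀ g, Commute (φ c) (φ (s g)) := fun g => by
    rw [commute_iff_eq, ← map_mul, ← map_mul]; exact nullCon_mk_eq.2 (h4 g)
  have r5 : ∀ g, φ (s g) * φ (constSeq b) * φ (s g⁻¹) = φ c * φ (constSeq (B g)) * φ c := fun g => by
    rw [← r2]
    simp only [← map_mul]
    exact nullCon_mk_eq.2 (hSB g)
  have r6 : ∀ g h, φ (s g) * φ (constSeq (star (w h))) * φ (s g⁻¹)
      = φ c * φ (constSeq (U g h)) * φ c := fun g h => by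
    rw [← r2]
    simp only [← map_mul]
    exact nullCon_mk_eq.2 (hSU g h)
  constructor
  · have hs := covariant_sum (c := φ c) (s := fun g => φ (s g)) r1 r3 r4
      (w := fun g => φ (constSeq (w g))) (B := fun g => φ (constSeq (B g)))
      (W := fun g => φ (constSeq (star (w g)))) (U := fun k h => φ (constSeq (U k h)))
      (b := φ (constSeq b)) (fun g => hc _ (hw g)) (fun g => hc _ (hB g)) (fun g => hc _ (hW g))
      (fun k h => hc _ (hU k h)) r5 r6
    simp only [← r2] at hs
    simp only [← map_mul, ← map_sum] at hs
    have := nullCon_mk_eq.1 hs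
    refine this.congr fun k => ?_
    congr 1
    · change C k * (∑ g, constSeq (w g) * s g).1 k * b *
        ((∑ g, s' g * constSeq (star (w g))).1 k * C k) = _
      rw [boundedSeq_sum_apply, boundedSeq_sum_apply, star_mul, hCs, star_sum]
      simp only [star_mul]
      rfl
    · change C k * C k * C k * (∑ l, (∑ g, constSeq (w g) * constSeq (B g) *
        constSeq (U l (l⁻¹ * g))) * s l).1 k = _
      rw [boundedSeq_sum_apply]
      congr 1
      refine Finset.sum_congr rfl fun l _ => ?_
      change (∑ g, constSeq (w g) * constSeq (B g) * constSeq (U l (l⁻¹ * g))).1 k * S l k = _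
      rw [boundedSeq_sum_apply]
      rfl
  · have hcq := hc q hq
    have : φ (constSeq q * c ^ 4 * constSeq q) = φ (c * c * c * (constSeq q * constSeq q * s 1)) := by
      simp only [map_mul, map_pow, r1]
      have e : Commute (φ c ^ 4) (φ (constSeq q) * φ (constSeq q)) :=
        (hcq.mul_right hcq).pow_left 4
      have e1 : Commute (φ c) (φ (constSeq q) * φ (constSeq q)) := hcq.mul_right hcq
      calc φ (constSeq q) * φ c ^ 4 * φ (constSeq q)
          = φ c ^ 4 * (φ (constSeq q) * φ (constSeq q)) := by
            rw [← (hcq.pow_left 4).eq, mul_assoc]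
        _ = φ c * φ c * φ c * (φ c * (φ (constSeq q) * φ (constSeq q))) := by
            simp only [pow_succ, pow_zero, one_mul, mul_assoc]
        _ = _ := by rw [e1.eq]
    exact nullCon_mk_eq.1 this

end AsymptoticRelations

/-! ### Norm and order estimates for the compression argument. -/

section Estimates

/-- Here V stands for q C⁴ q and X for Y b Y*. Half of ε pays for the asymptotic identities, and the
other half is shared among the |G| coefficients of w b w* - a. -/
theorem norm_sub_le_of_coefficients {E G : Type*} [CStarAlgebra E] [Group G] [Fintype G]
    [DecidableEq G] {a q C X V : E} {D S : G → E} {ε : ℝ} (hqa : q * q = a) (hC : ‖C‖ ≤ 1)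
    (hS : ∀ l, ‖S l‖ ≤ 1) (hD : ∀ l, ‖D l - (if l = 1 then a else 0)‖ < ε / 2 / Fintype.card G)
    (h : ‖X - C * C * C * ∑ l, D l * S l - (V - C * C * C * (q * q * S 1))‖ < ε / 2) :
    ‖V - X‖ ≤ ε := by
  have hN : (0 : ℝ) < Fintype.card G := by exact_mod_cast Fintype.card_pos
  have e0 : ∑ l, (D l - if l = 1 then a else 0) * S l = (∑ l, D l * S l) - q * q * S 1 := by
    simp only [sub_mul, Finset.sum_sub_distrib]
    congr 1
    rw [Finset.sum_eq_single 1]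
    · rw [if_pos rfl, hqa]
    · intro l _ hl; rw [if_neg hl, zero_mul]
    · simp
  have e1 : V - X = -(X - C * C * C * ∑ l, D l * S l - (V - C * C * C * (q * q * S 1))) -
      C * C * C * ∑ l, (D l - if l = 1 then a else 0) * S l := by
    rw [e0, mul_sub]
    abel
  rw [e1]
  refine (norm_sub_le _ _).trans ?_
  rw [norm_neg]
  have e2 : ‖C * C * C * ∑ l, (D l - if l = 1 then a else 0) * S l‖ ≤ ε / 2 := by
    have hC3 : ‖C * C * C‖ ≤ 1 := by
      refine norm_mul₃_le.trans ?_
      have h0 := norm_nonneg C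
      calc ‖C‖ * ‖C‖ * ‖C‖ ≤ 1 * 1 * 1 := by gcongr
        _ = 1 := by norm_num
    refine (norm_mul_le _ _).trans ?_
    calc ‖C * C * C‖ * ‖∑ l, (D l - if l = 1 then a else 0) * S l‖
        ≤ 1 * ∑ l : G, ε / 2 / Fintype.card G := by
          gcongr
          refine norm_sum_le_of_le _ fun l _ => ?_
          calc _ ≤ ‖D l - if l = 1 then a else 0‖ * ‖S l‖ := norm_mul_le _ _
            _ ≤ (ε / 2 / Fintype.card G) * 1 :=
              mul_le_mul (hD l).le (hS l) (norm_nonneg _) ((norm_nonneg _).trans (hD l).le)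
            _ = _ := mul_one _
      _ = ε / 2 := by
          rw [Finset.sum_const, Finset.card_univ, nsmul_eq_mul]
          field_simp
  linarith

variable {E : Type*} [CStarAlgebra E] [PartialOrder E] [StarOrderedRing E]

/-- On [0, 1] the factor 1 + t + t² + t³ of 1 - t⁴ is at most 4. -/
theorem one_sub_pow_four_le {C : E} (hC : 0 ≤ C) (hC1 : ‖C‖ ≤ 1) :
    1 - C ^ 4 ≤ (4 : ℝ) • (1 - C) := by
  have hs : IsSelfAdjoint C := hC.isSelfAdjoint
  rcases subsingleton_or_nontrivial E with hE | hE
  · exact (Subsingleton.elim _ _).le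
  have e1 : (1 : E) - C ^ 4 = cfc (fun t : ℝ => 1 - t ^ 4) C := by
    rw [cfc_sub (fun _ : ℝ => 1) (fun t => t ^ 4) C, cfc_const_one ℝ C, cfc_pow_id C 4]
  have e2 : (4 : ℝ) • (1 - C) = cfc (fun t : ℝ => 4 * (1 - t)) C := by
    rw [cfc_const_mul 4 (fun t : ℝ => 1 - t) C, cfc_sub (fun _ : ℝ => 1) (fun t => t) C,
      cfc_const_one ℝ C, cfc_id' ℝ C]
  rw [e1, e2]
  refine cfc_mono fun t ht => ?_
  have h0 := spectrum_nonneg' hC ht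
  have h1 : t ≤ 1 := (le_abs_self t).trans ((spectrum.norm_le_norm_of_mem ht).trans hC1)
  have h2 : 0 ≤ 1 - t := by linarith
  have h3 : t ^ 2 ≤ 1 := pow_le_one₀ h0 h1
  have h5 : t ^ 3 ≤ 1 := pow_le_one₀ h0 h1
  nlinarith [mul_nonneg h2 (show 0 ≤ 3 - t - t ^ 2 - t ^ 3 by linarith)]

theorem le_cutDown_add {x : E} (hx : IsSelfAdjoint x) {η ε : ℝ} (h : η ≤ ε) :
    x ≤ cutDown x η + algebraMap ℝ E ε := by
  have e3 : cutDown x η + algebraMap ℝ E ε = cfc (fun t : ℝ => max (t - η) 0 + ε) x := by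
    rw [cutDown, ← cfc_const ε x hx]
    exact (cfc_add x (fun t : ℝ => max (t - η) 0) (fun _ => ε)).symm
  rw [e3]
  conv_lhs => rw [← cfc_id' ℝ x hx]
  refine cfc_mono fun t _ => ?_
  have := le_max_left (t - η) 0
  linarith

/-- Split a = q C⁴ q + q (1 - C⁴) q. The first term is near X, and the second is at most 4 q (1 - C)
q, which D controls up to 4ε a. -/
theorem le_add_of_compression {a q C D X : E} (ha : 0 ≤ a) (hq : star q = q) (hqa : q * q = a)
    (hC : 0 ≤ C) (hC1 : ‖C‖ ≤ 1) {ε : ℝ} (hε : 0 < ε) (hD : 1 - C ≤ D + algebraMap ℝ E ε)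
    (hX : 0 ≤ X) (h : ‖q * C ^ 4 * q - X‖ ≤ ε) :
    a ≤ (X + (4 : ℝ) • (q * D * q)) + algebraMap ℝ E (ε + 4 * ε * ‖a‖) := by
  have e1 : a = q * C ^ 4 * q + q * (1 - C ^ 4) * q := by rw [← hqa]; noncomm_ring
  have hC4 : IsSelfAdjoint (q * C ^ 4 * q) := by
    rw [IsSelfAdjoint, star_mul, star_mul, hq, star_pow, hC.isSelfAdjoint.star_eq, mul_assoc]
  have e2 := le_add_of_norm_sub_le hC4 hX.isSelfAdjoint h
  have e3 : q * (1 - C ^ 4) * q ≤ (4 : ℝ) • (q * D * q) + (4 * ε) • a := by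
    have f1 := conj_le_conj ((one_sub_pow_four_le hC hC1).trans (smul_le_smul_of_nonneg_left hD
      (show (0 : ℝ) ≤ 4 by norm_num))) q
    rw [hq] at f1
    refine f1.trans (le_of_eq ?_)
    rw [Algebra.algebraMap_eq_smul_one, smul_add, mul_add, add_mul, mul_smul_comm,
      smul_mul_assoc, smul_smul, mul_smul_comm, mul_one, smul_mul_assoc, hqa]
  have e4 : (4 * ε) • a ≤ algebraMap ℝ E (4 * ε * ‖a‖) := by
    rw [Algebra.algebraMap_eq_smul_one, mul_smul (4 * ε) ‖a‖ (1 : E)]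
    exact smul_le_smul_of_nonneg_left (le_norm_smul_one ha) (by positivity)
  calc a = q * C ^ 4 * q + q * (1 - C ^ 4) * q := e1
    _ ≤ (X + algebraMap ℝ E ε) + ((4 : ℝ) • (q * D * q) + algebraMap ℝ E (4 * ε * ‖a‖)) :=
      add_le_add e2 (e3.trans (add_le_add le_rfl e4))
    _ = _ := by rw [map_add]; abel

theorem four_smul_conj_nonneg {D q : E} (hD : 0 ≤ D) (hq : star q = q) :
    0 ≤ (4 : ℝ) • (q * D * q) := by
  have := conj_nonneg' hD q
  rw [hq] at this
  exact smul_nonneg (by norm_num) this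

theorem csub_four_smul_conj {D q : E} (hq : star q = q) : CSub ((4 : ℝ) • (q * D * q)) D := by
  refine (csub_smul (by norm_num) _).trans ?_
  have := CSub.conj q D
  rwa [hq] at this

theorem tendsto_cutDown {a : E} (ha : 0 ≤ a) {u : ℕ → ℝ} (hu0 : ∀ j, 0 ≤ u j)
    (hu : Tendsto u atTop (𝓝 0)) : Tendsto (fun j => cutDown a (u j)) atTop (𝓝 a) := by
  rw [tendsto_iff_norm_sub_tendsto_zero]
  exact squeeze_zero (fun _ => norm_nonneg _) (fun j => norm_cutDown_sub_le ha (hu0 j)) hu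

end Estimates

/-! ### From comparison in the crossed product back to comparison in A. -/

section Core

variable {G A : Type*} [Group G] [Fintype G] [CStarAlgebra A] [PartialOrder A] [StarOrderedRing A]
variable {α : G →* (A ≃⋆ₐ[ℂ] A)}
variable {n : Type*} [Fintype n] [DecidableEq n]

theorem tendsto_zero_of_norm_lt {E : Type*} [NormedAddCommGroup E] {x : ℕ → E}
    (h : ∀ k, ‖x k‖ < 1 / ((k : ℝ) + 1)) : Tendsto x atTop (𝓝 0) := by
  rw [tendsto_zero_iff_norm_tendsto_zero]
  exact squeeze_zero (fun _ => norm_nonneg _) (fun k => (h k).le)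
    tendsto_one_div_add_atTop_nhds_zero_nat

theorem norm_starHom_le {D E : Type*} [NonUnitalCStarAlgebra D] [NonUnitalCStarAlgebra E]
    (f : D →⋆ₙₐ[ℂ] E) (x : D) : ‖f x‖ ≤ ‖x‖ := NonUnitalStarAlgHom.norm_apply_le f x

theorem matAction_scalarHom {c : A} {g : G} (hc : α g c = c) :
    matAction α n g (scalarHom n c) = scalarHom n c := by
  ext i j
  rw [matAction_apply, scalarHom_apply]
  split_ifs
  · exact hc
  · exact map_zero _

theorem tendsto_scalarHom {u : ℕ → A} (h : Tendsto u atTop (𝓝 0)) :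
    Tendsto (fun k => scalarHom n (u k)) atTop (𝓝 0) := by
  have := ((continuous_starHom (scalarHom (A := A) n)).tendsto 0).comp h
  rwa [map_zero] at this

/-- The defining property of weakly tracially strictly approximately inner actions, for finite
sets of matrices and in terms of sequences. -/
theorem exists_approxInner_sequence (hα : IsWeaklyTraciallyStrictlyApproxInner α)
    (T : Finset (CStarMatrix n n A)) {x : A} (hx0 : 0 ≤ x) (hx1 : ‖x‖ = 1) :
    ∃ (c : ℕ → A) (s : ℕ → G → A), (∀ k, 0 ≤ c k ∧ ‖c k‖ ≤ 1 ∧ (∀ g, ‖s k g‖ ≤ 1) ∧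
        CuntzSub (oneByOne (cutDown (1 - c k) (1 / ((k : ℝ) + 1)))) (oneByOne x)) ∧
      Tendsto (fun k => scalarHom n (s k 1) - scalarHom n (c k)) atTop (𝓝 0) ∧
      (∀ g, Tendsto (fun k => star (scalarHom n (s k g)) - scalarHom n (s k g⁻¹)) atTop (𝓝 0)) ∧
      (∀ g h, Tendsto (fun k => scalarHom n (s k g) * scalarHom n (s k h) -
        scalarHom n (c k) * scalarHom n (s k (g * h))) atTop (𝓝 0)) ∧
      (∀ g, Tendsto (fun k => scalarHom n (c k) * scalarHom n (s k g) -
        scalarHom n (s k g) * scalarHom n (c k)) atTop (𝓝 0)) ∧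
      (∀ M ∈ T, Tendsto (fun k => scalarHom n (c k) * M - M * scalarHom n (c k)) atTop (𝓝 0)) ∧
      (∀ M ∈ T, ∀ g, Tendsto (fun k => scalarHom n (s k g) * M * star (scalarHom n (s k g)) -
        scalarHom n (c k) * matAction α n g M * scalarHom n (c k)) atTop (𝓝 0)) := by
  classical
  let F : Finset A := T.biUnion fun M => Finset.univ.image fun p : n × n => M p.1 p.2
  have hF : ∀ M ∈ T, ∀ i j, M i j ∈ F := fun M hM i j => Finset.mem_biUnion.2
    ⟨M, hM, Finset.mem_image_of_mem (fun p : n × n => M p.1 p.2) (Finset.mem_univ (i, j))⟩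
  choose c s hc0 hcα hc1 hs h1 h2 h3 h4 h5 h6 h7 _ using
    fun k : ℕ => hα F (1 / ((k : ℝ) + 1)) Nat.one_div_pos_of_nat x hx0 hx1
  refine ⟨c, s, fun k => ⟨hc0 k, hc1 k, fun g => (hs k g).1, h7 k⟩, ?_, fun g => ?_, fun g h => ?_,
    fun g => ?_, fun M hM => ?_, fun M hM g => ?_⟩
  · simpa only [map_sub] using tendsto_scalarHom (n := n) (tendsto_zero_of_norm_lt h1)
  · simpa only [map_sub, map_star] using
      tendsto_scalarHom (n := n) (tendsto_zero_of_norm_lt fun k => h2 k g)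
  · simpa only [map_sub, map_mul] using
      tendsto_scalarHom (n := n) (tendsto_zero_of_norm_lt fun k => h3 k g h)
  · simpa only [map_sub, map_mul] using
      tendsto_scalarHom (n := n) (tendsto_zero_of_norm_lt fun k => h5 k g)
  · refine tendsto_entrywise fun i j => ?_
    refine (tendsto_zero_of_norm_lt fun k => h4 k (M i j) (hF M hM i j)).congr fun k => ?_
    rw [CStarMatrix.sub_apply, scalarHom_mul_apply, mul_scalarHom_apply]
  · refine tendsto_entrywise fun i j => ?_
    have := (tendsto_zero_of_norm_lt fun k => h6 k (M i j) (hF M hM i j) g).neg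
    rw [neg_zero] at this
    refine this.congr fun k => ?_
    -- Invariance of c lets the compression by c pass through α_g.
    have e1 : scalarHom n (c k) * matAction α n g M * scalarHom n (c k)
        = matAction α n g (scalarHom n (c k) * M * scalarHom n (c k)) := by
      rw [map_mul, map_mul, matAction_scalarHom (hcα k g)]
    rw [e1, CStarMatrix.sub_apply, matAction_apply, mul_scalarHom_apply, scalarHom_mul_apply,
      ← map_star, mul_scalarHom_apply, scalarHom_mul_apply, neg_sub]

/-- Taking coefficients is continuous, and a itself has only the coefficient at 1. As G is finite,
one member of the implementing sequence serves all k. -/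
theorem exists_coefficients [DecidableEq G] {a b : CStarMatrix n n A}
    (h : CuntzSub (a.map (CrossedProduct.incl α)) (b.map (CrossedProduct.incl α)))
    {δ : ℝ} (hδ : 0 < δ) :
    ∃ w : G → CStarMatrix n n A, ∀ k, ‖(∑ g, w g * matAction α n g b *
      matAction α n k (star (w (k⁻¹ * g)))) - (if k = 1 then a else 0)‖ < δ := by
  obtain ⟨y, hy⟩ := h
  have h1 : ∀ k : G, ∀ᶠ j in atTop, ‖coeffMat α k (y j * b.map (CrossedProduct.incl α) *
      (y j).conjTranspose) - (if k = 1 then a else 0)‖ < δ := by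
    intro k
    have h1 := tendsto_coeffMat α hy k
    rw [coeffMat_map_incl, tendsto_iff_norm_sub_tendsto_zero] at h1
    exact h1.eventually_lt_const hδ
  obtain ⟨j, hj⟩ := (eventually_all.2 h1).exists
  refine ⟨fun g => coeffMat α g (y j), fun k => ?_⟩
  have := hj k
  rwa [coeffMat_conj] at this

open Classical in
theorem exists_finset_matrices (q b : CStarMatrix n n A) (w : G → CStarMatrix n n A) :
    ∃ T : Finset (CStarMatrix n n A), q ∈ T ∧ b ∈ T ∧ (∀ g, w g ∈ T) ∧ (∀ g, star (w g) ∈ T) ∧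
      (∀ g, matAction α n g b ∈ T) ∧ ∀ g h, matAction α n g (star (w h)) ∈ T := by
  refine ⟨({q, b} : Finset _) ∪ Finset.univ.image w ∪ Finset.univ.image (fun g => star (w g)) ∪
    Finset.univ.image (fun g => matAction α n g b) ∪
    Finset.univ.image (fun p : G × G => matAction α n p.1 (star (w p.2))), ?_⟩
  simp only [Finset.mem_union, Finset.mem_image, Finset.mem_univ, true_and, Finset.mem_insert,
    Finset.mem_singleton]
  exact ⟨by tauto, by tauto, fun g => Or.inl <| Or.inl <| Or.inl <| Or.inr ⟨g, rfl⟩,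
    fun g => Or.inl <| Or.inl <| Or.inr ⟨g, rfl⟩, fun g => Or.inl <| Or.inr ⟨g, rfl⟩,
    fun g h => Or.inr ⟨(g, h), rfl⟩⟩

/-- The witness is Y = c ∑ w_g s_g, the image of an implementing element ∑ w_g u_g under u_g ↦ s_g,
cut down by c. The w_g are chosen first, so that the approximately inner data can be adapted to
them. -/
theorem exists_norm_conj_sub_le (hα : IsWeaklyTraciallyStrictlyApproxInner α) {a b q : CStarMatrix n n A}
    (hqa : q * q = a)
    (h : CuntzSub (a.map (CrossedProduct.incl α)) (b.map (CrossedProduct.incl α)))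
    {x : A} (hx0 : 0 ≤ x) (hx1 : ‖x‖ = 1) {ε : ℝ} (hε : 0 < ε) :
    ∃ (Y : CStarMatrix n n A) (c : A) (η : ℝ), 0 ≤ c ∧ ‖c‖ ≤ 1 ∧ η ≤ ε ∧
      CuntzSub (oneByOne (cutDown (1 - c) η)) (oneByOne x) ∧
      ‖q * scalarHom n c ^ 4 * q - Y * b * star Y‖ ≤ ε := by
  classical
  obtain ⟨w, hw⟩ := exists_coefficients h (div_pos (half_pos hε)
    (show (0 : ℝ) < Fintype.card G by exact_mod_cast Fintype.card_pos))
  obtain ⟨T, hqT, hbT, hwT, hWT, hBT, hUT⟩ := exists_finset_matrices (α := α) q b w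
  obtain ⟨c, s, hcs, h1, h2, h3, h4, h5, h6⟩ := exists_approxInner_sequence hα T hx0 hx1
  have hCn : ∀ k, ‖scalarHom n (c k)‖ ≤ 1 := fun k => (norm_starHom_le _ _).trans (hcs k).2.1
  have hSn : ∀ g k, ‖scalarHom n (s k g)‖ ≤ 1 := fun g k =>
    (norm_starHom_le _ _).trans ((hcs k).2.2.1 g)
  have hCs : ∀ k, star (scalarHom n (c k)) = scalarHom n (c k) := fun k => by
    rw [← map_star, (hcs k).1.isSelfAdjoint.star_eq]
  have t := tendsto_covariant_sum (C := fun k => scalarHom n (c k))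
    (S := fun g k => scalarHom n (s k g)) hCs
    hCn hSn (w := w) (B := fun g => matAction α n g b)
    (U := fun k h => matAction α n k (star (w h))) (b := b) (q := q) h1 h2 h3 h4 (h5 q hqT)
    (fun g => h5 _ (hwT g)) (fun g => h5 _ (hWT g)) (fun g => h5 _ (hBT g))
    (fun k h => h5 _ (hUT k h)) (fun g => h6 _ hbT g) (fun g h => h6 _ (hWT h) g)
  have t3 := tendsto_zero_iff_norm_tendsto_zero.1 ((t.1.sub t.2).trans (by rw [sub_zero]))
  obtain ⟨k, hk1, hk2⟩ := ((t3.eventually_lt_const (show 0 < ε / 2 by positivity)).and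
    (tendsto_one_div_add_atTop_nhds_zero_nat.eventually_le_const hε)).exists
  exact ⟨scalarHom n (c k) * ∑ g, w g * scalarHom n (s k g), c k, 1 / ((k : ℝ) + 1), (hcs k).1,
    (hcs k).2.1, hk2, (hcs k).2.2.2,
    norm_sub_le_of_coefficients hqa (hCn k) (fun l => hSn l k) hw hk1⟩

theorem one_sub_scalarHom_le {c : A} (hc : 0 ≤ c) {η ε : ℝ} (hη : η ≤ ε) :
    1 - scalarHom n c ≤ scalarHom n (cutDown (1 - c) η) + algebraMap ℝ (CStarMatrix n n A) ε := by
  have e1 := le_cutDown_add ((IsSelfAdjoint.one A).sub hc.isSelfAdjoint) hη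
  rw [← sub_nonneg] at e1 ⊢
  have e2 := scalarMatrix_nonneg (n := n) e1
  refine le_of_le_of_eq e2 ?_
  ext i j
  rw [scalarMatrix_apply, CStarMatrix.sub_apply, CStarMatrix.sub_apply, CStarMatrix.add_apply,
    CStarMatrix.one_apply, scalarHom_apply, scalarHom_apply,
    Algebra.algebraMap_eq_smul_one, Algebra.algebraMap_eq_smul_one, CStarMatrix.smul_apply,
    CStarMatrix.one_apply]
  split_ifs <;> simp

/-- If `a ≾ b` in the crossed product then `a ≾ b ⊕ z` in `A`, for every nonzero `z`. -/
theorem le_add_of_map_incl_le (hN : NoMinimal A) (hP : IsPrimeRing A)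
    (hα : IsWeaklyTraciallyStrictlyApproxInner α) {m : ℕ} {a b : CStarMatrix (Fin m) (Fin m) A}
    (ha : 0 ≤ a) (hb : 0 ≤ b)
    (h : CuntzSub (a.map (CrossedProduct.incl α)) (b.map (CrossedProduct.incl α)))
    {z : W A} (hz : z ≠ 0) : cls a ha ≤ cls b hb + z := by
  -- Over m × m matrices the remainder 1 - c becomes m copies of itself, so m copies of x have to
  -- fit under z.
  obtain ⟨u, hu0, hu⟩ := exists_nsmul_le hN hP m hz
  obtain ⟨d, hd, hd0, hdu⟩ := exists_cls₁_le hu0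
  set x : A := ‖d‖⁻¹ • d with hx
  have hx0 : 0 ≤ x := smul_nonneg (by positivity) hd
  have hx1 : ‖x‖ = 1 := by
    rw [hx, norm_smul, norm_inv, norm_norm, inv_mul_cancel₀ (norm_ne_zero_iff.2 hd0)]
  have hxz : m • cls₁ x hx0 ≤ z := by
    refine le_trans (nsmul_le_nsmul_right (le_trans ?_ hdu) m) hu
    exact cls₁_le_of_csub (csub_smul (by positivity) d)
  obtain ⟨q, hq0, hqa⟩ := exists_sqrt ha
  have hqs : star q = q := hq0.isSelfAdjoint.star_eq
  -- Only a cut-down of a is compared; the cut 2 (ε + 4ε‖a‖) tends to 0 with ε, and the limit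
  -- recovers a.
  have key : ∀ ε : ℝ, 0 < ε →
      cls (cutDown a (2 * (ε + 4 * ε * ‖a‖))) (cutDown_nonneg _ _) ≤ cls b hb + z := by
    intro ε hε
    obtain ⟨Y, c, η, hc0, hc1, hη, hcx, hY⟩ := exists_norm_conj_sub_le hα hqa h hx0 hx1 hε
    have hD0 : 0 ≤ scalarHom (Fin m) (cutDown (1 - c) η) := scalarMatrix_nonneg (cutDown_nonneg _ _)
    have hYb : 0 ≤ Y * b * star Y := conj_nonneg' hb Y
    have hqDq := four_smul_conj_nonneg hD0 hqs
    have h6 := le_add_of_compression (C := scalarHom (Fin m) c) ha hqs hqa (scalarMatrix_nonneg hc0)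
      ((norm_starHom_le _ _).trans hc1) hε (one_sub_scalarHom_le hc0 hη) hYb hY
    have h7 := cutDown_csub ha (show 0 < ε + 4 * ε * ‖a‖ by positivity) (CSub.refl _) h6
    refine (cls_le_of_csub (hb := add_nonneg hYb hqDq) h7).trans ((cls_add_le hYb hqDq).trans ?_)
    refine add_le_add (cls_le_of_csub (CSub.conj Y b)) (le_trans ?_ hxz)
    refine (cls_le_of_csub (hb := hD0) (csub_four_smul_conj hqs)).trans ?_
    refine (le_of_eq (cls_scalarMatrix m (cutDown_nonneg (1 - c) η))).trans ?_
    exact nsmul_le_nsmul_right (cls_le_cls.2 hcx) m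
  induction z using W.induction with | _ k e he
  rw [cls_add_cls, cls_le_cls]
  have ht : Tendsto (fun j : ℕ => 2 * ((1 / ((j : ℝ) + 1)) + 4 * (1 / ((j : ℝ) + 1)) * ‖a‖))
      atTop (𝓝 0) := by
    have h0 := tendsto_one_div_add_atTop_nhds_zero_nat (𝕜 := ℝ)
    have := ((h0.add ((h0.const_mul 4).mul_const ‖a‖)).const_mul 2)
    simpa using this
  refine CuntzSub.of_tendsto (tendsto_cutDown ha (fun j => by positivity) ht) fun j => ?_
  have := key _ (Nat.one_div_pos_of_nat (n := j))
  rw [cls_add_cls, cls_le_cls] at this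
  exact this

end Core

/-! ### The comparison restated for classes in W(A). -/

section CommonSize

theorem zero_cls {D : Type*} [NonUnitalCStarAlgebra D] [PartialOrder D] [StarOrderedRing D] (n : ℕ) :
    cls (0 : CStarMatrix (Fin n) (Fin n) D) le_rfl = 0 := cls_eq_zero_iff.2 rfl

/-- Two elements of `W(D)` have representatives of the same size. -/
theorem exists_common_size {D : Type*} [NonUnitalCStarAlgebra D] [PartialOrder D]
    [StarOrderedRing D] (x y : W D) : ∃ (N : ℕ) (a b : CStarMatrix (Fin N) (Fin N) D) (ha : 0 ≤ a)
      (hb : 0 ≤ b), x = cls a ha ∧ y = cls b hb := by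
  induction x using W.induction with | _ m a ha
  induction y using W.induction with | _ n b hb
  refine ⟨m + n, dsum a 0, dsum 0 b, dsum_nonneg ha le_rfl, dsum_nonneg le_rfl hb, ?_, ?_⟩
  · rw [← cls_add_cls ha le_rfl, zero_cls, add_zero]
  · rw [← cls_add_cls le_rfl hb, zero_cls, zero_add]

variable {G A : Type*} [Group G] [Fintype G] [CStarAlgebra A] [PartialOrder A] [StarOrderedRing A]
variable {α : G →* (A ≃⋆ₐ[ℂ] A)}

theorem le_add_of_mapW_incl_le (hN : NoMinimal A) (hP : IsPrimeRing A)
    (hα : IsWeaklyTraciallyStrictlyApproxInner α) {x y z : W A}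
    (h : W.map (CrossedProduct.incl α) x ≤ W.map (CrossedProduct.incl α) y) (hz : z ≠ 0) :
    x ≤ y + z := by
  obtain ⟨N, a, b, ha, hb, rfl, rfl⟩ := exists_common_size x y
  rw [W.map_cls, W.map_cls, cls_le_cls] at h
  exact le_add_of_map_incl_le hN hP hα ha hb h hz

end CommonSize

/-! ### Finite corners of the stabilization. -/

namespace Stab

section Corners

variable {D : Type*} [NonUnitalCStarAlgebra D] [PartialOrder D] [StarOrderedRing D]

theorem MInf_of_corner {k n : ℕ} (h : k ≤ n) (M : CStarMatrix (Fin k) (Fin k) D) :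
    MInf.of D (corner D h M) = MInf.of D M :=
  (DirectLimit.eq_of_le (f := fun _ _ h => corner D h)
    (⟨k, M⟩ : Σ n : ℕ, CStarMatrix (Fin n) (Fin n) D) n h).symm

/-- The inclusion `M_n(D) → 𝒦 ⊗ D`. -/
noncomputable def hom (n : ℕ) : CStarMatrix (Fin n) (Fin n) D →⋆ₙₐ[ℂ] Stab D where
  toFun M := ofMInf (MInf.of D M)
  map_smul' c M := by rw [MInf.of_smul, ofMInf_smul]; rfl
  map_zero' := by rw [MInf.of_zero, map_zero]
  map_add' M N := by rw [MInf.of_add, map_add]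
  map_mul' M N := by rw [MInf.of_mul, ofMInf_mul]
  map_star' M := by rw [MInf.of_star, ofMInf_star]

theorem norm_hom {n : ℕ} (M : CStarMatrix (Fin n) (Fin n) D) : ‖hom n M‖ = ‖M‖ :=
  (norm_ofMInf _).trans (MInf.norm_of M)

theorem hom_corner {k n : ℕ} (h : k ≤ n) (M : CStarMatrix (Fin k) (Fin k) D) :
    hom n (corner D h M) = hom k M := congrArg ofMInf (MInf_of_corner h M)

theorem isometry_hom (n : ℕ) : Isometry (hom n : CStarMatrix (Fin n) (Fin n) D → Stab D) :=
  AddMonoidHomClass.isometry_of_norm _ norm_hom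

theorem hom_injective (n : ℕ) :
    Function.Injective (hom n : CStarMatrix (Fin n) (Fin n) D → Stab D) := (isometry_hom n).injective

theorem isClosed_range_hom (n : ℕ) :
    IsClosed (Set.range (hom n : CStarMatrix (Fin n) (Fin n) D → Stab D)) :=
  (isometry_hom n).isClosedEmbedding.isClosed_range

theorem hom_induction {p : Stab D → Prop} (hp : IsClosed {x | p x})
    (h : ∀ n (M : CStarMatrix (Fin n) (Fin n) D), p (hom n M)) (x : Stab D) : p x :=
  Stab.induction hp (fun x => MInf.induction (p := fun x => p (ofMInf x)) h x) x

end Corners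

section Compression

variable {D : Type*} [CStarAlgebra D] [PartialOrder D] [StarOrderedRing D]

/-- The upper left `k × k` corner. -/
def upperLeft {n k : ℕ} (h : k ≤ n) (M : CStarMatrix (Fin n) (Fin n) D) :
    CStarMatrix (Fin k) (Fin k) D :=
  CStarMatrix.ofMatrix (Matrix.of fun i j => M (Fin.castLE h i) (Fin.castLE h j))

theorem corner_one_apply {n k : ℕ} (h : k ≤ n) (i j : Fin n) :
    corner D h 1 i j = if i = j then (if i.1 < k then 1 else 0) else 0 := by
  rw [corner_apply]
  by_cases hi : i.1 < k <;> by_cases hj : j.1 < k <;> by_cases hij : i = j <;>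
    simp_all [CStarMatrix.one_apply, Fin.ext_iff]

theorem corner_one_mul_mul {n k : ℕ} (h : k ≤ n) (M : CStarMatrix (Fin n) (Fin n) D) :
    corner D h 1 * M * corner D h 1 = corner D h (upperLeft h M) := by
  ext i j
  rw [CStarMatrix.mul_apply]
  simp only [CStarMatrix.mul_apply, corner_one_apply]
  rw [corner_apply]
  by_cases hi : i.1 < k <;> by_cases hj : j.1 < k <;> simp [hi, hj, upperLeft]

/-- The unit of `M_k(D)` in `𝒦 ⊗ D`. -/
noncomputable def unit (D : Type*) [CStarAlgebra D] [PartialOrder D] [StarOrderedRing D] (k : ℕ) :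
    Stab D := hom k 1

theorem star_unit (k : ℕ) : star (unit D k) = unit D k := by
  rw [unit, ← map_star, star_one]

theorem norm_unit_le (k : ℕ) : ‖unit D k‖ ≤ 1 := by
  rw [unit, norm_hom]
  rcases subsingleton_or_nontrivial (CStarMatrix (Fin k) (Fin k) D) with h | h
  · rw [Subsingleton.elim (1 : CStarMatrix (Fin k) (Fin k) D) 0, norm_zero]; exact zero_le_one
  · exact CStarRing.norm_one.le

theorem unit_mul_hom_mul_unit (k : ℕ) (M : CStarMatrix (Fin k) (Fin k) D) :
    unit D k * hom k M * unit D k = hom k M := by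
  rw [unit, ← map_mul, ← map_mul, one_mul, mul_one]

/-- The range of the isometry `hom k` is closed, so it suffices to compress elements of the dense
union of the matrix algebras. -/
theorem unit_mul_mul_unit_mem (k : ℕ) (s : Stab D) :
    ∃ M, unit D k * s * unit D k = hom k M := by
  have h : ∀ s : Stab D, unit D k * s * unit D k ∈ Set.range (hom k) := by
    refine hom_induction ((isClosed_range_hom k).preimage (by fun_prop)) fun n M => ?_
    refine ⟨upperLeft (le_max_left k n) (corner D (le_max_right k n) M), ?_⟩
    rw [← hom_corner (le_max_left k n), ← corner_one_mul_mul, map_mul, map_mul, hom_corner,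
      hom_corner]
    rfl
  obtain ⟨M, hM⟩ := h s
  exact ⟨M, hM.symm⟩

theorem unit_mul_hom_mul_unit_of_le {n k : ℕ} (h : n ≤ k) (M : CStarMatrix (Fin n) (Fin n) D) :
    unit D k * hom n M * unit D k = hom n M := by
  rw [← hom_corner h, unit_mul_hom_mul_unit]

/-- Compression is eventually the identity on each finite matrix algebra, and is contractive. The
shift k + 1 supplies the nonzero size needed when these compressions are flattened. -/
theorem tendsto_unit_mul_mul_unit (s : Stab D) :
    Tendsto (fun k => unit D (k + 1) * s * unit D (k + 1)) atTop (𝓝 s) := by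
  rw [Metric.tendsto_atTop]
  intro ε hε
  have hd : s ∈ closure {x : Stab D | ∃ n M, x = hom n M} := hom_induction
    (p := fun s => s ∈ closure {x : Stab D | ∃ n M, x = hom n M}) isClosed_closure
    (fun n M => subset_closure ⟨n, M, rfl⟩) s
  obtain ⟨_, ⟨n, M, rfl⟩, hM⟩ := Metric.mem_closure_iff.1 hd (ε / 2) (half_pos hε)
  refine ⟨n, fun k hk => ?_⟩
  rw [dist_eq_norm] at hM ⊢
  have e : unit D (k + 1) * s * unit D (k + 1) - s
      = unit D (k + 1) * (s - hom n M) * unit D (k + 1) - (s - hom n M) := by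
    have := unit_mul_hom_mul_unit_of_le (show n ≤ k + 1 by omega) M
    rw [mul_sub, sub_mul, this]
    abel
  rw [e]
  refine (norm_sub_le _ _).trans_lt ?_
  have h1 : ‖unit D (k + 1) * (s - hom n M) * unit D (k + 1)‖ ≤ 1 * ‖s - hom n M‖ * 1 := by
    refine norm_mul₃_le.trans ?_
    have := norm_unit_le (D := D) (k + 1)
    gcongr
  linarith

end Compression

end Stab

/-! ### Corner embeddings reflect Cuntz comparison. -/

section CornerHoms

variable {E F : Type*} [NonUnitalCStarAlgebra E] [NonUnitalCStarAlgebra F]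
variable {m n : Type*} [Fintype m] [DecidableEq m] [Fintype n] [DecidableEq n]

/-- `f` is an isomorphism onto the corner `s F s`. -/
structure IsCornerHom (f : E →⋆ₙₐ[ℂ] F) (s : F) : Prop where
  injective : Function.Injective f
  star_eq : star s = s
  mul_mul : ∀ x, s * f x * s = f x
  exists_eq : ∀ t, ∃ x, s * t * s = f x

theorem scalarMatrix_conjTranspose {s : F} (hs : star s = s) :
    (scalarMatrix m s).conjTranspose = scalarMatrix m s := by
  have := (scalarMatrix_star (n := m) s).symm
  rw [hs] at this
  exact this

/-- Compression of all entries of a matrix by `s`. -/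
def compress (s : F) (y : CStarMatrix m n F) : CStarMatrix m n F :=
  scalarMatrix m s * y * scalarMatrix n s

theorem compress_apply (s : F) (y : CStarMatrix m n F) (i : m) (j : n) :
    compress s y i j = s * y i j * s := by
  simp [compress, CStarMatrix.mul_apply, scalarMatrix_apply]

theorem tendsto_compress {X : Type*} {l : Filter X} {u : X → CStarMatrix m n F}
    {M : CStarMatrix m n F} (s : F) (h : Tendsto u l (𝓝 M)) :
    Tendsto (fun x => compress s (u x)) l (𝓝 (compress s M)) := by
  refine tendsto_entrywise fun i j => ?_
  simp only [compress_apply]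
  exact ((tendsto_entry h i j).const_mul s).mul_const s

theorem compress_conj {s : F} (hs : star s = s) (y : CStarMatrix m n F) {b : CStarMatrix n n F}
    (hb : compress s b = b) : compress s y * b * (compress s y).conjTranspose
      = compress s (y * b * y.conjTranspose) := by
  nth_rw 2 [← hb]
  simp only [compress, rect_conjTranspose_mul, rect_mul_assoc, scalarMatrix_conjTranspose hs]

namespace IsCornerHom

variable {f : E →⋆ₙₐ[ℂ] F} {s : F} (hf : IsCornerHom f s)

include hf

theorem compress_map (b : CStarMatrix m n E) : compress s (b.map f) = b.map f := by
  ext i j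
  rw [compress_apply]
  exact hf.mul_mul _

theorem exists_map_eq (y : CStarMatrix m n F) : ∃ Y : CStarMatrix m n E, compress s y = Y.map f := by
  choose g hg using hf.exists_eq
  refine ⟨CStarMatrix.ofMatrix (Matrix.of fun i j => g (y i j)), ?_⟩
  ext i j
  rw [compress_apply, hg]
  rfl

theorem exists_conj_map_eq (y : CStarMatrix m n F) (b : CStarMatrix n n E) :
    ∃ Y : CStarMatrix m n E, compress s (y * b.map f * y.conjTranspose) =
      (Y * b * Y.conjTranspose).map f := by
  obtain ⟨Y, hY⟩ := hf.exists_map_eq y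
  refine ⟨Y, ?_⟩
  rw [← compress_conj hf.star_eq y (hf.compress_map b), hY, map_rect_mul, map_rect_mul,
    map_conjTranspose]

/-- Compressing an implementing sequence entrywise by s leaves the limit unchanged and moves the
sequence into the corner, where it lifts along f. -/
theorem cuntzSub_of_map {a : CStarMatrix m m E} {b : CStarMatrix n n E}
    (h : CuntzSub (a.map f) (b.map f)) : CuntzSub a b := by
  obtain ⟨y, hy⟩ := h
  choose Y hY using fun k => hf.exists_conj_map_eq (y k) b
  refine ⟨Y, tendsto_entrywise fun i j => ?_⟩
  have h1 := tendsto_entry (tendsto_compress s hy) i j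
  simp only [hY, hf.compress_map] at h1
  exact (NonUnitalStarAlgHom.isometry f hf.injective).isEmbedding.tendsto_nhds_iff.2 h1

end IsCornerHom

end CornerHoms

/-! ### Matrices over a finite corner as larger matrices over D. -/

namespace Stab

variable {D : Type*} [CStarAlgebra D] [PartialOrder D] [StarOrderedRing D]

theorem isCornerHom_hom (k : ℕ) :
    IsCornerHom (hom k : CStarMatrix (Fin k) (Fin k) D →⋆ₙₐ[ℂ] Stab D) (unit D k) :=
  ⟨hom_injective k, star_unit k, unit_mul_hom_mul_unit k, unit_mul_mul_unit_mem k⟩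

/-- The inclusion `D → 𝒦 ⊗ D` as the upper left corner. -/
noncomputable def incl (D : Type*) [CStarAlgebra D] [PartialOrder D] [StarOrderedRing D] :
    D →⋆ₙₐ[ℂ] Stab D where
  toFun d := hom 1 (oneByOne d)
  map_smul' c d := map_smul (hom 1) c (oneByOne d)
  map_zero' := map_zero (hom 1)
  map_add' a b := map_add (hom 1) (oneByOne a) (oneByOne b)
  map_mul' a b := by rw [oneByOne_mul, map_mul]
  map_star' a := map_star (hom 1) (oneByOne a)

theorem incl_apply (d : D) : incl D d = hom 1 (oneByOne d) := rfl

theorem isCornerHom_incl : IsCornerHom (incl D) (unit D 1) where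
  injective a b h := congrArg (fun M => M 0 0) (hom_injective 1 h)
  star_eq := star_unit 1
  mul_mul x := unit_mul_hom_mul_unit 1 _
  exists_eq t := by
    obtain ⟨M, hM⟩ := unit_mul_mul_unit_mem 1 t
    refine ⟨M 0 0, hM.trans (congrArg (hom 1) ?_)⟩
    ext i j
    rw [Subsingleton.elim i 0, Subsingleton.elim j 0]
    rfl

theorem incl_eq_hom_single {k : ℕ} [NeZero k] (d : D) : incl D d = hom k (single 0 0 d) := by
  rw [incl_apply, ← hom_corner (NeZero.one_le : 1 ≤ k)]
  congr 1
  ext i j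
  rw [corner_apply, single_apply]
  simp only [Nat.lt_one_iff, Fin.ext_iff, Fin.val_zero]
  split_ifs <;> rfl

variable {k : ℕ} [NeZero k]

theorem hom_conj_single (p q : Fin k) (x : D) :
    hom k (single p 0 1) * incl D x * hom k (single 0 q 1) = hom k (single p q x) := by
  rw [incl_eq_hom_single (k := k), ← map_mul, ← map_mul]
  congr 1
  ext i j
  rw [mul_single_mul_apply]
  simp only [single_apply]
  by_cases hi : i = p <;> by_cases hj : j = q <;> simp [hi, hj]

theorem single_conj_hom (p q : Fin k) (M : CStarMatrix (Fin k) (Fin k) D) :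
    hom k (single 0 p 1) * hom k M * hom k (single q 0 1) = incl D (M p q) := by
  rw [incl_eq_hom_single (k := k), ← map_mul, ← map_mul]
  congr 1
  ext i j
  rw [CStarMatrix.mul_apply]
  simp only [CStarMatrix.mul_apply, single_apply]
  by_cases hi : i = 0 <;> by_cases hj : j = 0 <;> simp [hi, hj]

theorem sum_single (M : CStarMatrix (Fin k) (Fin k) D) :
    ∑ p, ∑ q, hom k (single p q (M p q)) = hom k M := by
  have h : M = ∑ p, ∑ q, single p q (M p q) := by
    ext i j
    simp only [sum_entry, single_apply]
    simp [ite_and]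
  conv_rhs => rw [h, map_sum]
  simp only [map_sum]

variable {m : Type*} [Fintype m] [DecidableEq m]

/-- A matrix of matrices as a matrix over `D`. -/
def flatten (Z : CStarMatrix m m (CStarMatrix (Fin k) (Fin k) D)) :
    CStarMatrix (m × Fin k) (m × Fin k) D :=
  CStarMatrix.ofMatrix (Matrix.of fun i j => Z i.1 j.1 i.2 j.2)

/-- The matrix implementing the Cuntz equivalence of a matrix over `M_k(D)` and its flattening. -/
noncomputable def flattenUnit : CStarMatrix m (m × Fin k) (Stab D) :=
  CStarMatrix.ofMatrix (Matrix.of fun i j => if i = j.1 then hom k (single j.2 0 1) else 0)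

theorem flattenUnit_apply (i : m) (j : m × Fin k) : (flattenUnit : CStarMatrix m (m × Fin k) (Stab D)) i j
    = if i = j.1 then hom k (single j.2 0 1) else 0 := rfl

theorem star_single_one (p q : Fin k) :
    star (single p q 1 : CStarMatrix (Fin k) (Fin k) D) = single q p 1 := by
  ext i j
  rw [CStarMatrix.star_apply, single_apply, single_apply]
  by_cases hi : i = q <;> by_cases hj : j = p <;> simp [hi, hj]

/-- Conjugation by matrix units moves each entry of a block from the upper left corner to its place
(p, q); summing over p and q restores the block. -/
theorem flattenUnit_conj (Z : CStarMatrix m m (CStarMatrix (Fin k) (Fin k) D)) :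
    flattenUnit * (flatten Z).map (incl D) * flattenUnit.conjTranspose = Z.map (hom k) := by
  ext i j
  rw [CStarMatrix.mul_apply, CStarMatrix.map_apply, ← sum_single, Finset.sum_comm]
  simp only [CStarMatrix.mul_apply, CStarMatrix.conjTranspose_apply, flattenUnit_apply, apply_ite star,
    ← map_star, star_single_one, star_zero, Fintype.sum_prod_type]
  simp only [ite_mul, mul_ite, zero_mul, mul_zero, Finset.sum_mul]
  simp [hom_conj_single, flatten]

theorem flattenUnit_conj' (Z : CStarMatrix m m (CStarMatrix (Fin k) (Fin k) D)) :
    flattenUnit.conjTranspose * Z.map (hom k) * flattenUnit.conjTranspose.conjTranspose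
      = (flatten Z).map (incl D) := by
  ext i j
  rw [CStarMatrix.mul_apply, CStarMatrix.map_apply]
  simp only [CStarMatrix.mul_apply, CStarMatrix.conjTranspose_apply, flattenUnit_apply, apply_ite star,
    ← map_star, star_single_one, star_zero]
  simp [← single_conj_hom, flatten]

end Stab

/-! ### Positivity under homomorphisms and compressions. -/

section Positivity

variable {E F : Type*} [NonUnitalCStarAlgebra E] [PartialOrder E] [StarOrderedRing E]
  [NonUnitalCStarAlgebra F] [PartialOrder F] [StarOrderedRing F]

theorem starHom_nonneg (f : E →⋆ₙₐ[ℂ] F) {x : E} (hx : 0 ≤ x) : 0 ≤ f x := by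
  obtain ⟨y, rfl⟩ := nonneg_iff_exists.1 hx
  rw [map_mul, map_star]
  exact star_mul_self_nonneg _

/-- With y the negative part of x, y x y = -y³. Its image is both ≥ 0 and ≤ 0, so y³ = 0 by
injectivity, hence y = 0. -/
theorem nonneg_of_starHom_nonneg {f : E →⋆ₙₐ[ℂ] F} (hf : Function.Injective f) {x : E}
    (hx : 0 ≤ f x) : 0 ≤ x := by
  have hs : IsSelfAdjoint x := hf (by rw [map_star, hx.isSelfAdjoint.star_eq])
  set y := x⁻ with hy
  have hy0 : 0 ≤ y := CFC.negPart_nonneg x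
  have hys : star y = y := hy0.isSelfAdjoint.star_eq
  have h1 : y * x * y = -(y * y * y) := by
    nth_rw 1 [← CFC.posPart_sub_negPart x hs]
    rw [mul_sub, hy, CFC.negPart_mul_posPart, zero_sub, neg_mul]
  have h2 : 0 ≤ f (y * x * y) := by
    have := star_left_conjugate_nonneg hx (f y)
    rwa [← map_star, hys, ← map_mul, ← map_mul] at this
  have h3 : 0 ≤ f (y * y * y) := by
    have := star_left_conjugate_nonneg hy0 y
    rw [hys] at this
    exact starHom_nonneg f this
  rw [h1, map_neg, neg_nonneg] at h2
  have h4 : y * y * y = 0 := hf (by rw [le_antisymm h2 h3, map_zero])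
  have h5 : y * y = 0 := by
    rw [← CStarRing.star_mul_self_eq_zero_iff, star_mul, hys, ← mul_assoc, h4, zero_mul]
  have h6 : y = 0 := by
    rw [← CStarRing.star_mul_self_eq_zero_iff, hys, h5]
  rw [← CFC.posPart_sub_negPart x hs, ← hy, h6, sub_zero]
  exact CFC.posPart_nonneg x

theorem nonneg_of_map_nonneg {n : Type*} [Fintype n] {f : E →⋆ₙₐ[ℂ] F} (hf : Function.Injective f)
    {M : CStarMatrix n n E} (hM : 0 ≤ M.map f) : 0 ≤ M := by
  refine nonneg_of_starHom_nonneg (f := CStarMatrix.mapₙₐ f) (fun M N h => ?_) hM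
  ext i j
  exact hf (congrArg (fun X => X i j) h)

theorem compress_nonneg {m : Type*} [Fintype m] [DecidableEq m] {s : F} (hs : star s = s)
    {b : CStarMatrix m m F} (hb : 0 ≤ b) : 0 ≤ compress s b := by
  have := star_left_conjugate_nonneg hb (scalarMatrix m s)
  rwa [← scalarMatrix_star, hs] at this

theorem cuntzSub_compress {m : Type*} [Fintype m] [DecidableEq m] {s : F} (hs : star s = s)
    (b : CStarMatrix m m F) : CuntzSub (compress s b) b := by
  have := CuntzSub.conj (scalarMatrix m s) b
  rwa [scalarMatrix_conjTranspose hs] at this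

end Positivity

/-! ### W(D) inside Cu(D). -/

namespace Stab

variable {D : Type*} [CStarAlgebra D] [PartialOrder D] [StarOrderedRing D]

theorem map_incl_le_map_incl {x y : W D} (h : W.map (incl D) x ≤ W.map (incl D) y) : x ≤ y := by
  induction x using W.induction with | _ m a ha
  induction y using W.induction with | _ n b hb
  exact cls_le_cls.2 (isCornerHom_incl.cuntzSub_of_map (cls_le_cls.1 h))

variable {k : ℕ} [NeZero k]

theorem flatten_nonneg {m : Type*} [Fintype m] {Z : CStarMatrix m m (CStarMatrix (Fin k) (Fin k) D)}
    (hZ : 0 ≤ Z) : 0 ≤ flatten Z := by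
  obtain ⟨X, rfl⟩ := nonneg_iff_exists.1 hZ
  have : flatten (star X * X) = star (flatten X) * flatten X := by
    ext i j
    rw [CStarMatrix.mul_apply, Fintype.sum_prod_type]
    change (star X * X) i.1 j.1 i.2 j.2 = _
    rw [CStarMatrix.mul_apply, sum_entry]
    refine Finset.sum_congr rfl fun p _ => ?_
    rw [CStarMatrix.mul_apply]
    rfl
  rw [this]
  exact star_mul_self_nonneg _

/-- The flattening indexed by `Fin (m * k)`. -/
noncomputable def flattenFin {m : ℕ} (Z : CStarMatrix (Fin m) (Fin m) (CStarMatrix (Fin k) (Fin k) D)) :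
    CStarMatrix (Fin (m * k)) (Fin (m * k)) D :=
  CStarMatrix.reindexₐ ℂ D finProdFinEquiv (flatten Z)

theorem flattenFin_nonneg {m : ℕ} {Z : CStarMatrix (Fin m) (Fin m) (CStarMatrix (Fin k) (Fin k) D)}
    (hZ : 0 ≤ Z) : 0 ≤ flattenFin Z := by
  obtain ⟨X, hX⟩ := nonneg_iff_exists.1 (flatten_nonneg hZ)
  rw [flattenFin, hX, map_mul, map_star]
  exact star_mul_self_nonneg _

theorem flattenFin_apply {m : ℕ} (Z : CStarMatrix (Fin m) (Fin m) (CStarMatrix (Fin k) (Fin k) D))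
    (i j : Fin m × Fin k) : flattenFin Z (finProdFinEquiv i) (finProdFinEquiv j) =
      Z i.1 j.1 i.2 j.2 := by
  change flatten Z (finProdFinEquiv.symm (finProdFinEquiv i))
    (finProdFinEquiv.symm (finProdFinEquiv j)) = _
  rw [Equiv.symm_apply_apply, Equiv.symm_apply_apply]
  rfl

/-- `flattenUnit` and its adjoint implement the two comparisons. Thus classes supported in a finite
corner of the stabilization come from W(D). -/
theorem cls_map_hom {m : ℕ} {Z : CStarMatrix (Fin m) (Fin m) (CStarMatrix (Fin k) (Fin k) D)}
    (hZ : 0 ≤ Z) (hZ' : 0 ≤ Z.map (hom k)) :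
    cls (Z.map (hom k)) hZ' = W.map (incl D) (cls (flattenFin Z) (flattenFin_nonneg hZ)) := by
  have h := cuntzSub_of_embedding (a := (flatten Z).map (incl D))
    (b := (flattenFin Z).map (incl D)) finProdFinEquiv.toEmbedding
    (fun i j => congrArg (incl D) (flattenFin_apply Z i j))
    (fun i _ hi => (hi (finProdFinEquiv.surjective i)).elim)
    (fun _ j hj => (hj (finProdFinEquiv.surjective j)).elim)
  refine le_antisymm (cls_le_cls.2 (CuntzSub.trans ?_ h.1)) (cls_le_cls.2 (h.2.trans ?_))
  · rw [← flattenUnit_conj]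
    exact CuntzSub.conj _ _
  · rw [← flattenUnit_conj']
    exact CuntzSub.conj _ _

theorem cls_oneByOne_hom {a : CStarMatrix (Fin k) (Fin k) D} (ha : 0 ≤ a) :
    cls (oneByOne (hom k a)) (oneByOne_nonneg (starHom_nonneg (hom k) ha)) =
      W.map (incl D) (cls a ha) := by
  have h := cls_map_hom (Z := oneByOne a) (oneByOne_nonneg ha)
    (oneByOne_nonneg (starHom_nonneg (hom k) ha))
  refine h.trans (congrArg _ ?_)
  symm
  refine cls_eq_of_equiv ((Equiv.uniqueProd (Fin k) (Fin 1)).symm.trans finProdFinEquiv)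
    fun i j => ?_
  exact flattenFin_apply _ _ _

theorem exists_map_incl_eq_cls_map_hom {m : ℕ}
    {Z : CStarMatrix (Fin m) (Fin m) (CStarMatrix (Fin k) (Fin k) D)} (hZ : 0 ≤ Z.map (hom k)) :
    ∃ u : W D, W.map (incl D) u = cls (Z.map (hom k)) hZ :=
  have h : 0 ≤ Z := nonneg_of_map_nonneg (hom_injective k) hZ
  ⟨cls (flattenFin Z) (flattenFin_nonneg h), (cls_map_hom h hZ).symm⟩

theorem exists_map_incl_eq_cls {m : ℕ} {b : CStarMatrix (Fin m) (Fin m) (Stab D)} (hb : 0 ≤ b)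
    (h : ∃ Z : CStarMatrix (Fin m) (Fin m) (CStarMatrix (Fin k) (Fin k) D), b = Z.map (hom k)) :
    ∃ u : W D, W.map (incl D) u = cls b hb := by
  obtain ⟨Z, rfl⟩ := h
  exact exists_map_incl_eq_cls_map_hom hb

theorem exists_map_incl_eq_cls_compress {m : ℕ} (b : CStarMatrix (Fin m) (Fin m) (Stab D))
    (hb : 0 ≤ b) (k : ℕ) [NeZero k] : ∃ u : W D, W.map (incl D) u =
      cls (compress (unit D k) b) (compress_nonneg (star_unit k) hb) :=
  exists_map_incl_eq_cls (compress_nonneg (star_unit k) hb) ((isCornerHom_hom k).exists_map_eq b)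

end Stab

/-! ### From W(D) to Cu(D) by approximation. -/

section Approximation

/-- From ‖C - a‖ ≤ η follows a - η ≤ C; conjugate by e. -/
theorem csub_of_conj_sub {E : Type*} [CStarAlgebra E] [PartialOrder E] [StarOrderedRing E]
    {a a' C e : E} {η : ℝ} (ha : IsSelfAdjoint a) (ha' : 0 ≤ a')
    (he : e * (a - algebraMap ℝ E η) * star e = a') (hC : IsSelfAdjoint C) (h : ‖C - a‖ ≤ η) :
    CSub a' C := by
  rw [norm_sub_rev] at h
  have h1 := conj_le_conj (sub_le_iff_le_add.2 (le_add_of_norm_sub_le ha hC h)) e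
  rw [he] at h1
  exact (csub_of_le ha' h1).trans (CSub.conj e C)

theorem norm_map_sub {E F m : Type*} [Fintype m] [NonUnitalCStarAlgebra E] [PartialOrder E]
    [StarOrderedRing E] [NonUnitalCStarAlgebra F] [PartialOrder F] [StarOrderedRing F]
    {f : E →⋆ₙₐ[ℂ] F} (hf : Function.Injective f)
    (a b : CStarMatrix m m E) : ‖a.map f - b.map f‖ = ‖a - b‖ := by
  have h := NonUnitalStarAlgHom.norm_map
    (CStarMatrix.mapₙₐ f : CStarMatrix m m E →⋆ₙₐ[ℂ] CStarMatrix m m F)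
    (fun M N h => CStarMatrix.ext fun i j => hf (congrArg (fun X => X i j) h)) (a - b)
  rw [map_sub] at h
  exact h

theorem isSelfAdjoint_of_map {E F m : Type*} [Fintype m] [NonUnitalCStarAlgebra E]
    [NonUnitalCStarAlgebra F] {f : E →⋆ₙₐ[ℂ] F} (hf : Function.Injective f)
    {a : CStarMatrix m m E} (ha : IsSelfAdjoint (a.map f)) : IsSelfAdjoint a := by
  refine CStarMatrix.ext fun i j => hf ?_
  have := congrArg (fun X => X i j) ha.star_eq
  simpa [CStarMatrix.star_apply, map_star] using this

theorem compress_conj_isSelfAdjoint {F m n : Type*} [Fintype m] [DecidableEq m] [Fintype n]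
    [NonUnitalCStarAlgebra F] {s : F} (hs : star s = s) (w : CStarMatrix m n F)
    {b : CStarMatrix n n F} (hb : IsSelfAdjoint b) :
    IsSelfAdjoint (compress s (w * b * w.conjTranspose)) := by
  have hb' : b.conjTranspose = b := hb
  change (compress s (w * b * w.conjTranspose)).conjTranspose = _
  simp only [compress, rect_conjTranspose_mul, scalarMatrix_conjTranspose hs,
    rect_conjTranspose_conjTranspose, hb', rect_mul_assoc]

variable {D : Type*} [CStarAlgebra D] [PartialOrder D] [StarOrderedRing D]

/-- `u'` is the class of cut down `e (a - η) e*` of a representative `a` of `u`. -/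
def IsCut (η : ℝ) (u u' : W D) : Prop :=
  ∃ (n : ℕ) (a a' e : CStarMatrix (Fin n) (Fin n) D) (ha : 0 ≤ a) (ha' : 0 ≤ a'),
    u = cls a ha ∧ u' = cls a' ha' ∧ e * (a - algebraMap ℝ _ η) * star e = a'

theorem dsum_algebraMap (m n : ℕ) (η : ℝ) :
    dsum (algebraMap ℝ (CStarMatrix (Fin m) (Fin m) D) η)
      (algebraMap ℝ (CStarMatrix (Fin n) (Fin n) D) η) =
      algebraMap ℝ (CStarMatrix (Fin (m + n)) (Fin (m + n)) D) η := by
  ext i j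
  induction i using Fin.addCases <;> induction j using Fin.addCases <;>
    simp [CStarMatrix.algebraMap_apply, Fin.ext_iff] <;> omega

theorem dsum_sub {m n : ℕ} (a a' : CStarMatrix (Fin m) (Fin m) D)
    (b b' : CStarMatrix (Fin n) (Fin n) D) : dsum a b - dsum a' b' = dsum (a - a') (b - b') := by
  ext i j
  rw [CStarMatrix.sub_apply]
  induction i using Fin.addCases <;> induction j using Fin.addCases <;>
    simp

theorem dsum_star {m n : ℕ} (a : CStarMatrix (Fin m) (Fin m) D)
    (b : CStarMatrix (Fin n) (Fin n) D) : star (dsum a b) = dsum (star a) (star b) :=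
  conjTranspose_dsum a b

theorem IsCut.add {η : ℝ} {u u' v v' : W D} (hu : IsCut η u u') (hv : IsCut η v v') :
    IsCut η (u + v) (u' + v') := by
  obtain ⟨m, a, a', e, ha, ha', rfl, rfl, he⟩ := hu
  obtain ⟨n, b, b', f, hb, hb', rfl, rfl, hf⟩ := hv
  refine ⟨m + n, dsum a b, dsum a' b', dsum e f, dsum_nonneg ha hb, dsum_nonneg ha' hb', rfl, rfl, ?_⟩
  rw [← dsum_algebraMap, dsum_sub, dsum_star, dsum_mul, dsum_mul, he, hf]

theorem IsCut.zero (η : ℝ) : IsCut η (0 : W D) 0 :=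
  ⟨0, 0, 0, 0, le_rfl, le_rfl, rfl, rfl, by ext i; exact i.elim0⟩

theorem IsCut.nsmul {η : ℝ} {u u' : W D} (hu : IsCut η u u') (n : ℕ) : IsCut η (n • u) (n • u') := by
  induction n with
  | zero => simpa using IsCut.zero η
  | succ n ih => rw [succ_nsmul, succ_nsmul]; exact ih.add hu

theorem isCut_cutDown {n : ℕ} {a : CStarMatrix (Fin n) (Fin n) D} (ha : 0 ≤ a) {η : ℝ} (hη : 0 < η) :
    IsCut η (cls a ha) (cls (cutDown a (2 * η)) (cutDown_nonneg _ _)) := by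
  obtain ⟨e, he⟩ := exists_conj_eq_cutDown ha hη
  exact ⟨n, a, _, e, ha, cutDown_nonneg _ _, rfl, rfl, he⟩

/-- `y` is the limit of the images of the `S l`. -/
def IsLimitOf (y : Cu D) (S : ℕ → W D) : Prop :=
  ∃ (n : ℕ) (b : CStarMatrix (Fin n) (Fin n) (Stab D)) (hb : 0 ≤ b)
    (B : ℕ → CStarMatrix (Fin n) (Fin n) (Stab D)) (hB : ∀ l, 0 ≤ B l), y = cls b hb ∧
    Tendsto B atTop (𝓝 b) ∧ ∀ l, W.map (Stab.incl D) (S l) = cls (B l) (hB l)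

theorem IsLimitOf.add {y z : Cu D} {S T : ℕ → W D} (hy : IsLimitOf y S) (hz : IsLimitOf z T) :
    IsLimitOf (y + z) (fun l => S l + T l) := by
  obtain ⟨m, b, hb, B, hB, rfl, htB, hS⟩ := hy
  obtain ⟨n, c, hc, C, hC, rfl, htC, hT⟩ := hz
  refine ⟨m + n, dsum b c, dsum_nonneg hb hc, fun l => dsum (B l) (C l),
    fun l => dsum_nonneg (hB l) (hC l), rfl, ?_, fun l => ?_⟩
  · refine tendsto_entrywise fun i j => ?_
    induction i using Fin.addCases <;> induction j using Fin.addCases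
    · simpa using tendsto_entry htB _ _
    · simp
    · simp
    · simpa using tendsto_entry htC _ _
  · rw [map_add, hS, hT, cls_add_cls]

theorem IsLimitOf.zero : IsLimitOf (0 : Cu D) (fun _ => 0) :=
  ⟨0, 0, le_rfl, fun _ => 0, fun _ => le_rfl, rfl, tendsto_const_nhds, fun _ => map_zero _⟩

theorem IsLimitOf.nsmul {y : Cu D} {S : ℕ → W D} (hy : IsLimitOf y S) (n : ℕ) :
    IsLimitOf (n • y) (fun l => n • S l) := by
  induction n with
  | zero => simpa using IsLimitOf.zero
  | succ n ih => simp only [succ_nsmul]; exact ih.add hy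

theorem tendsto_compress_unit {n : ℕ} (b : CStarMatrix (Fin n) (Fin n) (Stab D)) :
    Tendsto (fun l => compress (Stab.unit D (l + 1)) b) atTop (𝓝 b) := by
  refine tendsto_entrywise fun i j => ?_
  simp only [compress_apply]
  exact Stab.tendsto_unit_mul_mul_unit _

theorem exists_isLimitOf (y : Cu D) :
    ∃ S : ℕ → W D, IsLimitOf y S ∧ ∀ l, W.map (Stab.incl D) (S l) ≤ y := by
  induction y using W.induction with | _ n b hb
  choose S hS using fun l : ℕ => Stab.exists_map_incl_eq_cls_compress b hb (l + 1)
  refine ⟨S, ⟨n, b, hb, _, _, rfl, tendsto_compress_unit b, hS⟩, fun l => ?_⟩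
  rw [hS, cls_le_cls]
  exact cuntzSub_compress (Stab.star_unit _) b

/-- Some compressed w (B l) w* is within η of the image of a, and it comes from a matrix C over D.
Then a' ≾ C by `csub_of_conj_sub`, and C lies below the stage l. -/
theorem IsCut.exists_le {η : ℝ} (hη : 0 < η) {u u' : W D} (hu : IsCut η u u') {y : Cu D}
    {S : ℕ → W D} (hy : IsLimitOf y S) (h : W.map (Stab.incl D) u ≤ y) : ∃ l, u' ≤ S l := by
  obtain ⟨m, a, a', e, ha, ha', rfl, rfl, he⟩ := hu
  obtain ⟨n, b, hb, B, hB, rfl, htB, hS⟩ := hy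
  obtain ⟨w, hw⟩ := cls_le_cls.1 h
  have h1 : a.map (Stab.incl D) ∈ closure {x | ∃ (l : ℕ) (w : CStarMatrix (Fin m) (Fin n) (Stab D)),
      x = compress (Stab.unit D 1) (w * B l * w.conjTranspose)} := by
    have h2 := tendsto_compress (Stab.unit D 1) hw
    rw [Stab.isCornerHom_incl.compress_map] at h2
    refine isClosed_closure.mem_of_tendsto h2 (Eventually.of_forall fun k => ?_)
    refine mem_closure_of_tendsto (b := atTop) (tendsto_compress (Stab.unit D 1)
      (u := fun l => w k * B l * (w k).conjTranspose) ?_) (Eventually.of_forall fun l => ⟨l, w k, rfl⟩)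
    refine tendsto_entrywise fun i j => ?_
    simp only [CStarMatrix.mul_apply]
    exact tendsto_finsetSum _ fun p _ => (tendsto_finsetSum _ fun q _ =>
      (tendsto_entry htB q p).const_mul _).mul_const _
  obtain ⟨_, ⟨l, w, rfl⟩, hl⟩ := Metric.mem_closure_iff.1 h1 η hη
  refine ⟨l, Stab.map_incl_le_map_incl ?_⟩
  rw [hS, W.map_cls, cls_le_cls]
  obtain ⟨C, hC⟩ := Stab.isCornerHom_incl.exists_map_eq (w * B l * w.conjTranspose)
  rw [hC, dist_eq_norm, norm_sub_rev, norm_map_sub Stab.isCornerHom_incl.injective] at hl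
  have hCs : IsSelfAdjoint C := isSelfAdjoint_of_map Stab.isCornerHom_incl.injective (by
    rw [← hC]
    exact compress_conj_isSelfAdjoint (Stab.star_unit 1) w (hB l).isSelfAdjoint)
  refine ((cuntzSub_iff_csub.2 (csub_of_conj_sub ha.isSelfAdjoint ha' he hCs hl.le)).map _).trans ?_
  rw [← hC]
  exact (cuntzSub_compress (Stab.star_unit 1) _).trans (CuntzSub.conj w (B l))

/-- If `W(D)` is almost unperforated then so is `Cu(D)`. -/
theorem almostUnperforated_cu (h : AlmostUnperforated (Set.univ : Set (W D))) :
    AlmostUnperforated (Set.univ : Set (Cu D)) := by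
  intro x _ y _ n hn hxy
  obtain ⟨S, hS, hSy⟩ := exists_isLimitOf y
  have key : ∀ u : W D, W.map (Stab.incl D) u ≤ x → W.map (Stab.incl D) u ≤ y := by
    intro u hu
    induction u using W.induction with | _ m a ha
    -- Only a cut-down of (n + 1) u is sure to lie below a fixed stage n (S l). There the hypothesis
    -- on W(D) applies, and η → 0 afterwards.
    have h1 : ∀ η : ℝ, 0 < η →
        W.map (Stab.incl D) (cls (cutDown a (2 * η)) (cutDown_nonneg _ _)) ≤ y := by
      intro η hη
      have h2 : W.map (Stab.incl D) ((n + 1) • cls a ha) ≤ n • y := by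
        rw [map_nsmul]
        exact (nsmul_le_nsmul_right hu _).trans hxy
      obtain ⟨l, hl⟩ := ((isCut_cutDown ha hη).nsmul (n + 1)).exists_le hη (hS.nsmul n) h2
      exact (W.map_mono _ (h _ trivial _ trivial n hn hl)).trans (hSy l)
    have ht : Tendsto (fun j : ℕ => 2 * (1 / ((j : ℝ) + 1))) atTop (𝓝 0) := by
      simpa using (tendsto_one_div_add_atTop_nhds_zero_nat (𝕜 := ℝ)).const_mul 2
    induction y using W.induction with | _ k b hb
    rw [W.map_cls, cls_le_cls]
    refine CuntzSub.of_tendsto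
      (tendsto_map (Stab.incl D) (tendsto_cutDown ha (fun j => by positivity) ht)) fun j => ?_
    exact cls_le_cls.1 (h1 _ (Nat.one_div_pos_of_nat (n := j)))
  obtain ⟨T, ⟨m, a, ha, B, hB, rfl, htB, hT⟩, hTx⟩ := exists_isLimitOf x
  induction y using W.induction with | _ k b hb
  rw [cls_le_cls]
  refine CuntzSub.of_tendsto htB fun l => ?_
  have := key (T l) (hTx l)
  rw [hT] at this
  exact cls_le_cls.1 this

end Approximation

/-! ### Compactness of projections in the Cuntz order. -/

section Projections

variable {F : Type*} [NonUnitalCStarAlgebra F] [PartialOrder F] [StarOrderedRing F]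

/-- The s are partial sums of the Neumann series for the inverse of h in the corner with unit q. -/
theorem exists_norm_mul_sub_le {q h : F} (hqq : q * q = q) (hqh : q * h = h) (hhq : h * q = h)
    (n : ℕ) :
    ∃ s : F, ‖s * h - q‖ ≤ ‖q - h‖ ^ (n + 1) := by
  induction n with
  | zero =>
    refine ⟨q, ?_⟩
    rw [hqh, norm_sub_rev, zero_add, pow_one]
  | succ n ih =>
    obtain ⟨s, hs⟩ := ih
    refine ⟨q + (q - h) * s, ?_⟩
    have e : (q + (q - h) * s) * h - q = (q - h) * (s * h - q) := by
      rw [add_mul, hqh, mul_sub, sub_mul q h q, hqq, hhq, mul_assoc]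
      abel
    rw [e, pow_succ']
    exact (norm_mul_le _ _).trans (mul_le_mul_of_nonneg_left hs (norm_nonneg _))

/-- If s_n h → q then s_n h² s_n* → q, and s_n h² s_n* is the conjugate of h by s_n h^{1/2}. -/
theorem exists_tendsto_projection {q h : F} (hqq : q * q = q) (hq : star q = q) (hqh : q * h = h)
    (hhq : h * q = h) (hh : 0 ≤ h) (hlt : ‖q - h‖ < 1) :
    ∃ z : ℕ → F, Tendsto (fun n => z n * h * star (z n)) atTop (𝓝 q) := by
  choose s hs using exists_norm_mul_sub_le hqq hqh hhq
  set c := CFC.sqrt h with hc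
  have hcs : star c = c := (CFC.sqrt_nonneg h).isSelfAdjoint.star_eq
  have hcc : c * c = h := CFC.sqrt_mul_sqrt_self h hh
  refine ⟨fun n => s n * c, ?_⟩
  have h1 : Tendsto (fun n => s n * h) atTop (𝓝 q) := by
    rw [tendsto_iff_norm_sub_tendsto_zero]
    exact squeeze_zero (fun _ => norm_nonneg _) hs
      ((tendsto_pow_atTop_nhds_zero_of_lt_one (norm_nonneg _) hlt).comp (tendsto_add_atTop_nat 1))
  have h2 := h1.mul ((continuous_star.tendsto q).comp h1)
  rw [hq, hqq] at h2
  refine h2.congr fun n => ?_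
  simp only [Function.comp_apply, star_mul, hcs, hh.isSelfAdjoint.star_eq]
  have e : c * h * c = h * h := by
    nth_rw 2 3 [← hcc]
    nth_rw 1 [← hcc]
    simp only [mul_assoc]
  calc s n * h * (h * star (s n)) = s n * (h * h) * star (s n) := by simp only [mul_assoc]
    _ = _ := by rw [← e]; simp only [mul_assoc]

/-- To stay among square matrices, place each column of v in one fixed column of a square matrix; v
v* is the sum of the resulting V_j V_j*. -/
theorem rect_mul_conjTranspose_nonneg {m n : Type*} [Fintype m] [Fintype n]
    (v : CStarMatrix m n F) : 0 ≤ v * v.conjTranspose := by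
  classical
  rcases isEmpty_or_nonempty m with hm | ⟨⟨i0⟩⟩
  · exact le_of_eq (CStarMatrix.ext fun i => hm.elim i)
  let V : n → CStarMatrix m m F := fun j =>
    CStarMatrix.ofMatrix (Matrix.of fun i p => if p = i0 then v i j else 0)
  have hV : ∀ j i p, V j i p = if p = i0 then v i j else 0 := fun _ _ _ => rfl
  have : v * v.conjTranspose = ∑ j, V j * star (V j) := by
    ext i p
    rw [CStarMatrix.mul_apply, sum_entry]
    refine Finset.sum_congr rfl fun j _ => ?_
    rw [CStarMatrix.mul_apply, Finset.sum_eq_single i0]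
    · simp [hV, CStarMatrix.star_apply]
    · intro b _ hb; simp [hV, hb]
    · simp
  rw [this]
  exact Finset.sum_nonneg fun j _ => mul_star_self_nonneg _

theorem rect_conj_nonneg {m n : Type*} [Fintype m] [Fintype n] (v : CStarMatrix m n F)
    {b : CStarMatrix n n F} (hb : 0 ≤ b) : 0 ≤ v * b * v.conjTranspose := by
  obtain ⟨x, rfl⟩ := nonneg_iff_exists.1 hb
  have h := rect_mul_conjTranspose_nonneg (v * star x)
  have e : (v * star x).conjTranspose = x * v.conjTranspose := by
    rw [rect_conjTranspose_mul]
    congr 1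
    exact star_star x
  rw [e, rect_mul_assoc, ← rect_mul_assoc (star x)] at h
  rwa [rect_mul_assoc]

/-- Compactness of classes of projections. -/
theorem exists_projection_cuntzSub {m n : Type*} [Fintype m] [Fintype n] {q : CStarMatrix m m F}
    (hq : IsStarProjection q) {b : CStarMatrix n n F} {B : ℕ → CStarMatrix n n F}
    (hB : ∀ l, 0 ≤ B l) (htB : Tendsto B atTop (𝓝 b)) (h : CuntzSub q b) : ∃ l, CuntzSub q (B l) := by
  obtain ⟨w, hw⟩ := h
  have hqq : q * q = q := hq.isIdempotentElem.eq
  have hqs : star q = q := hq.isSelfAdjoint.star_eq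
  have h1 : q ∈ closure {x | ∃ (l : ℕ) (w : CStarMatrix m n F), x = w * B l * w.conjTranspose} := by
    refine isClosed_closure.mem_of_tendsto hw (Eventually.of_forall fun k => ?_)
    refine mem_closure_of_tendsto (b := atTop) (f := fun l => w k * B l * (w k).conjTranspose) ?_
      (Eventually.of_forall fun l => ⟨l, w k, rfl⟩)
    refine tendsto_entrywise fun i j => ?_
    simp only [CStarMatrix.mul_apply]
    exact tendsto_finsetSum _ fun p _ => (tendsto_finsetSum _ fun q _ =>
      (tendsto_entry htB q p).const_mul _).mul_const _
  obtain ⟨_, ⟨l, w, rfl⟩, hl⟩ := Metric.mem_closure_iff.1 h1 1 one_pos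
  rw [dist_eq_norm] at hl
  have hx := rect_conj_nonneg w (hB l)
  set x := w * B l * w.conjTranspose with hxdef
  -- Compression by q brings the approximant into the corner of q, where distance less than 1 from q
  -- suffices for inversion.
  have hh : 0 ≤ q * x * q := by
    have := star_left_conjugate_nonneg hx q
    rwa [hqs] at this
  have hqn : ‖q‖ ≤ 1 := by
    have := CStarRing.norm_star_mul_self (x := q)
    rw [hqs, hqq] at this
    nlinarith [norm_nonneg q]
  have hlt : ‖q - q * x * q‖ < 1 := by
    have e : q - q * x * q = q * (q - x) * q := by
      rw [mul_sub, sub_mul, hqq, hqq]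
    rw [e]
    refine norm_mul₃_le.trans_lt ?_
    calc ‖q‖ * ‖q - x‖ * ‖q‖ ≤ 1 * ‖q - x‖ * 1 := by gcongr
      _ < 1 := by linarith
  obtain ⟨z, hz⟩ := exists_tendsto_projection hqq hqs (by rw [← mul_assoc, ← mul_assoc, hqq])
    (by rw [mul_assoc, hqq]) hh hlt
  refine ⟨l, CuntzSub.trans ⟨z, hz⟩ (CuntzSub.trans ?_ (CuntzSub.conj w (B l)))⟩
  have := CuntzSub.conj q x
  rwa [show q.conjTranspose = q from hqs] at this

end Projections

/-! ### Purely positive classes are not classes of projections. -/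

section PurelyPositive

variable {D : Type*} [CStarAlgebra D] [PartialOrder D] [StarOrderedRing D]

theorem csub_of_cuntzSub_hom {k : ℕ} {a b : CStarMatrix (Fin k) (Fin k) D}
    (h : CuntzSub (oneByOne (Stab.hom k a)) (oneByOne (Stab.hom k b))) : CSub a b := by
  obtain ⟨y, hy⟩ := h
  have h1 := tendsto_entry (tendsto_compress (Stab.unit D k) hy) 0 0
  have hc : ∀ c : CStarMatrix (Fin k) (Fin k) D,
      compress (Stab.unit D k) (oneByOne (Stab.hom k c)) = oneByOne (Stab.hom k c) := fun c => by
    ext i j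
    rw [compress_apply]
    exact Stab.unit_mul_hom_mul_unit k c
  rw [hc] at h1
  intro ε hε
  obtain ⟨l, hl⟩ := ((tendsto_iff_norm_sub_tendsto_zero.1 h1).eventually_lt_const hε).exists
  rw [← compress_conj (Stab.star_unit k) _ (hc b)] at hl
  obtain ⟨x, hx⟩ := Stab.unit_mul_mul_unit_mem k (y l 0 0)
  refine ⟨x, ?_⟩
  have e : (compress (Stab.unit D k) (y l) * oneByOne (Stab.hom k b) *
      (compress (Stab.unit D k) (y l)).conjTranspose) 0 0 = Stab.hom k (x * b * star x) := by
    rw [CStarMatrix.mul_apply, Fin.sum_univ_one, CStarMatrix.mul_apply, Fin.sum_univ_one,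
      CStarMatrix.conjTranspose_apply, compress_apply, hx, map_mul, map_mul, map_star]
    rfl
  rw [e] at hl
  change ‖Stab.hom k (x * b * star x) - Stab.hom k a‖ < ε at hl
  rw [← map_sub, Stab.norm_hom] at hl
  exact hl

theorem tendsto_oneByOne_hom_cutDown {k : ℕ} {a : CStarMatrix (Fin k) (Fin k) D} (ha : 0 ≤ a) :
    Tendsto (fun j : ℕ => oneByOne (Stab.hom k (cutDown a (1 / ((j : ℝ) + 1))))) atTop
      (𝓝 (oneByOne (Stab.hom k a))) :=
  tendsto_entrywise fun _ _ => show Tendsto (fun j : ℕ => Stab.hom k (cutDown a (1 / ((j : ℝ) + 1))))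
    atTop (𝓝 (Stab.hom k a)) from ((Stab.isometry_hom (D := D) k).continuous.tendsto a).comp
      (tendsto_cutDown ha (fun j => by positivity) tendsto_one_div_add_atTop_nhds_zero_nat)

theorem oneByOne_hom_nonneg {k : ℕ} {a : CStarMatrix (Fin k) (Fin k) D} (ha : 0 ≤ a) :
    0 ≤ oneByOne (Stab.hom k a) := oneByOne_nonneg (starHom_nonneg (Stab.hom k) ha)

/-- Since a is the limit of its cut-downs, compactness gives q ≾ (a - δ)_+ for some δ > 0; combine
this with a ≾ q. -/
theorem exists_csub_cutDown {k n : ℕ} {a : CStarMatrix (Fin k) (Fin k) D} (ha : 0 ≤ a)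
    {q : CStarMatrix (Fin n) (Fin n) (Stab D)} (hq : IsStarProjection q)
    (h1 : CuntzSub q (oneByOne (Stab.hom k a))) (h2 : CuntzSub (oneByOne (Stab.hom k a)) q) :
    ∃ δ : ℝ, 0 < δ ∧ CSub a (cutDown a δ) := by
  have hB : ∀ j : ℕ, 0 ≤ oneByOne (Stab.hom k (cutDown a (1 / ((j : ℝ) + 1)))) := fun j =>
    oneByOne_hom_nonneg (cutDown_nonneg a _)
  obtain ⟨j, hj⟩ := exists_projection_cuntzSub hq hB (tendsto_oneByOne_hom_cutDown ha) h1
  exact ⟨_, Nat.one_div_pos_of_nat, csub_of_cuntzSub_hom (h2.trans hj)⟩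

theorem cls_hom_ne_projection {k : ℕ} (hD : IsFinite' (CStarMatrix (Fin k) (Fin k) D))
    {a : CStarMatrix (Fin k) (Fin k) D} (ha : 0 ≤ a) (hz : ZeroLimit a)
    (ha' : 0 ≤ oneByOne (Stab.hom k a)) : ¬ ∃ (n : ℕ) (q : CStarMatrix (Fin n) (Fin n) (Stab D))
      (hq : IsStarProjection q), cls (oneByOne (Stab.hom k a)) ha' = cls q (projection_nonneg hq) := by
  rintro ⟨n, q, hq, h⟩
  obtain ⟨δ, hδ, hs⟩ := exists_csub_cutDown ha hq (cls_le_cls.1 h.ge) (cls_le_cls.1 h.le)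
  obtain ⟨t, ht, ht0, htj⟩ := hz (δ / 2) (by positivity)
  exact false_of_csub_cutDown hD ha hs ht ht0 (by linarith)

/-- The lower right block of an inverse of a ⊕ b inverts b. This makes the spectrum of b part of
that of a ⊕ b, so a single summand with small spectrum is enough in `PurelyPos`. -/
theorem isUnit_of_dsum {m n : ℕ} {a : CStarMatrix (Fin m) (Fin m) D}
    {b : CStarMatrix (Fin n) (Fin n) D} (h : IsUnit (dsum a b)) : IsUnit b := by
  obtain ⟨X, hX, hX'⟩ := isUnit_iff_exists.1 h
  refine isUnit_iff_exists.2
    ⟨CStarMatrix.ofMatrix (Matrix.of fun i j => X (Fin.natAdd m i) (Fin.natAdd m j)), ?_, ?_⟩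
  · ext i j
    have := congrArg (fun M => M (Fin.natAdd m i) (Fin.natAdd m j)) hX
    simp only [CStarMatrix.mul_apply, Fin.sum_univ_add, dsum_right_left, dsum_right_right, zero_mul,
      Finset.sum_const_zero, zero_add, CStarMatrix.one_apply, Fin.natAdd_inj] at this
    rw [CStarMatrix.mul_apply, CStarMatrix.one_apply]
    exact this
  · ext i j
    have := congrArg (fun M => M (Fin.natAdd m i) (Fin.natAdd m j)) hX'
    simp only [CStarMatrix.mul_apply, Fin.sum_univ_add, dsum_left_right, dsum_right_right, mul_zero,
      Finset.sum_const_zero, zero_add, CStarMatrix.one_apply, Fin.natAdd_inj] at this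
    rw [CStarMatrix.mul_apply, CStarMatrix.one_apply]
    exact this

theorem ZeroLimit.dsum {m n : ℕ} (a : CStarMatrix (Fin m) (Fin m) D)
    {b : CStarMatrix (Fin n) (Fin n) D} (h : ZeroLimit b) : ZeroLimit (dsum a b) := by
  intro δ hδ
  obtain ⟨t, ht, h0, h1⟩ := h δ hδ
  refine ⟨t, fun hu => ht ?_, h0, h1⟩
  have e := (dsum_sub _ a _ b).symm.trans
    (congrArg (· - CuntzSemigroup.dsum a b) (dsum_algebraMap (D := D) m n t))
  exact isUnit_of_dsum ((congrArg IsUnit e).mpr hu)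

theorem spectrum_starHom {E F : Type*} [CStarAlgebra E] [CStarAlgebra F] {f : E →⋆ₙₐ[ℂ] F}
    (hf : Function.Injective f) (h1 : f 1 = 1) {a : E} (ha : IsSelfAdjoint a) :
    spectrum ℝ (f a) = spectrum ℝ a := by
  let g : E →⋆ₐ[ℂ] F :=
    { f with
      map_one' := h1
      commutes' := fun c => by
        change f (algebraMap ℂ E c) = _
        rw [Algebra.algebraMap_eq_smul_one, map_smul, h1, Algebra.algebraMap_eq_smul_one] }
  exact ha.map_spectrum_real g hf

variable {G A : Type*} [Group G] [Fintype G] [CStarAlgebra A] [PartialOrder A] [StarOrderedRing A]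
variable {α : G →* (A ≃⋆ₐ[ℂ] A)}

theorem ZeroLimit.map_incl {n : ℕ} {a : CStarMatrix (Fin n) (Fin n) A} (ha : 0 ≤ a)
    (h : ZeroLimit a) : ZeroLimit (a.map (CrossedProduct.incl α)) := by
  have := spectrum_starHom (f := CStarMatrix.mapₙₐ (n := Fin n) (CrossedProduct.incl α))
    (fun M N h => CStarMatrix.ext fun i j =>
      CrossedProduct.incl_injective α (congrArg (fun X => X i j) h))
    (by
      ext i j
      change CrossedProduct.incl α ((1 : CStarMatrix (Fin n) (Fin n) A) i j) = _
      rw [CStarMatrix.one_apply, CStarMatrix.one_apply]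
      split_ifs
      · exact CrossedProduct.incl_one α
      · exact map_zero _) ha.isSelfAdjoint
  intro δ hδ
  rw [show a.map (CrossedProduct.incl α) = CStarMatrix.mapₙₐ (CrossedProduct.incl α) a from rfl, this]
  exact h δ hδ

/-- The limit point 0 of the spectrum survives direct sums and the injective unital inclusion into
the crossed product, whose matrix algebras are finite. -/
theorem PurelyPos.map_mem_cuPlus (hA : IsStablyFinite A) {x : W A} (hx : PurelyPos x) :
    W.map (Stab.incl (CrossedProduct α)) (W.map (CrossedProduct.incl α) x)
      ∈ CuPlus (CrossedProduct α) := by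
  obtain ⟨x₁, n, w, hw, hz, rfl⟩ := hx
  induction x₁ using W.induction with | _ m a ha
  have hn : n ≠ 0 := by
    rintro rfl
    exact hz.ne_zero (CStarMatrix.ext fun i => i.elim0)
  have : NeZero (m + n) := ⟨by omega⟩
  have hz' := (hz.dsum a).map_incl (α := α) (dsum_nonneg ha hw)
  have h0 := map_nonneg' (CrossedProduct.incl α) (dsum_nonneg ha hw)
  rw [cls_add_cls, W.map_cls, ← Stab.cls_oneByOne_hom]
  exact ⟨_, starHom_nonneg (Stab.hom _) h0, rfl, cls_hom_ne_projection (CrossedProduct.isFinite_matrix α hA _) h0 hz' _⟩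

end PurelyPositive

end CuntzSemigroup

/-! ### The theorem. -/

open CuntzSemigroup in
theorem mainTheorem10 {A G : Type*} [CStarAlgebra A] [PartialOrder A] [StarOrderedRing A]
    [Group G] [Fintype G] (α : G →* (A ≃⋆ₐ[ℂ] A))
    (hA_simple : IsSimpleCStar A) (hA_finite : IsStablyFinite A) (hA_typeI : ¬ IsTypeI A)
    (hα : IsWeaklyTraciallyStrictlyApproxInner α)
    (hCu : AlmostUnperforated (CuPlus (CrossedProduct α) ∪ {0})) :
    AlmostUnperforated (Set.univ : Set (Cu A)) := by
  refine almostUnperforated_cu (almostUnperforated_of_purelyPos hA_simple hA_typeI ?_)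
  intro x y hx hy n hn h r hr
  -- The inequality is sent to Cu of the crossed product, improved there by the hypothesis, and
  -- pulled back at the cost of the nonzero class r.
  refine le_add_of_mapW_incl_le (noMinimal_of_not_isTypeI hA_simple hA_typeI) hA_simple.isPrimeRing
    hα (Stab.map_incl_le_map_incl ?_) hr
  refine hCu _ (Or.inl (hx.map_mem_cuPlus hA_finite)) _ (Or.inl (hy.map_mem_cuPlus hA_finite))
    n hn ?_
  simpa only [map_nsmul] using W.map_mono (Stab.incl _) (W.map_mono (CrossedProduct.incl α) h)
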